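/- Let $S$ be a closed (compact, connected) Riemann surface of genus at least $2$, let $g$ be its hyperbolic metric (the conformal metric of Gauss curvature $-1$), with area form $dA$, and let $\alpha$ be a holomorphic quadratic differential on $S$, with $K=|\alpha|^2/\det g\ge 0$ its squared length. Let $H^1(S)$ be the Sobolev space with norm $(\|\nabla v\|_2^2+\|v\|_2^2)^{1/2}$ and, for $t\in\mathbb R$, put $$I_t(v)=\tfrac12\|\nabla v\|_2^2-2t^2\int_S Ke^{v}\,dA+2\int_S e^{-v}\,dA+2\int_S v\,dA,\qquad v\in H^1(S).$$ (a) All these integrals converge for every $v\in H^1(S)$, and $I_t$ is of class $C^1$ on $H^1(S)$. (b) (Palais–Smale condition) If $t,c\in\mathbb R$ and $(v_n)$ is a sequence in $H^1(S)$ with $I_t(v_n)\to c$ and $I_t'(v_n)\to 0$ in the dual of $H^1(S)$, then $(v_n)$ has a subsequence which converges in $H^1(S)$. Moreover $c$ is a critical value of $I_t$: there is $w\in H^1(S)$ with $I_t(w)=c$ and $I_t'(w)=0$. (c) (Mountain-pass solution) Say that $v\in H^1(S)$ is a solution of problem $(1)_t$ if $-\Delta v=2t^2Ke^v-2(1-e^{-v})$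 weakly, and that such a solution is stable if $\int_S|\nabla\varphi|^2\,dA-\int_S(2t^2Ke^v-2e^{-v})\varphi^2\,dA\ge 0$ for all $\varphi\in H^1(S)$. Assume $\alpha\not\equiv 0$ and let $t_0=\sup\{t\ge 0: (1)_t \text{ has a solution}\}$. If $0<t<t_0$ and $v_{1,t}$ is a stable solution of $(1)_t$, then there is an unstable (that is, not stable) solution $v_{2,t}\in H^1(S)$ of $(1)_t$, a critical point of $I_t$, with $v_{2,t}>v_{1,t}$ almost everywhere on $S$ and $$I_t(v_{2,t})=\inf_{\Gamma\in\mathcal P_t}\ \max_{s\in[0,1]} I_t(\Gamma(s))>I_t(v_{1,t}),$$ where $\mathcal P_t$ is the set of continuous maps $\Gamma:[0,1]\to H^1(S)$ with $\Gamma(0)=v_{1,t}$ and $I_t(\Gamma(1))\le I_t(v_{1,t})-10$. -/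

import Mathlib

open MeasureTheory Set Filter Topology
open scoped Manifold ContDiff

/-! ### Transition maps of a Riemann surface -/

/-- The change of coordinates from the chart `e` to the chart `e'`. -/
noncomputable def transitionMap {S : Type*} [TopologicalSpace S]
    (e e' : OpenPartialHomeomorph S ℂ) : ℂ → ℂ := fun z => e' (e.symm z)

section Transition

variable {S : Type*} [TopologicalSpace S] [ChartedSpace ℂ S] [IsManifold 𝓘(ℂ) ω S]

theorem contDiffOn_transition {e e' : OpenPartialHomeomorph S ℂ}
    (he : e ∈ atlas ℂ S) (he' : e' ∈ atlas ℂ S) :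
    ContDiffOn ℂ ω (transitionMap e e') (e.symm.trans e').source := by
  have h := (contDiffGroupoid ω 𝓘(ℂ)).compatible he he'
  rw [contDiffGroupoid, mem_groupoid_of_pregroupoid] at h
  have h1 := h.1
  simp only [contDiffPregroupoid, modelWithCornersSelf_coe, modelWithCornersSelf_coe_symm,
    Function.comp_id, Function.id_comp, preimage_id, range_id, inter_univ] at h1
  exact h1

theorem hasDerivAt_transition {e e' : OpenPartialHomeomorph S ℂ}
    (he : e ∈ atlas ℂ S) (he' : e' ∈ atlas ℂ S) {x : S} (hx : x ∈ e.source) (hx' : x ∈ e'.source) :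
    HasDerivAt (transitionMap e e') (deriv (transitionMap e e') (e x)) (e x) := by
  have hmem : e x ∈ (e.symm.trans e').source := by
    simp [hx, hx']
  have h := (contDiffOn_transition he he').contDiffAt
    ((e.symm.trans e').open_source.mem_nhds hmem)
  exact (h.differentiableAt (by simp)).hasDerivAt

/-- A Riemann surface is in particular a real smooth surface. -/
theorem isManifold_real : IsManifold 𝓘(ℝ, ℂ) ∞ S := by
  apply isManifold_of_contDiffOn
  intro e e' he he'
  have h := ((contDiffOn_transition he he').restrict_scalars ℝ).of_le
    (show (∞ : WithTop ℕ∞) ≤ ω from le_top)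
  simp only [modelWithCornersSelf_coe, modelWithCornersSelf_coe_symm,
    Function.comp_id, Function.id_comp, preimage_id, range_id, inter_univ]
  exact h

end Transition

/-! ### Conformal hyperbolic metrics, quadratic differentials -/

/-- The Gauss curvature `-Δ (log ρ) / (2 ρ)` of the conformal metric `ρ(z) |dz|²` on a plane
domain, where `Δ` is the Euclidean Laplacian. -/
noncomputable def planarGaussCurvature (ρ : ℂ → ℝ) (z : ℂ) : ℝ :=
  -(Laplacian.laplacian (fun w => Real.log (ρ w)) z) / (2 * ρ z)

/-- A hyperbolic metric on the Riemann surface `S`, compatible with its conformal structure: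
a Riemannian metric which in every holomorphic chart `e` has the form `ρₑ(z) |dz|²` with `ρₑ`
smooth and positive, and whose Gauss curvature is `-1`. On a compact connected `S`, such a
metric exists exactly when the genus of `S` is at least two, and it is unique. -/
structure HyperbolicMetric (S : Type*) [TopologicalSpace S] [ChartedSpace ℂ S] where
  /-- the density `ρₑ` in the chart `e` (relevant only on `e.target`) -/
  density : atlas ℂ S → ℂ → ℝ
  density_pos : ∀ e : atlas ℂ S, ∀ z ∈ e.1.target, 0 < density e z
  density_smooth : ∀ e : atlas ℂ S, ContDiffOn ℝ ∞ (density e) e.1.target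
  density_compat : ∀ e e' : atlas ℂ S, ∀ x ∈ e.1.source ∩ e'.1.source,
    density e (e.1 x) = density e' (e'.1 x) * ‖deriv (transitionMap e.1 e'.1) (e.1 x)‖ ^ 2
  curvature_eq : ∀ e : atlas ℂ S, ∀ z ∈ e.1.target, planarGaussCurvature (density e) z = -1

/-- A holomorphic quadratic differential `α` on the Riemann surface `S`: in every holomorphic
chart `e`, `α = φₑ(z) dz²` with `φₑ` holomorphic. -/
structure HolomorphicQuadraticDifferential (S : Type*) [TopologicalSpace S]
    [ChartedSpace ℂ S] where
  /-- the coefficient `φₑ` in the chart `e` (relevant only on `e.target`) -/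
  coeff : atlas ℂ S → ℂ → ℂ
  coeff_holomorphic : ∀ e : atlas ℂ S, DifferentiableOn ℂ (coeff e) e.1.target
  coeff_compat : ∀ e e' : atlas ℂ S, ∀ x ∈ e.1.source ∩ e'.1.source,
    coeff e (e.1 x) = coeff e' (e'.1 x) * deriv (transitionMap e.1 e'.1) (e.1 x) ^ 2

/-- The preferred chart at `x`, as an element of the atlas. -/
noncomputable def chartOf {S : Type*} [TopologicalSpace S] [ChartedSpace ℂ S] (x : S) : atlas ℂ S :=
  ⟨chartAt ℂ x, chart_mem_atlas ℂ x⟩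

/-- The squared length `K = |α|² / det g` of `α` with respect to the hyperbolic metric `g`;
in a chart, `K = |φₑ|² / ρₑ²`, which does not depend on the chart. -/
noncomputable def HolomorphicQuadraticDifferential.normSq {S : Type*} [TopologicalSpace S]
    [ChartedSpace ℂ S] (α : HolomorphicQuadraticDifferential S) (g : HyperbolicMetric S)
    (x : S) : ℝ :=
  ‖α.coeff (chartOf x) (chartAt ℂ x x)‖ ^ 2 / g.density (chartOf x) (chartAt ℂ x x) ^ 2

/-! ### The area measure -/

theorem measurableSet_chart_preimage {S : Type*} [TopologicalSpace S]
    [MeasurableSpace S] [BorelSpace S] (e : OpenPartialHomeomorph S ℂ) {A : Set S}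
    (hA : MeasurableSet A) : MeasurableSet (e.target ∩ e.symm ⁻¹' A) := by
  classical
  have h1 : Measurable (e.target.piecewise e.symm (fun _ => e.symm 0)) :=
    e.continuousOn_symm.measurable_piecewise continuousOn_const e.open_target.measurableSet
  have h2 := (h1 hA).inter e.open_target.measurableSet
  convert h2 using 1
  ext z
  by_cases hz : z ∈ e.target <;> simp [hz, Set.piecewise]

namespace HyperbolicMetric

section Area

variable {S : Type*} [TopologicalSpace S] [ChartedSpace ℂ S]
  [MeasurableSpace S]

/-- The area measure of the domain of the chart `e`, that is `ρₑ(z) dx dy`. -/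
noncomputable def chartArea (g : HyperbolicMetric S) (e : atlas ℂ S) : Measure S :=
  Measure.map e.1.symm
    ((volume.restrict e.1.target).withDensity (fun z => ENNReal.ofReal (g.density e z)))

/-- The area measure `dA` of the metric: the smallest measure which dominates `ρₑ(z) dx dy` on
the domain of every chart `e` (and hence agrees with it there, as these are compatible). -/
noncomputable def area (g : HyperbolicMetric S) : Measure S := ⨆ e : atlas ℂ S, g.chartArea e

variable [BorelSpace S]

theorem chartArea_apply (g : HyperbolicMetric S) (e : atlas ℂ S) {A : Set S}
    (hA : MeasurableSet A) :
    g.chartArea e A =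
      ∫⁻ z in e.1.target ∩ e.1.symm ⁻¹' A, ENNReal.ofReal (g.density e z) := by
  have hm : AEMeasurable e.1.symm (volume.restrict e.1.target) :=
    e.1.continuousOn_symm.aemeasurable e.1.open_target.measurableSet
  have hac := withDensity_absolutelyContinuous (volume.restrict e.1.target)
    (fun z => ENNReal.ofReal (g.density e z))
  have hms := measurableSet_chart_preimage e.1 hA
  rw [chartArea, Measure.map_apply_of_aemeasurable (hm.mono_ac hac) hA]
  have h0 : ((volume.restrict e.1.target).withDensity
      (fun z => ENNReal.ofReal (g.density e z))) (e.1.symm ⁻¹' A)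
      = ((volume.restrict e.1.target).withDensity
      (fun z => ENNReal.ofReal (g.density e z))) (e.1.target ∩ e.1.symm ⁻¹' A) := by
    apply measure_congr
    have : ∀ᵐ z ∂((volume.restrict e.1.target).withDensity
      (fun z => ENNReal.ofReal (g.density e z))), z ∈ e.1.target :=
      hac.ae_le (ae_restrict_mem e.1.open_target.measurableSet)
    filter_upwards [this] with z hz
    simp only [eq_iff_iff]
    exact ⟨fun h => ⟨hz, h⟩, fun h => h.2⟩
  rw [h0, withDensity_apply _ hms, Measure.restrict_restrict hms]
  congr 2
  ext z
  simp only [mem_inter_iff, mem_preimage]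
  tauto

variable [IsManifold 𝓘(ℂ) ω S]

theorem chartArea_le (g : HyperbolicMetric S) (e e' : atlas ℂ S) {A : Set S}
    (hA : MeasurableSet A) (hAe : A ⊆ e.1.source) : g.chartArea e' A ≤ g.chartArea e A := by
  rw [g.chartArea_apply e hA, g.chartArea_apply e' hA]
  set B := e.1.target ∩ e.1.symm ⁻¹' (A ∩ e'.1.source) with hB
  have hBm : MeasurableSet B :=
    measurableSet_chart_preimage e.1 (hA.inter e'.1.open_source.measurableSet)
  have himg : e'.1.target ∩ e'.1.symm ⁻¹' A = transitionMap e.1 e'.1 '' B := by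
    ext w
    constructor
    · rintro ⟨hw, hwA⟩
      have h1 := hAe hwA
      refine ⟨e.1 (e'.1.symm w), ⟨e.1.map_source h1, ?_⟩, ?_⟩
      · simp only [mem_preimage, e.1.left_inv h1]
        exact ⟨hwA, e'.1.map_target hw⟩
      · simp [transitionMap, e.1.left_inv h1, e'.1.right_inv hw]
    · rintro ⟨z, ⟨hz, hzA, hz'⟩, rfl⟩
      refine ⟨e'.1.map_source hz', ?_⟩
      simpa [transitionMap, e'.1.left_inv hz'] using hzA
  have hd : ∀ z ∈ B, HasFDerivWithinAt (transitionMap e.1 e'.1)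
      ((ContinuousLinearMap.toSpanSingleton ℂ
        (deriv (transitionMap e.1 e'.1) z)).restrictScalars ℝ) B z := by
    rintro z ⟨hz, hzA, hz'⟩
    have h := hasDerivAt_transition e.2 e'.2 (e.1.map_target hz) hz'
    rw [e.1.right_inv hz] at h
    exact (h.hasFDerivAt.restrictScalars ℝ).hasFDerivWithinAt
  have hinj : InjOn (transitionMap e.1 e'.1) B := by
    rintro z ⟨hz, _, hz'⟩ w ⟨hw, _, hw'⟩ h
    exact e.1.symm.injOn hz hw (e'.1.injOn hz' hw' h)
  have hdet : ∀ a : ℂ, ((ContinuousLinearMap.toSpanSingleton ℂ a).restrictScalars ℝ).det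
      = ‖a‖ ^ 2 := by
    intro a
    rw [ContinuousLinearMap.det]
    simp [LinearMap.det_restrictScalars, Algebra.norm_complex_eq, Complex.normSq_eq_norm_sq]
  rw [himg, lintegral_image_eq_lintegral_abs_det_fderiv_mul volume hBm hd hinj]
  calc _ = ∫⁻ z in B, ENNReal.ofReal (g.density e z) := by
        apply setLIntegral_congr_fun hBm
        rintro z ⟨hz, hzA, hz'⟩
        have hc := g.density_compat e e' (e.1.symm z) ⟨e.1.map_target hz, hz'⟩
        rw [e.1.right_inv hz] at hc
        simp only [hdet]
        rw [hc, abs_of_nonneg (by positivity), ← ENNReal.ofReal_mul (by positivity), mul_comm]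
        rfl
    _ ≤ _ := lintegral_mono_set
        (show B ⊆ e.1.target ∩ e.1.symm ⁻¹' A from fun z hz => ⟨hz.1, hz.2.1⟩)

/-- On the domain of the chart `e` the area measure is `ρₑ(z) dx dy`. -/
theorem area_eq_chartArea (g : HyperbolicMetric S) (e : atlas ℂ S) {A : Set S}
    (hA : MeasurableSet A) (hAe : A ⊆ e.1.source) : g.area A = g.chartArea e A := by
  refine le_antisymm ?_ (le_iSup g.chartArea e A)
  have hle : g.area ≤ g.chartArea e + g.area.restrict (e.1.source)ᶜ := by
    refine iSup_le fun e' => Measure.le_iff.2 fun B hB => ?_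
    have hs := e.1.open_source.measurableSet
    rw [← measure_inter_add_sdiff B hs, Measure.add_apply,
      Measure.restrict_apply hB]
    refine add_le_add ((g.chartArea_le e e' (hB.inter hs) inter_subset_right).trans
      (measure_mono inter_subset_left)) ?_
    exact le_iSup g.chartArea e' _
  refine (hle A).trans ?_
  rw [Measure.add_apply, Measure.restrict_apply hA]
  have : A ∩ (e.1.source)ᶜ = ∅ := by
    rw [← Set.sdiff_eq, Set.sdiff_eq_empty]
    exact hAe
  simp [this]

instance isLocallyFiniteMeasure_area (g : HyperbolicMetric S) :
    IsLocallyFiniteMeasure g.area := by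
  constructor
  intro x
  set e : atlas ℂ S := chartOf x with he
  have hx : x ∈ e.1.source := mem_chart_source ℂ x
  have hxt : e.1 x ∈ e.1.target := e.1.map_source hx
  obtain ⟨N, hN, hNt, hNc⟩ := local_compact_nhds (e.1.open_target.mem_nhds hxt)
  obtain ⟨C, hC⟩ := hNc.bddAbove_image ((g.density_smooth e).continuousOn.mono hNt)
  have hopen : IsOpen (e.1.source ∩ e.1 ⁻¹' interior N) :=
    e.1.isOpen_inter_preimage isOpen_interior
  refine ⟨e.1.source ∩ e.1 ⁻¹' interior N,
    hopen.mem_nhds ⟨hx, mem_interior_iff_mem_nhds.2 hN⟩, ?_⟩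
  rw [g.area_eq_chartArea e hopen.measurableSet inter_subset_left,
    g.chartArea_apply e hopen.measurableSet]
  calc _ ≤ ∫⁻ _ in N, ENNReal.ofReal C := by
        refine (lintegral_mono_set (t := N) ?_).trans
          (setLIntegral_mono' hNc.measurableSet fun z hz =>
            ENNReal.ofReal_le_ofReal (hC ⟨z, hz, rfl⟩))
        rintro z ⟨hz, _, hzN⟩
        have := interior_subset hzN
        rwa [e.1.right_inv hz] at this
    _ < ⊤ := by
        rw [setLIntegral_const]
        exact ENNReal.mul_lt_top ENNReal.ofReal_lt_top hNc.measure_lt_top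

end Area

end HyperbolicMetric

/-! ### The gradient pairing -/

section Gradient

variable {S : Type*} [TopologicalSpace S] [ChartedSpace ℂ S]

/-- The Euclidean scalar product of the gradients of `u` and `v`, read in the chart `e`. -/
noncomputable def chartGradInner (e : OpenPartialHomeomorph S ℂ) (u v : S → ℝ) (z : ℂ) : ℝ :=
  fderiv ℝ (u ∘ e.symm) z 1 * fderiv ℝ (v ∘ e.symm) z 1 +
    fderiv ℝ (u ∘ e.symm) z Complex.I * fderiv ℝ (v ∘ e.symm) z Complex.I

/-- The function `⟨∇u, ∇v⟩` on `S`, with respect to the metric `g`; in a chart, it is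
`ρₑ⁻¹ (∂₁u ∂₁v + ∂₂u ∂₂v)`, which does not depend on the chart. -/
noncomputable def HyperbolicMetric.gradInner (g : HyperbolicMetric S) (u v : S → ℝ) (x : S) : ℝ :=
  (g.density (chartOf x) (chartAt ℂ x x))⁻¹ * chartGradInner (chartAt ℂ x) u v (chartAt ℂ x x)

variable [IsManifold 𝓘(ℂ) ω S]

theorem contDiffOn_comp_chart_symm {u : S → ℝ} (hu : ContMDiff 𝓘(ℝ, ℂ) 𝓘(ℝ, ℝ) ∞ u)
    (e : atlas ℂ S) : ContDiffOn ℝ ∞ (u ∘ e.1.symm) e.1.target := by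
  have := isManifold_real (S := S)
  rw [← contMDiffOn_iff_contDiffOn]
  exact hu.comp_contMDiffOn (contMDiffOn_symm_of_mem_maximalAtlas
    (IsManifold.subset_maximalAtlas e.2))

theorem HyperbolicMetric.gradInner_eq (g : HyperbolicMetric S) {u v : S → ℝ}
    (hu : ContMDiff 𝓘(ℝ, ℂ) 𝓘(ℝ, ℝ) ∞ u) (hv : ContMDiff 𝓘(ℝ, ℂ) 𝓘(ℝ, ℝ) ∞ v)
    (e : atlas ℂ S) {x : S} (hx : x ∈ e.1.source) :
    g.gradInner u v x = (g.density e (e.1 x))⁻¹ * chartGradInner e.1 u v (e.1 x) := by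
  set e' : atlas ℂ S := chartOf x with he'
  have hx' : x ∈ e'.1.source := mem_chart_source ℂ x
  set a := deriv (transitionMap e.1 e'.1) (e.1 x) with ha
  have hτ := hasDerivAt_transition e.2 e'.2 hx hx'
  have hkey : ∀ {f : S → ℝ}, ContMDiff 𝓘(ℝ, ℂ) 𝓘(ℝ, ℝ) ∞ f → ∀ w : ℂ,
      fderiv ℝ (f ∘ e.1.symm) (e.1 x) w = fderiv ℝ (f ∘ e'.1.symm) (e'.1 x) (w * a) := by
    intro f hf w
    have hf' : HasFDerivAt (f ∘ e'.1.symm) (fderiv ℝ (f ∘ e'.1.symm) (e'.1 x))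
        (transitionMap e.1 e'.1 (e.1 x)) := by
      have h1 : transitionMap e.1 e'.1 (e.1 x) = e'.1 x := by
        simp [transitionMap, e.1.left_inv hx]
      rw [h1]
      exact (((contDiffOn_comp_chart_symm hf e').contDiffAt
        (e'.1.open_target.mem_nhds (e'.1.map_source hx'))).differentiableAt
          (by simp)).hasFDerivAt
    have hc := hf'.comp (e.1 x) (hτ.hasFDerivAt.restrictScalars ℝ)
    have heq : (f ∘ e'.1.symm) ∘ transitionMap e.1 e'.1 =ᶠ[𝓝 (e.1 x)] f ∘ e.1.symm := by
      have : e.1.symm ⁻¹' e'.1.source ∈ 𝓝 (e.1 x) := by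
        apply (e.1.continuousAt_symm (e.1.map_source hx)).preimage_mem_nhds
        rw [e.1.left_inv hx]
        exact e'.1.open_source.mem_nhds hx'
      filter_upwards [this] with z hz
      simp only [Function.comp_apply, transitionMap]
      rw [e'.1.left_inv hz]
    rw [(hc.congr_of_eventuallyEq heq.symm).fderiv]
    simp [ha]
  have hlin : ∀ (L : ℂ →L[ℝ] ℝ) (b : ℂ), L b = b.re * L 1 + b.im * L Complex.I := by
    intro L b
    conv_lhs => rw [← Complex.re_add_im b]
    rw [map_add, show (b.re : ℂ) = b.re • (1 : ℂ) by simp,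
      show (b.im : ℂ) * Complex.I = b.im • Complex.I by simp, map_smul, map_smul]
    simp
  have hρ := g.density_compat e e' x ⟨hx, hx'⟩
  have hpos := g.density_pos e (e.1 x) (e.1.map_source hx)
  have hpos' := g.density_pos e' (e'.1 x) (e'.1.map_source hx')
  have hn : ‖a‖ ^ 2 = a.re ^ 2 + a.im ^ 2 := by
    rw [← Complex.normSq_eq_norm_sq, Complex.normSq_apply]; ring
  have hgrad : chartGradInner e.1 u v (e.1 x) = ‖a‖ ^ 2 * chartGradInner e'.1 u v (e'.1 x) := by
    simp only [chartGradInner, hkey hu, hkey hv, one_mul]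
    rw [hlin _ a, hlin (fderiv ℝ (v ∘ e'.1.symm) (e'.1 x)) a,
      hlin _ (Complex.I * a), hlin (fderiv ℝ (v ∘ e'.1.symm) (e'.1 x)) (Complex.I * a), hn]
    simp
    ring
  rw [hgrad, hρ]
  have hane : ‖a‖ ^ 2 ≠ 0 := by
    intro h
    rw [← ha, h, mul_zero] at hρ
    exact hpos.ne' hρ
  change (g.density e' (e'.1 x))⁻¹ * chartGradInner e'.1 u v (e'.1 x) = _
  rw [← ha, mul_inv, mul_assoc, inv_mul_cancel_left₀ hane]

theorem HyperbolicMetric.continuous_gradInner (g : HyperbolicMetric S) {u v : S → ℝ}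
    (hu : ContMDiff 𝓘(ℝ, ℂ) 𝓘(ℝ, ℝ) ∞ u) (hv : ContMDiff 𝓘(ℝ, ℂ) 𝓘(ℝ, ℝ) ∞ v) :
    Continuous (g.gradInner u v) := by
  rw [continuous_iff_continuousAt]
  intro x
  set e : atlas ℂ S := chartOf x with he
  have hx : x ∈ e.1.source := mem_chart_source ℂ x
  have hev : (fun y => (g.density e (e.1 y))⁻¹ * chartGradInner e.1 u v (e.1 y))
      =ᶠ[𝓝 x] g.gradInner u v := by
    filter_upwards [e.1.open_source.mem_nhds hx] with y hy
    exact (g.gradInner_eq hu hv e hy).symm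
  refine ContinuousAt.congr ?_ hev
  have hxt := e.1.map_source hx
  have hcont : ContinuousAt e.1 x := e.1.continuousAt hx
  have hfd : ∀ {f : S → ℝ}, ContMDiff 𝓘(ℝ, ℂ) 𝓘(ℝ, ℝ) ∞ f → ∀ w : ℂ,
      ContinuousAt (fun z => fderiv ℝ (f ∘ e.1.symm) z w) (e.1 x) := by
    intro f hf w
    have h1 := (contDiffOn_comp_chart_symm hf e).continuousOn_fderiv_of_isOpen
      e.1.open_target (by simp)
    exact (h1.continuousAt (e.1.open_target.mem_nhds hxt)).clm_apply continuousAt_const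
  have hG : ContinuousAt (fun z => (g.density e z)⁻¹ * chartGradInner e.1 u v z) (e.1 x) := by
    refine ContinuousAt.mul (ContinuousAt.inv₀ ((g.density_smooth e).continuousOn.continuousAt
      (e.1.open_target.mem_nhds hxt)) (g.density_pos e _ hxt).ne') ?_
    exact ((hfd hu 1).mul (hfd hv 1)).add ((hfd hu Complex.I).mul (hfd hv Complex.I))
  exact hG.comp (f := e.1) hcont

end Gradient

/-! ### The Sobolev space `H¹(S)` -/

section Sobolev

variable {S : Type*} [TopologicalSpace S] [ChartedSpace ℂ S]

/-- The space `C^∞(S)` of smooth real functions on `S`, to be equipped with the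
`H¹` scalar product of the metric `g`. -/
def SmoothFunctions (_g : HyperbolicMetric S) : Type _ := C^∞⟮𝓘(ℝ, ℂ), S; 𝓘(ℝ, ℝ), ℝ⟯

namespace SmoothFunctions

variable {g : HyperbolicMetric S}

noncomputable instance : AddCommGroup (SmoothFunctions g) :=
  inferInstanceAs (AddCommGroup C^∞⟮𝓘(ℝ, ℂ), S; 𝓘(ℝ, ℝ), ℝ⟯)

noncomputable instance : Module ℝ (SmoothFunctions g) :=
  inferInstanceAs (Module ℝ C^∞⟮𝓘(ℝ, ℂ), S; 𝓘(ℝ, ℝ), ℝ⟯)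

/-- The function underlying an element of `C^∞(S)`. -/
noncomputable def val (u : SmoothFunctions g) : S → ℝ :=
  (show C^∞⟮𝓘(ℝ, ℂ), S; 𝓘(ℝ, ℝ), ℝ⟯ from u : S → ℝ)

theorem contMDiff_val (u : SmoothFunctions g) : ContMDiff 𝓘(ℝ, ℂ) 𝓘(ℝ, ℝ) ∞ u.val :=
  ContMDiffMap.contMDiff (show C^∞⟮𝓘(ℝ, ℂ), S; 𝓘(ℝ, ℝ), ℝ⟯ from u)

theorem continuous_val (u : SmoothFunctions g) : Continuous u.val := u.contMDiff_val.continuous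

@[simp] theorem val_add (u v : SmoothFunctions g) : (u + v).val = u.val + v.val := rfl

@[simp] theorem val_smul (r : ℝ) (u : SmoothFunctions g) : (r • u).val = r • u.val := rfl

theorem gradInner_self_nonneg (u : SmoothFunctions g) (x : S) :
    0 ≤ g.gradInner u.val u.val x := by
  have h := g.density_pos (chartOf x) _ (mem_chart_target ℂ x)
  refine mul_nonneg (inv_nonneg.2 h.le) ?_
  unfold chartGradInner
  nlinarith

variable [IsManifold 𝓘(ℂ) ω S]

theorem differentiableAt_chart (u : SmoothFunctions g) (x : S) :
    DifferentiableAt ℝ (u.val ∘ (chartAt ℂ x).symm) (chartAt ℂ x x) :=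
  ((contDiffOn_comp_chart_symm u.contMDiff_val (chartOf x)).contDiffAt
    ((chartAt ℂ x).open_target.mem_nhds (mem_chart_target ℂ x))).differentiableAt (by simp)

theorem gradInner_add (u v w : SmoothFunctions g) :
    g.gradInner (u + v).val w.val = g.gradInner u.val w.val + g.gradInner v.val w.val := by
  funext x
  have h : fderiv ℝ ((u + v).val ∘ (chartAt ℂ x).symm) (chartAt ℂ x x) =
      fderiv ℝ (u.val ∘ (chartAt ℂ x).symm) (chartAt ℂ x x) +
        fderiv ℝ (v.val ∘ (chartAt ℂ x).symm) (chartAt ℂ x x) :=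
    fderiv_add (u.differentiableAt_chart x) (v.differentiableAt_chart x)
  simp only [HyperbolicMetric.gradInner, chartGradInner, Pi.add_apply, h,
    add_apply]
  ring

theorem gradInner_smul (r : ℝ) (u v : SmoothFunctions g) :
    g.gradInner (r • u).val v.val = r • g.gradInner u.val v.val := by
  funext x
  have h : fderiv ℝ ((r • u).val ∘ (chartAt ℂ x).symm) (chartAt ℂ x x) =
      r • fderiv ℝ (u.val ∘ (chartAt ℂ x).symm) (chartAt ℂ x x) :=
    fderiv_const_smul (u.differentiableAt_chart x) r
  simp only [HyperbolicMetric.gradInner, chartGradInner, Pi.smul_apply, h,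
    smul_apply, smul_eq_mul]
  ring

variable [CompactSpace S] [MeasurableSpace S] [BorelSpace S]

theorem integrable_gradInner (u v : SmoothFunctions g) :
    Integrable (g.gradInner u.val v.val) g.area :=
  (g.continuous_gradInner u.contMDiff_val v.contMDiff_val).integrable_of_hasCompactSupport
    (HasCompactSupport.of_compactSpace _)

theorem integrable_mul (u v : SmoothFunctions g) :
    Integrable (fun x => u.val x * v.val x) g.area :=
  (u.continuous_val.mul v.continuous_val).integrable_of_hasCompactSupport
    (HasCompactSupport.of_compactSpace _)

/-- The `H¹` scalar product `∫ ⟨∇u, ∇v⟩ dA + ∫ u v dA` on `C^∞(S)`. -/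
noncomputable abbrev innerCore : PreInnerProductSpace.Core ℝ (SmoothFunctions g) where
  inner u v := ∫ x, g.gradInner u.val v.val x ∂g.area + ∫ x, u.val x * v.val x ∂g.area
  conj_inner_symm u v := by
    simp only [HyperbolicMetric.gradInner, chartGradInner, conj_trivial, mul_comm]
  re_inner_nonneg u :=
    add_nonneg (integral_nonneg fun x => u.gradInner_self_nonneg x)
      (integral_nonneg fun x => mul_self_nonneg _)
  add_left u v w := by
    simp only [gradInner_add, Pi.add_apply]
    simp only [val_add, Pi.add_apply, add_mul]
    rw [integral_add (integrable_gradInner u w) (integrable_gradInner v w),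
      integral_add (integrable_mul u w) (integrable_mul v w)]
    ring
  smul_left u v r := by
    simp only [gradInner_smul]
    simp only [val_smul, Pi.smul_apply, smul_eq_mul, conj_trivial, mul_assoc,
      integral_const_mul]
    ring

noncomputable instance : SeminormedAddCommGroup (SmoothFunctions g) :=
  InnerProductSpace.Core.toSeminormedAddCommGroup (𝕜 := ℝ) (c := innerCore)

noncomputable instance : InnerProductSpace ℝ (SmoothFunctions g) :=
  InnerProductSpace.ofCore innerCore

theorem inner_def (u v : SmoothFunctions g) :
    inner ℝ u v =
      ∫ x, g.gradInner u.val v.val x ∂g.area + ∫ x, u.val x * v.val x ∂g.area := rfl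

/-- The class of a smooth function in `L²(S)`. -/
noncomputable def toL2Linear : SmoothFunctions g →ₗ[ℝ] Lp ℝ 2 g.area where
  toFun u := ContinuousMap.toLp 2 g.area ℝ ⟨u.val, u.continuous_val⟩
  map_add' u v := by rw [← map_add]; rfl
  map_smul' r u := by rw [RingHom.id_apply, ← map_smul]; rfl

theorem coeFn_toL2Linear (u : SmoothFunctions g) : toL2Linear u =ᵐ[g.area] u.val :=
  ContinuousMap.coeFn_toLp g.area (𝕜 := ℝ) ⟨u.val, u.continuous_val⟩

theorem inner_toL2Linear (u v : SmoothFunctions g) :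
    inner ℝ (toL2Linear u) (toL2Linear v) = ∫ x, u.val x * v.val x ∂g.area := by
  rw [L2.inner_def]
  refine integral_congr_ae ?_
  filter_upwards [coeFn_toL2Linear u, coeFn_toL2Linear v] with x hu hv
  simp [hu, hv, mul_comm]

theorem norm_toL2Linear_le (u : SmoothFunctions g) : ‖toL2Linear u‖ ≤ 1 * ‖u‖ := by
  rw [one_mul]
  refine le_of_sq_le_sq ?_ (norm_nonneg _)
  rw [← real_inner_self_eq_norm_sq, ← real_inner_self_eq_norm_sq, inner_toL2Linear, inner_def]
  exact le_add_of_nonneg_left (integral_nonneg fun x => u.gradInner_self_nonneg x)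

/-- The inclusion of `C^∞(S)`, with its `H¹` seminorm, into `L²(S)`. -/
noncomputable def toL2CLM : SmoothFunctions g →L[ℝ] Lp ℝ 2 g.area :=
  LinearMap.mkContinuous (E := SmoothFunctions g) (F := Lp ℝ 2 g.area) (σ := RingHom.id ℝ)
    toL2Linear 1 norm_toL2Linear_le

end SmoothFunctions

variable [IsManifold 𝓘(ℂ) ω S] [CompactSpace S] [MeasurableSpace S] [BorelSpace S]

/-- The Sobolev space `H¹(S)`: the completion of `C^∞(S)` for the norm
`(‖∇u‖₂² + ‖u‖₂²)^(1/2)`. It is a real Hilbert space. -/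
abbrev SobolevH1 (g : HyperbolicMetric S) : Type _ :=
  UniformSpace.Completion (SmoothFunctions g)

namespace SobolevH1

variable {g : HyperbolicMetric S}

/-- The inclusion `H¹(S) → L²(S)`, which extends the one of smooth functions. -/
noncomputable def toL2 : SobolevH1 g →L[ℝ] Lp ℝ 2 g.area :=
  SmoothFunctions.toL2CLM.extend UniformSpace.Completion.toComplL

/-- The function on `S`, defined almost everywhere, underlying an element of `H¹(S)`. -/
noncomputable def fn (v : SobolevH1 g) : S → ℝ := toL2 v

/-- The pairing `∫ ⟨∇v, ∇w⟩ dA` on `H¹(S)`, which is the `H¹` scalar product minus the `L²` one. -/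
noncomputable def gradPairing (v w : SobolevH1 g) : ℝ := inner ℝ v w - inner ℝ (toL2 v) (toL2 w)

theorem toL2_coe (u : SmoothFunctions g) :
    toL2 (u : SobolevH1 g) = SmoothFunctions.toL2Linear u :=
  ContinuousLinearMap.extend_eq _ UniformSpace.Completion.denseRange_coe
    (UniformSpace.Completion.isUniformInducing_coe _) u

/-- For smooth `u`, the function underlying the corresponding element of `H¹(S)` is `u`. -/
theorem fn_coe (u : SmoothFunctions g) : fn (u : SobolevH1 g) =ᵐ[g.area] u.val := by
  rw [fn, toL2_coe]
  exact u.coeFn_toL2Linear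

theorem gradPairing_coe (u v : SmoothFunctions g) :
    gradPairing (u : SobolevH1 g) (v : SobolevH1 g) =
      ∫ x, g.gradInner u.val v.val x ∂g.area := by
  rw [gradPairing, toL2_coe, toL2_coe, UniformSpace.Completion.inner_coe,
    SmoothFunctions.inner_toL2Linear, SmoothFunctions.inner_def, add_sub_cancel_right]

end SobolevH1

end Sobolev

/-! ### The functional `I_t` and the problem `(1)_t` -/

section Functional

variable {S : Type*} [TopologicalSpace S] [ChartedSpace ℂ S] [IsManifold 𝓘(ℂ) ω S]
  [CompactSpace S] [MeasurableSpace S] [BorelSpace S] {g : HyperbolicMetric S}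

/-- The functional
`I_t(v) = ½ ‖∇v‖₂² - 2 t² ∫ K e^v dA + 2 ∫ e^{-v} dA + 2 ∫ v dA` on `H¹(S)`, where `K = |α|²`. -/
noncomputable def gaussFunctional (α : HolomorphicQuadraticDifferential S) (t : ℝ)
    (v : SobolevH1 g) : ℝ :=
  1 / 2 * v.gradPairing v - 2 * t ^ 2 * ∫ x, α.normSq g x * Real.exp (v.fn x) ∂g.area
    + 2 * ∫ x, Real.exp (-v.fn x) ∂g.area + 2 * ∫ x, v.fn x ∂g.area

/-- `v` is a (weak) solution in `H¹(S)` of the problem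
`(1)_t : -Δv = 2 t² K e^v - 2 (1 - e^{-v})`. -/
def IsGaussSolution (α : HolomorphicQuadraticDifferential S) (t : ℝ) (v : SobolevH1 g) : Prop :=
  ∀ φ : SobolevH1 g, v.gradPairing φ =
    ∫ x, (2 * t ^ 2 * α.normSq g x * Real.exp (v.fn x) - 2 * (1 - Real.exp (-v.fn x)))
      * φ.fn x ∂g.area

/-- `v` is a stable solution of `(1)_t`: the linearized operator
`φ ↦ -Δφ - (2 t² K e^v - 2 e^{-v}) φ` at `v` is nonnegative definite on `H¹(S)`. -/
def IsStableGaussSolution (α : HolomorphicQuadraticDifferential S) (t : ℝ)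
    (v : SobolevH1 g) : Prop :=
  IsGaussSolution α t v ∧ ∀ φ : SobolevH1 g,
    0 ≤ φ.gradPairing φ -
      ∫ x, (2 * t ^ 2 * α.normSq g x * Real.exp (v.fn x) - 2 * Real.exp (-v.fn x))
        * φ.fn x ^ 2 ∂g.area

/-- `t₀ = sup {t ≥ 0 | (1)_t has a solution}` (the set contains `0`, and is bounded unless
`α` vanishes identically). -/
noncomputable def maximalParameter (g : HyperbolicMetric S)
    (α : HolomorphicQuadraticDifferential S) : ℝ :=
  sSup {t : ℝ | 0 ≤ t ∧ ∃ v : SobolevH1 g, IsGaussSolution α t v}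

/-- The continuous paths in `H¹(S)` which start at `v₁` and end at a point where
`I_t ≤ I_t(v₁) - 10`. -/
def mountainPassPaths (α : HolomorphicQuadraticDifferential S) (t : ℝ) (v₁ : SobolevH1 g) :
    Set C(unitInterval, SobolevH1 g) :=
  {Γ | Γ 0 = v₁ ∧ gaussFunctional α t (Γ 1) ≤ gaussFunctional α t v₁ - 10}

/-- `v₂` is a mountain-pass solution of `(1)_t` over `v₁`: it is an unstable solution, larger than
`v₁`, at the level `inf_Γ max_s I_t(Γ(s))`, which exceeds `I_t(v₁)`. -/
structure IsMountainPassSolution (α : HolomorphicQuadraticDifferential S) (t : ℝ)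
    (v₁ v₂ : SobolevH1 g) : Prop where
  critical : HasFDerivAt (gaussFunctional (g := g) α t) (0 : SobolevH1 g →L[ℝ] ℝ) v₂
  solution : IsGaussSolution α t v₂
  unstable : ¬ IsStableGaussSolution α t v₂
  larger : ∀ᵐ x ∂g.area, v₁.fn x < v₂.fn x
  level : IsGLB {m : ℝ | ∃ Γ ∈ mountainPassPaths α t v₁,
    IsGreatest (range fun s => gaussFunctional α t (Γ s)) m} (gaussFunctional α t v₂)
  level_gt : gaussFunctional α t v₁ < gaussFunctional α t v₂

end Functional

/-!
# Palais–Smale condition and mountain-pass solutions of `-Δv = 2 t² K e^v - 2 (1 - e^{-v})`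

Since `H¹(S)` is defined as a completion, its analysis starts from smooth functions read in charts.
The Poincaré inequality on convex plane domains, applied to the cells of a fine grid, bounds the
`L²` norm by a small multiple of the energy plus finitely many averages
(`SmoothFunctions.rellich`), so weak convergence in `H¹(S)` is strong convergence in `L²(S)`
(`SobolevH1.IsWeakLimit.tendsto_toL2`). Weak limits are taken along a fixed ultrafilter, which
spares the extraction of subsequences. The exponential terms need only a weak form of the
Moser–Trudinger inequality: `∫ e^{p|v|}` is bounded on bounded sets of `H¹(S)`. It follows from the
Sobolev inequality `‖w‖₂ ≤ C (‖∇w‖₁ + ‖w‖₁)` for truncations of `v` at consecutive integer levels,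
which makes the areas of the sets `{j ≤ v}` decay faster than any geometric sequence
(`SmoothFunctions.exists_lintegral_exp_le`). With it, `I_t` is of class `C¹`
(`contDiff_gaussFunctional`), and `∫ w e^v a φ` is controlled by the `L²` norm of `φ`
(`SobolevH1.exists_integral_exp_mul_le_norm_toL2`).

*Palais–Smale.* Testing `I_t'(v_n) → 0` with the constant `1` bounds both exponential integrals, in
particular the mean of `v_n` from below; the bound on `I_t(v_n)` then bounds the energy and the
mean, hence the norm (`exists_norm_le_of_fderiv_le`). Testing with `v_n - w`, where `w` is a weak
limit, all terms but the energy of `v_n - w` tend to zero by compactness, so the convergence is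
strong (`tendsto_of_isWeakLimit`).

*Mountain pass.* As the nonlinearity is strictly convex in `v`, a stable solution lies below every
solution for the same or a larger parameter (`IsStableGaussSolution.fn_le`). For `t < t₀` there is a
solution `w` with a larger parameter; paired with `w - v₁`, a nonnegative null vector of the second
variation at the stable solution `v₁` must vanish, because `K > 0` almost everywhere. So the second
variation is coercive (`IsStableGaussSolution.exists_coercive`), and `v₁` is a strict local minimum,
surrounded by a barrier, while `I_t → -∞` along the constants. Ekeland's principle on the space of
paths (`exists_almost_critical_of_minimax`) yields a Palais–Smale sequence at the minimax level, and
so a solution `v₂` at this level. If `v₂` were stable, then comparison in both directions would give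
`v₁ = v₂`, which is excluded by the energies; hence `v₂` is unstable. Finally `v₂ ≥ v₁` by
comparison, and the inequality is strict almost everywhere by a strong maximum principle for weak
supersolutions (`ae_pos_or_ae_eq_zero`): the test function `√(u² + a) - u` bounds the energy of
`arsinh (u / √a)` independently of `a`, which is incompatible, as `a → 0`, with `u` vanishing on one
set of positive measure and not on another.
-/

set_option linter.unusedSectionVars false

/-! ### Weak limits, Ekeland's principle and the minimax principle in Hilbert spaces -/

section Abstract

/-- A bounded family in a Hilbert space converges weakly along every ultrafilter. -/
theorem exists_weak_limit {H ι : Type*} [NormedAddCommGroup H] [InnerProductSpace ℝ H]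
    [CompleteSpace H] (U : Ultrafilter ι) (v : ι → H) (R : ℝ) (hv : ∀ i, ‖v i‖ ≤ R) :
    ∃ w : H, ‖w‖ ≤ R ∧ ∀ y, Tendsto (fun i => inner ℝ (v i) y) U (𝓝 (inner ℝ w y)) := by
  have hb : ∀ y i, |inner ℝ (v i) y| ≤ R * ‖y‖ := fun y i =>
    (abs_real_inner_le_norm _ _).trans (mul_le_mul_of_nonneg_right (hv i) (norm_nonneg _))
  have hex : ∀ y, ∃ l : ℝ, Tendsto (fun i => inner ℝ (v i) y) U (𝓝 l) := by
    intro y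
    obtain ⟨l, -, hl⟩ := (isCompact_Icc (a := -(R * ‖y‖)) (b := R * ‖y‖)).ultrafilter_le_nhds
      (U.map fun i => inner ℝ (v i) y) (le_principal_iff.2 (mem_map.2
        (univ_mem' fun i => abs_le.1 (hb y i))))
    exact ⟨l, hl⟩
  choose L hL using hex
  let ℓ : H →L[ℝ] ℝ := LinearMap.mkContinuous
    { toFun := L
      map_add' := fun x y => tendsto_nhds_unique (hL (x + y)) (by
        simpa only [inner_add_right] using (hL x).add (hL y))
      map_smul' := fun r x => tendsto_nhds_unique (hL (r • x)) (by
        simpa only [inner_smul_right, RCLike.ofReal_real_eq_id, id, RingHom.id_apply, smul_eq_mul]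
          using (hL x).const_mul r) } R
    (fun y => le_of_tendsto (hL y).abs (Eventually.of_forall (hb y)))
  have hw : ∀ y, inner ℝ ((InnerProductSpace.toDual ℝ H).symm ℓ) y = L y := fun y => by
    rw [InnerProductSpace.toDual_symm_apply]; rfl
  refine ⟨(InnerProductSpace.toDual ℝ H).symm ℓ, ?_, fun y => by rw [hw]; exact hL y⟩
  set w := (InnerProductSpace.toDual ℝ H).symm ℓ
  have h1 : ‖w‖ * ‖w‖ ≤ R * ‖w‖ := by
    rw [← real_inner_self_eq_norm_mul_norm, hw]
    exact le_of_tendsto (hL w) (Eventually.of_forall fun i => (le_abs_self _).trans (hb w i))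
  rcases (norm_nonneg w).eq_or_lt' with h0 | h0
  · rw [h0]
    obtain ⟨i⟩ : Nonempty ι := U.neBot.nonempty
    exact (norm_nonneg _).trans (hv i)
  · exact le_of_mul_le_mul_right h1 h0

/-- Ekeland's variational principle. -/
theorem exists_ekeland_point {X : Type*} [MetricSpace X] [CompleteSpace X] {Φ : X → ℝ}
    (hΦ : LowerSemicontinuous Φ) {m : ℝ} (hm : ∀ x, m ≤ Φ x) {ε : ℝ} (hε : 0 < ε) (x₀ : X) :
    ∃ x, Φ x ≤ Φ x₀ ∧ ∀ y, Φ x - ε * dist x y ≤ Φ y := by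
  let T : X → Set X := fun x => {y | Φ y + ε * dist x y ≤ Φ x}
  have hself : ∀ x, x ∈ T x := fun x => by simp [T]
  have htrans : ∀ {x y z}, y ∈ T x → z ∈ T y → z ∈ T x := by
    intro x y z hy hz
    have := mul_le_mul_of_nonneg_left (dist_triangle x y z) hε.le
    simp only [T, mem_ofPred_eq] at *
    linarith
  have hclosed : ∀ x, IsClosed (T x) := fun x =>
    (hΦ.add (continuous_const.mul (continuous_const.dist continuous_id)).lowerSemicontinuous
      ).isClosed_preimage (Φ x)
  have hbdd : ∀ x, BddBelow (Φ '' T x) := fun x => ⟨m, by rintro _ ⟨y, -, rfl⟩; exact hm y⟩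
  have hstep : ∀ (x : X) (n : ℕ), ∃ y ∈ T x, Φ y ≤ sInf (Φ '' T x) + (1 / 2) ^ n := by
    intro x n
    obtain ⟨_, ⟨y, hy, rfl⟩, h⟩ := Real.lt_sInf_add_pos (s := Φ '' T x) ⟨_, x, hself x, rfl⟩
      (show (0 : ℝ) < (1 / 2) ^ n by positivity)
    exact ⟨y, hy, h.le⟩
  choose next hnext hinf using hstep
  let s : ℕ → X := fun n => Nat.rec x₀ (fun k x => next x k) n
  have hs : ∀ n, s (n + 1) = next (s n) n := fun n => rfl
  have hmem : ∀ n m, n ≤ m → s m ∈ T (s n) := by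
    intro n m hnm
    induction m, hnm using Nat.le_induction with
    | base => exact hself _
    | succ k _ ih => exact htrans ih (by rw [hs]; exact hnext _ _)
  have hanti : Antitone fun n => Φ (s n) := by
    intro n m hnm
    have h := hmem n m hnm
    simp only [T, mem_ofPred_eq] at h
    have := mul_nonneg hε.le (dist_nonneg (x := s n) (y := s m))
    linarith
  obtain ⟨ℓ, hℓ⟩ : ∃ ℓ, Tendsto (fun n => Φ (s n)) atTop (𝓝 ℓ) :=
    ⟨_, tendsto_atTop_ciInf hanti ⟨m, by rintro _ ⟨n, rfl⟩; exact hm _⟩⟩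
  have hge : ∀ n, ℓ ≤ Φ (s n) := fun n => hanti.le_of_tendsto hℓ n
  have hcau : CauchySeq s := by
    refine cauchySeq_of_le_tendsto_0' (fun n => (Φ (s n) - ℓ) / ε) (fun n m hnm => ?_) ?_
    · have h := hmem n m hnm
      simp only [T, mem_ofPred_eq] at h
      rw [le_div_iff₀ hε]
      linarith [hge m]
    · simpa using (hℓ.sub_const ℓ).div_const ε
  obtain ⟨x, hx⟩ := cauchySeq_tendsto_of_complete hcau
  have hxT : ∀ n, x ∈ T (s n) := fun n =>
    (hclosed _).mem_of_tendsto hx (eventually_atTop.2 ⟨n, fun k hk => hmem n k hk⟩)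
  have hle : ∀ n, Φ x ≤ Φ (s n) := fun n => by
    have h := hxT n
    simp only [T, mem_ofPred_eq] at h
    have := mul_nonneg hε.le (dist_nonneg (x := s n) (y := x))
    linarith
  refine ⟨x, hle 0, fun y => ?_⟩
  by_cases hy : y ∈ T x
  · have h1 : ∀ n, Φ x ≤ Φ y + (1 / 2) ^ n := fun n => by
      have h2 := hinf (s n) n
      have h3 := csInf_le (hbdd (s n)) ⟨y, htrans (hxT n) hy, rfl⟩
      have h4 := hle (n + 1)
      rw [hs] at h4
      linarith
    have h2 : Φ x ≤ Φ y + 0 := ge_of_tendsto'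
      ((tendsto_pow_atTop_nhds_zero_of_lt_one (by norm_num) (by norm_num)).const_add _) h1
    have := mul_nonneg hε.le (dist_nonneg (x := x) (y := y))
    linarith
  · simp only [T, mem_ofPred_eq, not_le] at hy
    linarith

/-- The minimax principle: almost critical points exist near the level `c` at which the paths
from `v₁` to a sublevel set `{I ≤ b}` are forced to climb. Ekeland's principle is applied to
`Γ ↦ max I ∘ Γ`, and the almost minimizing path is pushed along a truncated gradient field. -/
theorem exists_almost_critical_of_minimax {H : Type*} [NormedAddCommGroup H]
    [InnerProductSpace ℝ H] [CompleteSpace H] {I : H → ℝ} (hI : ContDiff ℝ 1 I) {v₁ : H}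
    {b c ε : ℝ} (hb : b ≤ I v₁) (hc : I v₁ < c) (hε : 0 < ε)
    (hlow : ∀ Γ : C(unitInterval, H), Γ 0 = v₁ → I (Γ 1) ≤ b → ∃ s, c ≤ I (Γ s))
    (Γ₀ : C(unitInterval, H)) (h0 : Γ₀ 0 = v₁) (h1 : I (Γ₀ 1) ≤ b) (hup : ∀ s, I (Γ₀ s) ≤ c + ε) :
    ∃ p, c ≤ I p ∧ I p ≤ c + ε ∧ ‖fderiv ℝ I p‖ < 2 * ε := by
  have hIc : Continuous I := hI.continuous
  let P : Set C(unitInterval, H) := {Γ | Γ 0 = v₁ ∧ I (Γ 1) ≤ b}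
  have hPc : IsClosed P := (isClosed_eq (ContinuousEvalConst.continuous_eval_const 0)
    continuous_const).inter (isClosed_le (hIc.comp (ContinuousEvalConst.continuous_eval_const 1))
      continuous_const)
  have : CompleteSpace P := hPc.completeSpace_coe
  let Φ : P → ℝ := fun Γ => ⨆ s, I (Γ.1 s)
  have hbd : ∀ Γ : C(unitInterval, H), BddAbove (range fun s => I (Γ s)) := fun Γ =>
    (isCompact_range (hIc.comp Γ.continuous)).bddAbove
  have hΦ : LowerSemicontinuous Φ := lowerSemicontinuous_ciSup (fun Γ => hbd Γ.1) fun s =>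
    (hIc.comp ((ContinuousEvalConst.continuous_eval_const s).comp
      continuous_subtype_val)).lowerSemicontinuous
  have hle : ∀ (Γ : P) s, I (Γ.1 s) ≤ Φ Γ := fun Γ s => le_ciSup (hbd Γ.1) s
  have hcΦ : ∀ Γ : P, c ≤ Φ Γ := fun Γ => by
    obtain ⟨s, hs⟩ := hlow Γ.1 Γ.2.1 Γ.2.2
    exact hs.trans (hle Γ s)
  obtain ⟨Γ, hΓ0, hΓ⟩ := exists_ekeland_point hΦ hcΦ hε ⟨Γ₀, h0, h1⟩
  have hΓup : Φ Γ ≤ c + ε := hΓ0.trans (ciSup_le hup)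
  -- the truncated gradient field along the path: it vanishes where `I ≤ I v₁`, in particular at
  -- the end points, and it is the gradient, cut down to length at most one, where `c ≤ I`
  let N : H → H := fun p => (InnerProductSpace.toDual ℝ H).symm (fderiv ℝ I p)
  have hN : Continuous N := (InnerProductSpace.toDual ℝ H).symm.continuous.comp
    (hI.continuous_fderiv one_ne_zero)
  let χ : ℝ → ℝ := fun y => min 1 (max 0 ((y - I v₁) / (c - I v₁)))
  have hχ : Continuous χ := by fun_prop
  have hχ0 : ∀ y, 0 ≤ χ y := fun y => le_min zero_le_one (le_max_left _ _)
  have hχ1 : ∀ y, χ y ≤ 1 := fun y => min_le_left _ _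
  have hχz : ∀ y, y ≤ I v₁ → χ y = 0 := fun y hy => by
    have : (y - I v₁) / (c - I v₁) ≤ 0 := div_nonpos_of_nonpos_of_nonneg (by linarith) (by linarith)
    simp [χ, max_eq_left this]
  have hχo : ∀ y, c ≤ y → χ y = 1 := fun y hy => by
    have : 1 ≤ (y - I v₁) / (c - I v₁) := by rw [le_div_iff₀ (by linarith)]; linarith
    exact min_eq_left (this.trans (le_max_right _ _))
  have hmx : ∀ p, 0 < max ‖N p‖ (2 * ε) := fun p => lt_max_of_lt_right (by positivity)
  let X : C(unitInterval, H) := ⟨fun s => (χ (I (Γ.1 s)) * (max ‖N (Γ.1 s)‖ (2 * ε))⁻¹) • N (Γ.1 s),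
    ((hχ.comp (hIc.comp Γ.1.continuous)).mul (((hN.comp Γ.1.continuous).norm.max
      continuous_const).inv₀ fun s => (hmx _).ne')).smul (hN.comp Γ.1.continuous)⟩
  have hX : ∀ s, X s = (χ (I (Γ.1 s)) * (max ‖N (Γ.1 s)‖ (2 * ε))⁻¹) • N (Γ.1 s) := fun s => rfl
  have hX1 : ∀ s, ‖X s‖ ≤ 1 := fun s => by
    rw [hX, norm_smul, Real.norm_of_nonneg (mul_nonneg (hχ0 _) (inv_nonneg.2 (hmx _).le)), mul_assoc]
    refine mul_le_one₀ (hχ1 _) (by have := hmx (Γ.1 s); positivity) ?_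
    rw [inv_mul_le_iff₀ (hmx _), mul_one]
    exact le_max_left _ _
  let h : ℕ → ℝ := fun k => 1 / ((k : ℝ) + 1)
  have hh : ∀ k, 0 < h k := fun k => by positivity
  have hh0 : Tendsto h atTop (𝓝 0) := tendsto_one_div_add_atTop_nhds_zero_nat
  have hmem : ∀ k, Γ.1 - h k • X ∈ P := fun k => by
    have e0 : (Γ.1 - h k • X) 0 = Γ.1 0 := by
      simp [hX, hχz (I (Γ.1 0)) (by rw [Γ.2.1])]
    have e1 : (Γ.1 - h k • X) 1 = Γ.1 1 := by
      simp [hX, hχz (I (Γ.1 1)) (Γ.2.2.trans hb)]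
    exact ⟨by rw [e0]; exact Γ.2.1, by rw [e1]; exact Γ.2.2⟩
  have hmax : ∀ k, ∃ s, Φ Γ - ε * h k ≤ I (Γ.1 s - h k • X s) := fun k => by
    obtain ⟨s, -, hs⟩ := isCompact_univ.exists_isMaxOn univ_nonempty
      (hIc.comp (Γ.1 - h k • X).continuous).continuousOn
    refine ⟨s, ?_⟩
    have e := hΓ ⟨_, hmem k⟩
    have hd : dist Γ ⟨_, hmem k⟩ ≤ h k := by
      rw [Subtype.dist_eq, dist_eq_norm, sub_sub_cancel, ContinuousMap.norm_le _ (hh k).le]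
      intro s
      rw [ContinuousMap.smul_apply, norm_smul, Real.norm_of_nonneg (hh k).le]
      exact mul_le_of_le_one_right (hh k).le (hX1 s)
    have hs' : Φ ⟨_, hmem k⟩ ≤ I (Γ.1 s - h k • X s) := ciSup_le fun t => hs (mem_univ t)
    have := mul_le_mul_of_nonneg_left hd hε.le
    linarith
  choose s hs using hmax
  obtain ⟨z, φ, hφ, hz⟩ := CompactSpace.tendsto_subseq s
  have hhφ : Tendsto (fun k => h (φ k)) atTop (𝓝 0) := hh0.comp hφ.tendsto_atTop
  have hΓz : Tendsto (fun k => Γ.1 (s (φ k))) atTop (𝓝 (Γ.1 z)) := (Γ.1.continuous.tendsto z).comp hz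
  have hXz : Tendsto (fun k => X (s (φ k))) atTop (𝓝 (X z)) := (X.continuous.tendsto z).comp hz
  have hpz : Tendsto (fun k => Γ.1 (s (φ k)) - h (φ k) • X (s (φ k))) atTop (𝓝 (Γ.1 z)) := by
    simpa using hΓz.sub (hhφ.smul hXz)
  have hIz : Φ Γ ≤ I (Γ.1 z) := by
    have := le_of_tendsto_of_tendsto' ((hhφ.const_mul ε).const_sub (Φ Γ))
      ((hIc.tendsto _).comp hpz) fun k => hs (φ k)
    simpa using this
  refine ⟨Γ.1 z, (hcΦ Γ).trans hIz, (hle Γ z).trans hΓup, ?_⟩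
  have hst := (hI.contDiffAt (x := Γ.1 z)).hasStrictFDerivAt one_ne_zero
  have ho := hst.isLittleO.comp_tendsto (hpz.prodMk_nhds hΓz)
  have hkey : fderiv ℝ I (Γ.1 z) (X z) ≤ ε := by
    refine le_of_forall_pos_le_add fun η hη => ?_
    have h2 := ho.def hη
    refine le_of_tendsto (((fderiv ℝ I (Γ.1 z)).continuous.tendsto _).comp hXz) ?_
    filter_upwards [h2] with k hk
    have hhk := hh (φ k)
    simp only [Function.comp_apply, sub_sub_cancel_left, norm_neg, map_neg, map_smul,
      smul_eq_mul, norm_smul, Real.norm_of_nonneg hhk.le] at hk ⊢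
    have h3 : η * (h (φ k) * ‖X (s (φ k))‖) ≤ η * h (φ k) :=
      mul_le_mul_of_nonneg_left (mul_le_of_le_one_right hhk.le (hX1 _)) hη.le
    have h4 := (le_abs_self _).trans (hk.trans h3)
    have h5 := hs (φ k)
    have h6 := hle Γ (s (φ k))
    have h7 : h (φ k) * fderiv ℝ I (Γ.1 z) (X (s (φ k))) ≤ h (φ k) * (ε + η) := by linarith
    exact le_of_mul_le_mul_left h7 hhk
  by_contra! hcon
  have hnorm : ‖N (Γ.1 z)‖ = ‖fderiv ℝ I (Γ.1 z)‖ := LinearIsometryEquiv.norm_map _ _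
  have hNz : fderiv ℝ I (Γ.1 z) (N (Γ.1 z)) = ‖N (Γ.1 z)‖ * ‖N (Γ.1 z)‖ := by
    rw [← real_inner_self_eq_norm_mul_norm, InnerProductSpace.toDual_symm_apply]
  have hpos : 0 < ‖N (Γ.1 z)‖ := by rw [hnorm]; linarith
  rw [hX, hχo _ ((hcΦ Γ).trans hIz), map_smul, hNz, smul_eq_mul, one_mul,
    max_eq_left (by rw [hnorm]; exact hcon), inv_mul_cancel_left₀ hpos.ne', hnorm] at hkey
  linarith

end Abstract

/-! ### The Poincaré inequality on convex plane domains -/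

section Planar

/-- The Cauchy–Schwarz inequality for lower Lebesgue integrals, in squared form. -/
theorem lintegral_mul_sq_le {α : Type*} [MeasurableSpace α] (μ : Measure α) {f h : α → ENNReal}
    (hf : AEMeasurable f μ) (hh : AEMeasurable h μ) :
    (∫⁻ x, f x * h x ∂μ) ^ 2 ≤ (∫⁻ x, f x ^ 2 ∂μ) * ∫⁻ x, h x ^ 2 ∂μ := by
  have h1 := ENNReal.lintegral_mul_le_Lp_mul_Lq μ Real.HolderConjugate.two_two hf hh
  have h2 := pow_le_pow_left' h1 2
  have h3 : ∀ a : ENNReal, (a ^ (1 / 2 : ℝ)) ^ 2 = a := fun a => by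
    rw [← ENNReal.rpow_natCast, ← ENNReal.rpow_mul]; norm_num
  simpa only [mul_pow, h3, Pi.mul_apply, ENNReal.rpow_two] using h2

theorem lintegral_comp_add_smul_le (G : ℂ → ENNReal) (hG : Measurable G) {s : ℝ} (hs : 1 / 2 ≤ s)
    (a : ℂ) : ∫⁻ x, G (a + s • x) ≤ 4 * ∫⁻ x, G x := by
  have hs0 : s ≠ 0 := by linarith
  have h1 : ∫⁻ x, G (a + s • x) = ∫⁻ y, G (a + y) ∂(Measure.map (fun x => s • x) volume) :=
    (lintegral_map (f := fun y => G (a + y)) (hG.comp (measurable_const_add a))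
      (measurable_const_smul s)).symm
  rw [h1, Measure.map_addHaar_smul _ hs0, lintegral_smul_measure, Complex.finrank_real_complex,
    lintegral_add_left_eq_self, smul_eq_mul]
  gcongr
  rw [ENNReal.ofReal_le_iff_le_toReal (by norm_num), abs_of_nonneg (by positivity)]
  rw [inv_le_comm₀ (by positivity) (by norm_num)]
  norm_num
  nlinarith

theorem enorm_sub_sq_le_lintegral_segment {D U : Set ℂ} (hD : Convex ℝ D) (hU : IsOpen U)
    (hDU : D ⊆ U) {u : ℂ → ℝ} (hu : ContDiffOn ℝ 1 u U) {x y : ℂ} (hx : x ∈ D) (hy : y ∈ D) :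
    ‖u x - u y‖ₑ ^ 2 ≤ ‖x - y‖ₑ ^ 2 * ∫⁻ s in Icc (0 : ℝ) 1,
      D.indicator (fun z => ‖fderiv ℝ u z‖ₑ ^ 2) (y + s • (x - y)) := by
  have hmem : ∀ s ∈ Icc (0 : ℝ) 1, y + s • (x - y) ∈ D := fun s hs => hD.add_smul_sub_mem hy hx hs
  have hline : ∀ s : ℝ, HasDerivAt (fun s : ℝ => y + s • (x - y)) (x - y) s := fun s => by
    simpa using ((hasDerivAt_id s).smul_const (x - y)).const_add y
  have hder : ∀ s ∈ uIcc (0 : ℝ) 1, HasDerivAt (fun s : ℝ => u (y + s • (x - y)))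
      (fderiv ℝ u (y + s • (x - y)) (x - y)) s := by
    intro s hs
    rw [uIcc_of_le zero_le_one] at hs
    have h1 := ((hu.contDiffAt (hU.mem_nhds (hDU (hmem s hs)))).differentiableAt
      one_ne_zero).hasFDerivAt
    exact h1.comp_hasDerivAt s (hline s)
  have hcont : ContinuousOn (fun s : ℝ => fderiv ℝ u (y + s • (x - y)) (x - y)) (uIcc 0 1) := by
    rw [uIcc_of_le zero_le_one]
    refine ContinuousOn.clm_apply ?_ continuousOn_const
    exact (hu.continuousOn_fderiv_of_isOpen hU le_rfl).comp (by fun_prop) fun s hs => hDU (hmem s hs)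
  have hint := intervalIntegral.integral_eq_sub_of_hasDerivAt hder hcont.intervalIntegrable
  simp only [one_smul, zero_smul, add_zero, add_sub_cancel] at hint
  have hIoc : (volume.restrict (Ioc (0 : ℝ) 1)) = volume.restrict (Icc (0 : ℝ) 1) :=
    Measure.restrict_congr_set Ioc_ae_eq_Icc
  have hmeas : AEMeasurable (fun s : ℝ => ‖fderiv ℝ u (y + s • (x - y))‖ₑ)
      (volume.restrict (Icc (0 : ℝ) 1)) := by
    have := (measurable_fderiv ℝ u).comp
      (show Measurable fun s : ℝ => y + s • (x - y) by fun_prop)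
    exact this.enorm.aemeasurable
  have h1 : ‖u x - u y‖ₑ ≤ ‖x - y‖ₑ * ∫⁻ s in Icc (0 : ℝ) 1, ‖fderiv ℝ u (y + s • (x - y))‖ₑ := by
    rw [← hint, intervalIntegral.integral_of_le zero_le_one, hIoc]
    refine (enorm_integral_le_lintegral_enorm _).trans ?_
    rw [← lintegral_const_mul'' _ hmeas]
    refine lintegral_mono fun s => ?_
    rw [mul_comm]
    exact ContinuousLinearMap.le_opENorm _ _
  have h2 : (∫⁻ s in Icc (0 : ℝ) 1, ‖fderiv ℝ u (y + s • (x - y))‖ₑ) ^ 2 ≤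
      ∫⁻ s in Icc (0 : ℝ) 1, ‖fderiv ℝ u (y + s • (x - y))‖ₑ ^ 2 := by
    have := lintegral_mul_sq_le (volume.restrict (Icc (0 : ℝ) 1)) hmeas
      (aemeasurable_const (b := (1 : ENNReal)))
    simpa using this
  calc _ ≤ (‖x - y‖ₑ * ∫⁻ s in Icc (0 : ℝ) 1, ‖fderiv ℝ u (y + s • (x - y))‖ₑ) ^ 2 := by gcongr
    _ ≤ ‖x - y‖ₑ ^ 2 * ∫⁻ s in Icc (0 : ℝ) 1, ‖fderiv ℝ u (y + s • (x - y))‖ₑ ^ 2 := by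
      rw [mul_pow]; gcongr
    _ = _ := by
      congr 1
      refine setLIntegral_congr_fun measurableSet_Icc fun s hs => ?_
      rw [indicator_of_mem (hmem s hs)]

/-- The Poincaré inequality on a convex plane domain of diameter at most `d`, in the form of an
estimate of the mean oscillation. Segments between two points are parametrized by `s ∈ [0, 1]`;
for `s ≥ 1/2` one changes variables in the end point, for `s ≤ 1/2` in the starting point. -/
theorem lintegral_lintegral_enorm_sub_sq_le {D U : Set ℂ} (hD : Convex ℝ D)
    (hDm : MeasurableSet D) (hU : IsOpen U) (hDU : D ⊆ U) {u : ℂ → ℝ} (hu : ContDiffOn ℝ 1 u U)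
    {d : ENNReal} (hd : ∀ x ∈ D, ∀ y ∈ D, ‖x - y‖ₑ ≤ d) :
    ∫⁻ x in D, ∫⁻ y in D, ‖u x - u y‖ₑ ^ 2 ≤
      4 * d ^ 2 * volume D * ∫⁻ z in D, ‖fderiv ℝ u z‖ₑ ^ 2 := by
  set G : ℂ → ENNReal := D.indicator (fun z => ‖fderiv ℝ u z‖ₑ ^ 2) with hGdef
  have hG : Measurable G := ((measurable_fderiv ℝ u).enorm.pow_const 2).indicator hDm
  have hGint : ∫⁻ z, G z = ∫⁻ z in D, ‖fderiv ℝ u z‖ₑ ^ 2 := lintegral_indicator hDm _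
  have hs : ∀ s ∈ Icc (0 : ℝ) 1, ∫⁻ x in D, ∫⁻ y in D, G (y + s • (x - y)) ≤
      volume D * (4 * ∫⁻ z, G z) := by
    intro s hs
    rcases le_total (1 / 2) s with h | h
    · rw [lintegral_lintegral_swap (by
        apply Measurable.aemeasurable
        exact hG.comp (by fun_prop : Measurable fun p : ℂ × ℂ => p.2 + s • (p.1 - p.2)))]
      calc _ ≤ ∫⁻ y in D, 4 * ∫⁻ z, G z := by
            refine lintegral_mono fun y => (setLIntegral_le_lintegral _ _).trans ?_
            have e : ∀ x, y + s • (x - y) = (y - s • y) + s • x := fun x => by rw [smul_sub]; ring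
            simp_rw [e]
            exact lintegral_comp_add_smul_le G hG h _
        _ = _ := by rw [setLIntegral_const, mul_comm]
    · calc _ ≤ ∫⁻ x in D, 4 * ∫⁻ z, G z := by
            refine lintegral_mono fun x => (setLIntegral_le_lintegral _ _).trans ?_
            have e : ∀ y, y + s • (x - y) = s • x + (1 - s) • y := fun y => by
              rw [smul_sub, sub_smul, one_smul]; ring
            simp_rw [e]
            exact lintegral_comp_add_smul_le G hG (by linarith) _
        _ = _ := by rw [setLIntegral_const, mul_comm]
  have hm3 : Measurable fun p : (ℂ × ℂ) × ℝ => G (p.1.2 + p.2 • (p.1.1 - p.1.2)) :=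
    hG.comp (by fun_prop)
  calc ∫⁻ x in D, ∫⁻ y in D, ‖u x - u y‖ₑ ^ 2
      ≤ ∫⁻ x in D, ∫⁻ y in D, d ^ 2 * ∫⁻ s in Icc (0 : ℝ) 1, G (y + s • (x - y)) := by
        refine setLIntegral_mono' hDm fun x hx => setLIntegral_mono' hDm fun y hy => ?_
        refine (enorm_sub_sq_le_lintegral_segment hD hU hDU hu hx hy).trans ?_
        gcongr
        exact hd x hx y hy
    _ = d ^ 2 * ∫⁻ x in D, ∫⁻ y in D, ∫⁻ s in Icc (0 : ℝ) 1, G (y + s • (x - y)) := by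
        have h2 : Measurable fun p : ℂ × ℂ => ∫⁻ s in Icc (0 : ℝ) 1, G (p.2 + s • (p.1 - p.2)) :=
          hm3.lintegral_prod_right'
        rw [← lintegral_const_mul _ h2.lintegral_prod_right']
        refine lintegral_congr fun x => ?_
        rw [lintegral_const_mul]
        exact h2.comp measurable_prodMk_left
    _ = d ^ 2 * ∫⁻ s in Icc (0 : ℝ) 1, ∫⁻ x in D, ∫⁻ y in D, G (y + s • (x - y)) := by
        congr 1
        have h1 : ∀ x, ∫⁻ y in D, ∫⁻ s in Icc (0 : ℝ) 1, G (y + s • (x - y)) =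
            ∫⁻ s in Icc (0 : ℝ) 1, ∫⁻ y in D, G (y + s • (x - y)) := fun x => by
          rw [lintegral_lintegral_swap]
          exact (hm3.comp (by fun_prop : Measurable fun p : ℂ × ℝ => ((x, p.1), p.2))).aemeasurable
        simp_rw [h1]
        rw [lintegral_lintegral_swap]
        have h4 : Measurable fun q : (ℂ × ℝ) × ℂ => G (q.2 + q.1.2 • (q.1.1 - q.2)) :=
          hG.comp (by fun_prop)
        exact h4.lintegral_prod_right'.aemeasurable
    _ ≤ d ^ 2 * ∫⁻ s in Icc (0 : ℝ) 1, volume D * (4 * ∫⁻ z, G z) := by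
        gcongr 1
        exact setLIntegral_mono' measurableSet_Icc hs
    _ = _ := by
        rw [setLIntegral_const, hGint]
        simp only [Real.volume_Icc, sub_zero, ENNReal.ofReal_one, mul_one]
        ring

end Planar

/-! ### Integration in charts -/

section Charts

variable {S : Type*} [TopologicalSpace S] [ChartedSpace ℂ S] [MeasurableSpace S] [BorelSpace S]
  {g : HyperbolicMetric S}

theorem measurableSet_chartPreimage (e : OpenPartialHomeomorph S ℂ) {D : Set ℂ}
    (hD : MeasurableSet D) : MeasurableSet (e.source ∩ e ⁻¹' D) := by
  classical
  have h1 : Measurable (e.source.piecewise e (fun _ => 0)) :=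
    e.continuousOn.measurable_piecewise continuousOn_const e.open_source.measurableSet
  have h2 := e.open_source.measurableSet.inter (h1 hD)
  convert h2 using 1
  ext x
  by_cases hx : x ∈ e.source <;> simp [hx]

variable [IsManifold 𝓘(ℂ) ω S]

/-- Integrals over a subset of a chart domain, in terms of the coordinate. -/
theorem setLIntegral_area_chart (g : HyperbolicMetric S) (e : atlas ℂ S) {D : Set ℂ}
    (hDm : MeasurableSet D) (hD : D ⊆ e.1.target) {f : S → ENNReal} (hf : Measurable f) :
    ∫⁻ x in e.1.source ∩ e.1 ⁻¹' D, f x ∂g.area =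
      ∫⁻ z in D, ENNReal.ofReal (g.density e z) * f (e.1.symm z) := by
  set A := e.1.source ∩ e.1 ⁻¹' D with hA
  have hAm : MeasurableSet A := measurableSet_chartPreimage e.1 hDm
  have hres : g.area.restrict A = (g.chartArea e).restrict A := by
    ext B hB
    rw [Measure.restrict_apply hB, Measure.restrict_apply hB,
      g.area_eq_chartArea e (hB.inter hAm) fun x hx => hx.2.1]
  have hac := withDensity_absolutelyContinuous (volume.restrict e.1.target)
    (fun z => ENNReal.ofReal (g.density e z))
  have hm : AEMeasurable e.1.symm (volume.restrict e.1.target) :=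
    e.1.continuousOn_symm.aemeasurable e.1.open_target.measurableSet
  have hρ : AEMeasurable (fun z => ENNReal.ofReal (g.density e z)) (volume.restrict e.1.target) :=
    ((g.density_smooth e).continuousOn.aemeasurable e.1.open_target.measurableSet).ennreal_ofReal
  have hfA : Measurable (A.indicator f) := hf.indicator hAm
  rw [hres, ← lintegral_indicator hAm, HyperbolicMetric.chartArea,
    lintegral_map' hfA.aemeasurable (hm.mono_ac hac),
    lintegral_withDensity_eq_lintegral_mul₀ hρ
      (g := fun z => A.indicator f (e.1.symm z)) (hfA.comp_aemeasurable hm),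
    ← lintegral_indicator e.1.open_target.measurableSet, ← lintegral_indicator hDm]
  refine lintegral_congr fun z => ?_
  by_cases hz : z ∈ D
  · have h1 : e.1.symm z ∈ A := ⟨e.1.map_target (hD hz), by rwa [mem_preimage, e.1.right_inv (hD hz)]⟩
    simp [hz, hD hz, h1]
  · rw [indicator_of_notMem hz]
    by_cases hz' : z ∈ e.1.target
    · have h1 : e.1.symm z ∉ A := fun h => hz (by
        have := h.2
        rwa [mem_preimage, e.1.right_inv hz'] at this)
      simp [hz', h1]
    · rw [indicator_of_notMem hz']

theorem norm_clm_sq_le (L : ℂ →L[ℝ] ℝ) : ‖L‖ ^ 2 ≤ L 1 * L 1 + L Complex.I * L Complex.I := by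
  have hn : 0 ≤ L 1 * L 1 + L Complex.I * L Complex.I := by nlinarith
  have h1 : ‖L‖ ≤ √(L 1 * L 1 + L Complex.I * L Complex.I) := by
    refine ContinuousLinearMap.opNorm_le_bound _ (Real.sqrt_nonneg _) fun b => ?_
    have h2 : L b = b.re * L 1 + b.im * L Complex.I := by
      conv_lhs => rw [← Complex.re_add_im b]
      rw [map_add, show (b.re : ℂ) = b.re • (1 : ℂ) by simp,
        show (b.im : ℂ) * Complex.I = b.im • Complex.I by simp, map_smul, map_smul]
      simp
    have h3 : ‖b‖ ^ 2 = b.re ^ 2 + b.im ^ 2 := by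
      rw [← Complex.normSq_eq_norm_sq, Complex.normSq_apply]; ring
    refine Real.norm_eq_abs (L b) ▸ abs_le_of_sq_le_sq ?_ (by positivity)
    rw [mul_pow, Real.sq_sqrt hn, h3, h2]
    nlinarith [sq_nonneg (b.re * L Complex.I - b.im * L 1)]
  calc ‖L‖ ^ 2 ≤ (√(L 1 * L 1 + L Complex.I * L Complex.I)) ^ 2 := by gcongr
    _ = _ := Real.sq_sqrt hn

theorem norm_fderiv_chart_sq_le (u : SmoothFunctions g) (e : atlas ℂ S) {z : ℂ}
    (hz : z ∈ e.1.target) :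
    ‖fderiv ℝ (u.val ∘ e.1.symm) z‖ ^ 2 ≤
      g.density e z * g.gradInner u.val u.val (e.1.symm z) := by
  rw [g.gradInner_eq u.contMDiff_val u.contMDiff_val e (e.1.map_target hz), e.1.right_inv hz,
    mul_inv_cancel_left₀ (g.density_pos e z hz).ne']
  exact norm_clm_sq_le _

/-- A coordinate disc: a disc whose closed double lies in the image of a chart `e`, with bounds for
the density of the metric there. -/
structure ChartDisc (g : HyperbolicMetric S) where
  chart : atlas ℂ S
  center : ℂ
  radius : ℝ
  lower : ℝ
  upper : ℝ
  radius_pos : 0 < radius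
  closedBall_subset : Metric.closedBall center (2 * radius) ⊆ chart.1.target
  lower_pos : 0 < lower
  lower_le : ∀ z ∈ Metric.closedBall center (2 * radius), lower ≤ g.density chart z
  le_upper : ∀ z ∈ Metric.closedBall center (2 * radius), g.density chart z ≤ upper

namespace ChartDisc

variable (B : ChartDisc g)

/-- The part of the surface with coordinate in `D`. -/
def piece (D : Set ℂ) : Set S := B.chart.1.source ∩ B.chart.1 ⁻¹' D

/-- The open subset of the surface described by the coordinate disc. -/
def disc : Set S := B.piece (Metric.ball B.center B.radius)

theorem isOpen_disc : IsOpen B.disc := B.chart.1.isOpen_inter_preimage Metric.isOpen_ball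

theorem ball_subset_closedBall_two :
    Metric.ball B.center B.radius ⊆ Metric.closedBall B.center (2 * B.radius) :=
  Metric.ball_subset_closedBall.trans (Metric.closedBall_subset_closedBall
    (by linarith [B.radius_pos]))

theorem ball_subset_target : Metric.ball B.center B.radius ⊆ B.chart.1.target :=
  B.ball_subset_closedBall_two.trans B.closedBall_subset

theorem measurableSet_piece {D : Set ℂ} (hD : MeasurableSet D) : MeasurableSet (B.piece D) :=
  measurableSet_chartPreimage _ hD

theorem upper_pos : 0 < B.upper :=
  have h := Metric.mem_closedBall_self (x := B.center) (by linarith [B.radius_pos] : 0 ≤ 2 * B.radius)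
  B.lower_pos.trans_le ((B.lower_le _ h).trans (B.le_upper _ h))

theorem setLIntegral_piece_le {D : Set ℂ} (hDm : MeasurableSet D)
    (hD : D ⊆ Metric.closedBall B.center (2 * B.radius)) {f : S → ENNReal} (hf : Measurable f) :
    ∫⁻ x in B.piece D, f x ∂g.area ≤
      ENNReal.ofReal B.upper * ∫⁻ z in D, f (B.chart.1.symm z) := by
  rw [piece, setLIntegral_area_chart g B.chart hDm (hD.trans B.closedBall_subset) hf]
  have h1 : AEMeasurable (fun z => f (B.chart.1.symm z)) (volume.restrict D) :=
    hf.comp_aemeasurable ((B.chart.1.continuousOn_symm.mono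
      (hD.trans B.closedBall_subset)).aemeasurable hDm)
  rw [← lintegral_const_mul'' _ h1]
  refine setLIntegral_mono' hDm fun z hz => ?_
  gcongr
  exact B.le_upper z (hD hz)

theorem le_setLIntegral_piece {D : Set ℂ} (hDm : MeasurableSet D)
    (hD : D ⊆ Metric.closedBall B.center (2 * B.radius)) {f : S → ENNReal} (hf : Measurable f) :
    ∫⁻ z in D, f (B.chart.1.symm z) ≤
      ENNReal.ofReal B.lower⁻¹ * ∫⁻ x in B.piece D, f x ∂g.area := by
  rw [piece, setLIntegral_area_chart g B.chart hDm (hD.trans B.closedBall_subset) hf]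
  have hsub := hD.trans B.closedBall_subset
  have h1 : AEMeasurable (fun z => f (B.chart.1.symm z)) (volume.restrict D) :=
    hf.comp_aemeasurable ((B.chart.1.continuousOn_symm.mono hsub).aemeasurable hDm)
  have h2 : AEMeasurable (fun z => ENNReal.ofReal (g.density B.chart z)) (volume.restrict D) :=
    (((g.density_smooth B.chart).continuousOn.mono hsub).aemeasurable hDm).ennreal_ofReal
  rw [← lintegral_const_mul'' (f := fun z => ENNReal.ofReal (g.density B.chart z) *
    f (B.chart.1.symm z)) _ (h2.mul h1)]
  refine setLIntegral_mono' hDm fun z hz => ?_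
  rw [← mul_assoc, ← ENNReal.ofReal_mul (inv_nonneg.2 B.lower_pos.le)]
  have h3 : 1 ≤ B.lower⁻¹ * g.density B.chart z := by
    rw [inv_mul_eq_div, one_le_div B.lower_pos]
    exact B.lower_le z (hD hz)
  calc f (B.chart.1.symm z) = 1 * f (B.chart.1.symm z) := (one_mul _).symm
    _ ≤ _ := by
      gcongr
      rwa [ENNReal.one_le_ofReal]

end ChartDisc

theorem exists_chartDisc (g : HyperbolicMetric S) (x : S) : ∃ B : ChartDisc g, x ∈ B.disc := by
  set e : atlas ℂ S := chartOf x
  have hx : x ∈ e.1.source := mem_chart_source ℂ x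
  have hxt : e.1 x ∈ e.1.target := e.1.map_source hx
  obtain ⟨r, hr, hrs⟩ := Metric.nhds_basis_closedBall.mem_iff.1 (e.1.open_target.mem_nhds hxt)
  have hK : IsCompact (Metric.closedBall (e.1 x) r) := isCompact_closedBall _ _
  have hne : (Metric.closedBall (e.1 x) r).Nonempty := ⟨_, Metric.mem_closedBall_self hr.le⟩
  have hc := (g.density_smooth e).continuousOn.mono hrs
  obtain ⟨p, hp, hpmin⟩ := hK.exists_isMinOn hne hc
  obtain ⟨q, hq, hqmax⟩ := hK.exists_isMaxOn hne hc
  have h2 : 2 * (r / 2) = r := by ring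
  refine ⟨⟨e, e.1 x, r / 2, g.density e p, g.density e q, by positivity, by rwa [h2],
    g.density_pos e p (hrs hp), ?_, ?_⟩, hx, Metric.mem_ball_self (half_pos hr)⟩
  · rw [h2]; exact fun z hz => hpmin hz
  · rw [h2]; exact fun z hz => hqmax hz

theorem exists_finset_chartDisc [CompactSpace S] (g : HyperbolicMetric S) :
    ∃ T : Finset (ChartDisc g), ⋃ B ∈ T, B.disc = univ := by
  classical
  choose B hB using exists_chartDisc g
  obtain ⟨t, ht⟩ := isCompact_univ.elim_finite_subcover (fun x => (B x).disc)
    (fun x => (B x).isOpen_disc) fun x _ => mem_iUnion.2 ⟨x, hB x⟩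
  refine ⟨t.image B, eq_univ_of_univ_subset (ht.trans ?_)⟩
  intro y hy
  simp only [mem_iUnion, Finset.mem_image, exists_prop] at hy ⊢
  obtain ⟨x, hx, h⟩ := hy
  exact ⟨_, ⟨x, hx, rfl⟩, h⟩

theorem lintegral_le_sum_disc {μ : Measure S} {T : Finset (ChartDisc g)}
    (hT : ⋃ B ∈ T, B.disc = univ) (f : S → ENNReal) :
    ∫⁻ x, f x ∂μ ≤ ∑ B ∈ T, ∫⁻ x in B.disc, f x ∂μ := by
  have h := lintegral_iUnion_le (μ := μ) (fun B : T => B.1.disc) f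
  rw [tsum_fintype, Finset.sum_coe_sort T fun B => ∫⁻ x in B.disc, f x ∂μ] at h
  have h2 : ⋃ B : T, B.1.disc = univ := by
    rw [← hT]
    exact iUnion_subtype (fun B => B ∈ T) fun B => B.1.disc
  rwa [h2, setLIntegral_univ] at h

end Charts

/-! ### Poincaré and Rellich inequalities for smooth functions -/

/-- The mean oscillation of `f` as a variance. -/
theorem lintegral_lintegral_enorm_sub_sq {α : Type*} [MeasurableSpace α] (ν : Measure α)
    [IsFiniteMeasure ν] {f : α → ℝ} (hf : MemLp f 2 ν) :
    ∫⁻ x, ∫⁻ y, ‖f x - f y‖ₑ ^ 2 ∂ν ∂ν =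
      ENNReal.ofReal (2 * (ν.real univ * ∫ x, f x ^ 2 ∂ν - (∫ x, f x ∂ν) ^ 2)) := by
  have hf1 : Integrable f ν := hf.integrable (by norm_num)
  have hf2 : Integrable (fun x => f x ^ 2) ν := hf.integrable_sq
  have e : ∀ a : ℝ, ‖a‖ₑ ^ 2 = ENNReal.ofReal (a ^ 2) := fun a => by
    rw [← ofReal_norm, ← ENNReal.ofReal_pow (norm_nonneg _), Real.norm_eq_abs, sq_abs]
  have h1 : ∀ x, ∫⁻ y, ‖f x - f y‖ₑ ^ 2 ∂ν = ENNReal.ofReal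
      (f x ^ 2 * ν.real univ - 2 * f x * ∫ y, f y ∂ν + ∫ y, f y ^ 2 ∂ν) := by
    intro x
    have hi : Integrable (fun y => (f x - f y) ^ 2) ν := ((memLp_const _).sub hf).integrable_sq
    simp_rw [e]
    rw [← ofReal_integral_eq_lintegral_ofReal hi (ae_of_all _ fun y => sq_nonneg _)]
    congr 1
    have : ∀ y, (f x - f y) ^ 2 = f x ^ 2 - 2 * f x * f y + f y ^ 2 := fun y => by ring
    simp_rw [this]
    rw [integral_add _ hf2, integral_sub (integrable_const _) (hf1.const_mul _),
      integral_const_mul, integral_const, smul_eq_mul, mul_comm (ν.real univ)]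
    exact (integrable_const _).sub (hf1.const_mul _)
  simp_rw [h1]
  have hi2 : Integrable (fun x => f x ^ 2 * ν.real univ - 2 * f x * ∫ y, f y ∂ν) ν :=
    (hf2.mul_const _).sub ((hf1.const_mul 2).mul_const _)
  rw [← ofReal_integral_eq_lintegral_ofReal]
  · congr 1
    rw [integral_add hi2 (integrable_const _),
      integral_sub (hf2.mul_const _) ((hf1.const_mul 2).mul_const _), integral_mul_const,
      integral_mul_const, integral_const_mul, integral_const, smul_eq_mul]
    ring
  · exact hi2.add (integrable_const _)
  · refine ae_of_all _ fun x => ?_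
    have hi : Integrable (fun y => (f x - f y) ^ 2) ν := ((memLp_const _).sub hf).integrable_sq
    have : ∀ y, (f x - f y) ^ 2 = f x ^ 2 - 2 * f x * f y + f y ^ 2 := fun y => by ring
    have h3 : 0 ≤ ∫ y, (f x - f y) ^ 2 ∂ν := integral_nonneg fun y => sq_nonneg _
    simp_rw [this] at h3
    rw [integral_add _ hf2, integral_sub (integrable_const _) (hf1.const_mul _),
      integral_const_mul, integral_const, smul_eq_mul, mul_comm (ν.real univ)] at h3
    · exact h3
    · exact (integrable_const _).sub (hf1.const_mul _)

section SmoothInequalities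

variable {S : Type*} [TopologicalSpace S] [ChartedSpace ℂ S] [MeasurableSpace S] [BorelSpace S]
  [IsManifold 𝓘(ℂ) ω S] [CompactSpace S] {g : HyperbolicMetric S}

theorem SmoothFunctions.measurable_gradInner (u : SmoothFunctions g) :
    Measurable (g.gradInner u.val u.val) :=
  (g.continuous_gradInner u.contMDiff_val u.contMDiff_val).measurable

theorem memLp_of_continuous {f : S → ℝ} (hf : Continuous f) (p : ENNReal) :
    MemLp f p g.area := by
  obtain ⟨C, hC⟩ := (isCompact_range hf.norm).bddAbove
  exact MemLp.of_bound hf.aestronglyMeasurable C (ae_of_all _ fun x => hC ⟨x, rfl⟩)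

/-- The Dirichlet energy is conformally invariant: it bounds the Euclidean one in the chart. -/
theorem ChartDisc.setLIntegral_fderiv_sq_le (B : ChartDisc g) (u : SmoothFunctions g) {D : Set ℂ}
    (hDm : MeasurableSet D) (hD : D ⊆ Metric.closedBall B.center (2 * B.radius)) :
    ∫⁻ z in D, ‖fderiv ℝ (u.val ∘ B.chart.1.symm) z‖ₑ ^ 2 ≤
      ∫⁻ x in B.piece D, ENNReal.ofReal (g.gradInner u.val u.val x) ∂g.area := by
  rw [ChartDisc.piece, setLIntegral_area_chart g B.chart hDm (hD.trans B.closedBall_subset)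
    u.measurable_gradInner.ennreal_ofReal]
  refine setLIntegral_mono' hDm fun z hz => ?_
  have hz' := B.closedBall_subset (hD hz)
  rw [← ofReal_norm, ← ENNReal.ofReal_pow (norm_nonneg _),
    ← ENNReal.ofReal_mul (g.density_pos _ z hz').le]
  exact ENNReal.ofReal_le_ofReal (norm_fderiv_chart_sq_le u B.chart hz')

theorem ChartDisc.poincare (B : ChartDisc g) (u : SmoothFunctions g) {D : Set ℂ}
    (hDc : Convex ℝ D) (hDm : MeasurableSet D) (hD : D ⊆ Metric.ball B.center B.radius) {d : ℝ}
    (hd0 : 0 ≤ d) (hd : ∀ x ∈ D, ∀ y ∈ D, ‖x - y‖ ≤ d) :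
    g.area.real (B.piece D) * ∫ x in B.piece D, u.val x ^ 2 ∂g.area -
        (∫ x in B.piece D, u.val x ∂g.area) ^ 2 ≤
      2 * B.upper ^ 2 * B.lower⁻¹ * d ^ 2 * g.area.real (B.piece D) *
        ∫ x in B.piece D, g.gradInner u.val u.val x ∂g.area := by
  set Q := B.piece D
  have hQ : MeasurableSet Q := B.measurableSet_piece hDm
  have hD2 := hD.trans B.ball_subset_closedBall_two
  have hum : Measurable u.val := u.continuous_val.measurable
  set f := u.val ∘ B.chart.1.symm
  have hin : ∀ a : ℝ, Measurable fun y => ‖a - u.val y‖ₑ ^ 2 := fun a =>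
    (hum.const_sub a).enorm.pow_const 2
  have hprod : Measurable fun x => ∫⁻ y in Q, ‖u.val x - u.val y‖ₑ ^ 2 ∂g.area := by
    have : Measurable fun p : S × S => ‖u.val p.1 - u.val p.2‖ₑ ^ 2 :=
      ((hum.comp measurable_fst).sub (hum.comp measurable_snd)).enorm.pow_const 2
    exact this.lintegral_prod_right'
  have hvol : volume D ≤ ENNReal.ofReal B.lower⁻¹ * g.area Q := by
    have := B.le_setLIntegral_piece hDm hD2 (f := fun _ => 1) measurable_const
    simpa using this
  have hgi : IntegrableOn (g.gradInner u.val u.val) Q g.area :=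
    (SmoothFunctions.integrable_gradInner u u).integrableOn
  have hg0 : 0 ≤ ∫ x in Q, g.gradInner u.val u.val x ∂g.area :=
    integral_nonneg fun x => u.gradInner_self_nonneg x
  have key : ∫⁻ x in Q, ∫⁻ y in Q, ‖u.val x - u.val y‖ₑ ^ 2 ∂g.area ∂g.area ≤
      ENNReal.ofReal (2 * (2 * B.upper ^ 2 * B.lower⁻¹ * d ^ 2 * g.area.real Q *
        ∫ x in Q, g.gradInner u.val u.val x ∂g.area)) := by
    calc _ ≤ ENNReal.ofReal B.upper * ∫⁻ z in D, ∫⁻ y in Q, ‖f z - u.val y‖ₑ ^ 2 ∂g.area :=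
          B.setLIntegral_piece_le hDm hD2 hprod
      _ ≤ ENNReal.ofReal B.upper * ∫⁻ z in D, ENNReal.ofReal B.upper *
            ∫⁻ w in D, ‖f z - f w‖ₑ ^ 2 := by
          gcongr with z
          exact B.setLIntegral_piece_le hDm hD2 (hin _)
      _ = ENNReal.ofReal B.upper ^ 2 * ∫⁻ z in D, ∫⁻ w in D, ‖f z - f w‖ₑ ^ 2 := by
          rw [lintegral_const_mul' _ _ ENNReal.ofReal_ne_top, sq, mul_assoc]
      _ ≤ ENNReal.ofReal B.upper ^ 2 * (4 * ENNReal.ofReal d ^ 2 * volume D *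
            ∫⁻ z in D, ‖fderiv ℝ f z‖ₑ ^ 2) := by
          gcongr
          refine lintegral_lintegral_enorm_sub_sq_le hDc hDm B.chart.1.open_target
            (hD.trans B.ball_subset_target)
            ((contDiffOn_comp_chart_symm u.contMDiff_val B.chart).of_le (by simp)) fun x hx y hy => ?_
          rw [← ofReal_norm]
          exact ENNReal.ofReal_le_ofReal (hd x hx y hy)
      _ ≤ ENNReal.ofReal B.upper ^ 2 * (4 * ENNReal.ofReal d ^ 2 *
            (ENNReal.ofReal B.lower⁻¹ * g.area Q) *
            ∫⁻ x in Q, ENNReal.ofReal (g.gradInner u.val u.val x) ∂g.area) := by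
          gcongr
          exact B.setLIntegral_fderiv_sq_le u hDm hD2
      _ = _ := by
          rw [← ofReal_integral_eq_lintegral_ofReal hgi
            (ae_of_all _ fun x => u.gradInner_self_nonneg x),
            ← ofReal_measureReal (measure_ne_top _ _), ← ENNReal.ofReal_pow B.upper_pos.le,
            ← ENNReal.ofReal_pow hd0, show (4 : ENNReal) = ENNReal.ofReal 4 by norm_num]
          have h1 := B.upper_pos
          have h2 := inv_pos.2 B.lower_pos
          rw [← ENNReal.ofReal_mul, ← ENNReal.ofReal_mul, ← ENNReal.ofReal_mul,
            ← ENNReal.ofReal_mul, ← ENNReal.ofReal_mul]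
          · congr 1; ring
          all_goals positivity
  rw [lintegral_lintegral_enorm_sub_sq _ ((memLp_of_continuous u.continuous_val 2).restrict Q),
    measureReal_restrict_apply_univ, ENNReal.ofReal_le_ofReal_iff] at key
  · linarith
  · have h1 := B.upper_pos
    have h2 := inv_pos.2 B.lower_pos
    positivity

/-- The square of side `1 / N` with index `p` in the standard grid of the plane. -/
def gridSquare (N : ℝ) (p : ℤ × ℤ) : Set ℂ := {z | ⌊N * z.re⌋ = p.1 ∧ ⌊N * z.im⌋ = p.2}

theorem convex_gridSquare (N : ℝ) (p : ℤ × ℤ) : Convex ℝ (gridSquare N p) := by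
  have h1 : gridSquare N p = (fun z : ℂ => N * z.re) ⁻¹' Ico (p.1 : ℝ) (p.1 + 1) ∩
      (fun z : ℂ => N * z.im) ⁻¹' Ico (p.2 : ℝ) (p.2 + 1) := by
    ext z
    simp [gridSquare, Int.floor_eq_iff]
  rw [h1]
  refine Convex.inter ?_ ?_
  · exact (convex_Ico _ _).is_linear_preimage
      ⟨fun x y => by simp [mul_add], fun c x => by simp; ring⟩
  · exact (convex_Ico _ _).is_linear_preimage
      ⟨fun x y => by simp [mul_add], fun c x => by simp; ring⟩

theorem measurableSet_gridSquare (N : ℝ) (p : ℤ × ℤ) : MeasurableSet (gridSquare N p) := by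
  have h1 : Measurable fun z : ℂ => ⌊N * z.re⌋ := (Complex.measurable_re.const_mul N).floor
  have h2 : Measurable fun z : ℂ => ⌊N * z.im⌋ := (Complex.measurable_im.const_mul N).floor
  exact (h1 (measurableSet_singleton p.1)).inter (h2 (measurableSet_singleton p.2))

theorem norm_sub_le_of_mem_gridSquare {N : ℝ} (hN : 0 < N) {p : ℤ × ℤ} {x y : ℂ}
    (hx : x ∈ gridSquare N p) (hy : y ∈ gridSquare N p) : ‖x - y‖ ≤ 2 / N := by
  have h : ∀ {a b : ℝ} {k : ℤ}, ⌊N * a⌋ = k → ⌊N * b⌋ = k → |a - b| ≤ 1 / N := by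
    intro a b k ha hb
    rw [Int.floor_eq_iff] at ha hb
    rw [le_div_iff₀ hN, ← abs_of_pos hN, ← abs_mul, abs_le]
    constructor <;> nlinarith
  have h1 := h hx.1 hy.1
  have h2 := h hx.2 hy.2
  calc ‖x - y‖ ≤ |(x - y).re| + |(x - y).im| := Complex.norm_le_abs_re_add_abs_im _
    _ ≤ 1 / N + 1 / N := by rw [Complex.sub_re, Complex.sub_im]; gcongr
    _ = 2 / N := by ring

/-- Rellich's inequality on a coordinate disc: the disc is cut into small convex pieces, on each of
which the Poincaré inequality holds. -/
theorem ChartDisc.rellich (B : ChartDisc g) {ε : ℝ} (hε : 0 < ε) :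
    ∃ (F : Finset (ℤ × ℤ)) (Q : ℤ × ℤ → Set S) (w : ℤ × ℤ → ℝ), (∀ p, MeasurableSet (Q p)) ∧
      ∀ u : SmoothFunctions g, ∫ x in B.disc, u.val x ^ 2 ∂g.area ≤
        ε * ∫ x, g.gradInner u.val u.val x ∂g.area +
          ∑ p ∈ F, w p * (∫ x in Q p, u.val x ∂g.area) ^ 2 := by
  set C := 2 * B.upper ^ 2 * B.lower⁻¹ with hC
  have hC0 : 0 < C := by
    have h1 := B.upper_pos
    have h2 := inv_pos.2 B.lower_pos
    positivity
  obtain ⟨n, hn⟩ := exists_nat_gt (4 * C / ε)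
  set N : ℝ := n + 1
  have hN1 : 1 ≤ N := by simp [N]
  have hN : 0 < N := by linarith
  have hNε : C * (2 / N) ^ 2 ≤ ε := by
    have : 4 * C < N * ε := by
      rw [div_lt_iff₀ hε] at hn
      simp only [N]; nlinarith
    rw [div_pow, mul_div_assoc', div_le_iff₀ (by positivity)]
    nlinarith
  set M : ℤ := ⌈N * (‖B.center‖ + B.radius)⌉ + 1
  set F : Finset (ℤ × ℤ) := Finset.Icc (-M) M ×ˢ Finset.Icc (-M) M
  set D : ℤ × ℤ → Set ℂ := fun p => Metric.ball B.center B.radius ∩ gridSquare N p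
  have hDm : ∀ p, MeasurableSet (D p) := fun p =>
    Metric.isOpen_ball.measurableSet.inter (measurableSet_gridSquare N p)
  have hQm : ∀ p, MeasurableSet (B.piece (D p)) := fun p => B.measurableSet_piece (hDm p)
  refine ⟨F, fun p => B.piece (D p), fun p => (g.area.real (B.piece (D p)))⁻¹, hQm, fun u => ?_⟩
  have hfl : ∀ {a : ℝ}, |a| ≤ ‖B.center‖ + B.radius → ⌊N * a⌋ ∈ Finset.Icc (-M) M := by
    intro a ha
    have h1 : |N * a| ≤ N * (‖B.center‖ + B.radius) := by
      rw [abs_mul, abs_of_pos hN]; gcongr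
    have h2 := Int.le_ceil (N * (‖B.center‖ + B.radius))
    have h3 := abs_le.1 (h1.trans h2)
    rw [Finset.mem_Icc]
    constructor
    · rw [Int.le_floor]
      simp only [M]; push_cast; linarith
    · rw [← Int.lt_add_one_iff, Int.floor_lt]
      simp only [M]; push_cast; linarith
  have hcover : B.disc = ⋃ p ∈ F, B.piece (D p) := by
    ext x
    simp only [mem_iUnion]
    constructor
    · rintro ⟨hx, hxb⟩
      have hn : ‖B.chart.1 x‖ ≤ ‖B.center‖ + B.radius := by
        have : ‖B.chart.1 x - B.center‖ < B.radius := by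
          rw [← dist_eq_norm]; exact hxb
        calc ‖B.chart.1 x‖ = ‖B.center + (B.chart.1 x - B.center)‖ := by rw [add_sub_cancel]
          _ ≤ _ := (norm_add_le _ _).trans (by linarith)
      refine ⟨(⌊N * (B.chart.1 x).re⌋, ⌊N * (B.chart.1 x).im⌋), Finset.mem_product.2
        ⟨hfl ((Complex.abs_re_le_norm _).trans hn), hfl ((Complex.abs_im_le_norm _).trans hn)⟩,
        hx, hxb, rfl, rfl⟩
    · rintro ⟨p, -, hx, hxb, -⟩
      exact ⟨hx, hxb⟩
  have hdisj : (F : Set (ℤ × ℤ)).PairwiseDisjoint fun p => B.piece (D p) := by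
    intro p _ q _ hpq
    refine Set.disjoint_left.2 ?_
    rintro x ⟨-, -, h1, h2⟩ ⟨-, -, h3, h4⟩
    exact hpq (Prod.ext (h1.symm.trans h3) (h2.symm.trans h4))
  have hui : Integrable (fun x => u.val x ^ 2) g.area :=
    (memLp_of_continuous u.continuous_val 2).integrable_sq
  have hgi := SmoothFunctions.integrable_gradInner u u
  have hg0 : ∀ p, 0 ≤ ∫ x in B.piece (D p), g.gradInner u.val u.val x ∂g.area := fun p =>
    integral_nonneg fun x => u.gradInner_self_nonneg x
  have hpiece : ∀ p, ∫ x in B.piece (D p), u.val x ^ 2 ∂g.area ≤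
      ε * ∫ x in B.piece (D p), g.gradInner u.val u.val x ∂g.area +
        (g.area.real (B.piece (D p)))⁻¹ * (∫ x in B.piece (D p), u.val x ∂g.area) ^ 2 := by
    intro p
    have h := B.poincare u ((convex_ball _ _).inter (convex_gridSquare N p)) (hDm p)
      inter_subset_left (d := 2 / N) (by positivity)
      fun x hx y hy => norm_sub_le_of_mem_gridSquare hN hx.2 hy.2
    rcases (measureReal_nonneg (μ := g.area) (s := B.piece (D p))).eq_or_lt with h0 | h0
    · have h1 : g.area.restrict (B.piece (D p)) = 0 := by
        rw [Measure.restrict_eq_zero]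
        exact (measureReal_eq_zero_iff).1 h0.symm
      simp [h1]
    · change _ ≤ C * (2 / N) ^ 2 * g.area.real (B.piece (D p)) * _ at h
      rw [← sub_le_iff_le_add, ← mul_le_mul_iff_right₀ h0, mul_sub, mul_inv_cancel_left₀ h0.ne']
      refine h.trans ?_
      rw [mul_comm (C * _), mul_assoc]
      gcongr
      exact hg0 p
  calc ∫ x in B.disc, u.val x ^ 2 ∂g.area
      = ∑ p ∈ F, ∫ x in B.piece (D p), u.val x ^ 2 ∂g.area := by
        rw [hcover, integral_biUnion_finset F (fun p _ => hQm p) hdisj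
          fun p _ => hui.integrableOn]
    _ ≤ ∑ p ∈ F, (ε * ∫ x in B.piece (D p), g.gradInner u.val u.val x ∂g.area +
        (g.area.real (B.piece (D p)))⁻¹ * (∫ x in B.piece (D p), u.val x ∂g.area) ^ 2) :=
        Finset.sum_le_sum fun p _ => hpiece p
    _ = ε * ∫ x in B.disc, g.gradInner u.val u.val x ∂g.area + ∑ p ∈ F,
        (g.area.real (B.piece (D p)))⁻¹ * (∫ x in B.piece (D p), u.val x ∂g.area) ^ 2 := by
        rw [Finset.sum_add_distrib, ← Finset.mul_sum, hcover,
          integral_biUnion_finset F (fun p _ => hQm p) hdisj fun p _ => hgi.integrableOn]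
    _ ≤ _ := by
        gcongr ε * ?_ + _
        exact setIntegral_le_integral hgi (ae_of_all _ fun x => u.gradInner_self_nonneg x)

/-- Rellich's inequality: up to a small multiple of the Dirichlet energy, the `L²` norm is
controlled by finitely many averages. -/
theorem SmoothFunctions.rellich (g : HyperbolicMetric S) {ε : ℝ} (hε : 0 < ε) :
    ∃ (F : Finset (Σ _ : ChartDisc g, ℤ × ℤ)) (Q : (Σ _ : ChartDisc g, ℤ × ℤ) → Set S)
      (w : (Σ _ : ChartDisc g, ℤ × ℤ) → ℝ), (∀ p, MeasurableSet (Q p)) ∧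
      ∀ u : SmoothFunctions g, ∫ x, u.val x ^ 2 ∂g.area ≤
        ε * ∫ x, g.gradInner u.val u.val x ∂g.area +
          ∑ p ∈ F, w p * (∫ x in Q p, u.val x ∂g.area) ^ 2 := by
  obtain ⟨T, hT⟩ := exists_finset_chartDisc g
  have hδ : 0 < ε / (T.card + 1) := by positivity
  choose F Q w hQ h using fun B : ChartDisc g => B.rellich hδ
  refine ⟨T.sigma F, fun p => Q p.1 p.2, fun p => w p.1 p.2,
    fun p => hQ _ _, fun u => ?_⟩
  have hui : Integrable (fun x => u.val x ^ 2) g.area :=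
    (memLp_of_continuous u.continuous_val 2).integrable_sq
  have hg0 : 0 ≤ ∫ x, g.gradInner u.val u.val x ∂g.area :=
    integral_nonneg fun x => u.gradInner_self_nonneg x
  have h1 : ∫ x, u.val x ^ 2 ∂g.area ≤ ∑ B ∈ T, ∫ x in B.disc, u.val x ^ 2 ∂g.area := by
    have := lintegral_le_sum_disc (μ := g.area) hT fun x => ENNReal.ofReal (u.val x ^ 2)
    rw [← ofReal_integral_eq_lintegral_ofReal hui (ae_of_all _ fun x => sq_nonneg _)] at this
    have e : ∀ B : ChartDisc g, ∫⁻ x in B.disc, ENNReal.ofReal (u.val x ^ 2) ∂g.area =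
        ENNReal.ofReal (∫ x in B.disc, u.val x ^ 2 ∂g.area) := fun B =>
      (ofReal_integral_eq_lintegral_ofReal hui.integrableOn (ae_of_all _ fun x => sq_nonneg _)).symm
    simp_rw [e] at this
    rw [← ENNReal.ofReal_sum_of_nonneg fun B _ => integral_nonneg fun x => sq_nonneg _] at this
    exact (ENNReal.ofReal_le_ofReal_iff (Finset.sum_nonneg fun B _ =>
      integral_nonneg fun x => sq_nonneg _)).1 this
  refine h1.trans ((Finset.sum_le_sum fun B _ => h B u).trans ?_)
  rw [Finset.sum_add_distrib, Finset.sum_sigma]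
  gcongr
  rw [Finset.sum_const, nsmul_eq_mul, ← mul_assoc]
  gcongr
  rw [mul_div_assoc', div_le_iff₀ (by positivity)]
  nlinarith

end SmoothInequalities

/-! ### The Sobolev inequality for `W^{1,1}` -/

section SobolevOne

variable {S : Type*} [TopologicalSpace S] [ChartedSpace ℂ S] [MeasurableSpace S] [BorelSpace S]
  [IsManifold 𝓘(ℂ) ω S] [CompactSpace S] {g : HyperbolicMetric S}

/-- The Sobolev inequality on a coordinate disc: the function is multiplied by a bump function in
the chart, and the Gagliardo–Nirenberg–Sobolev inequality of the plane is applied. -/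
theorem ChartDisc.sobolev_one (B : ChartDisc g) :
    ∃ C : NNReal, ∀ w : SmoothFunctions g, ∫⁻ x in B.disc, ‖w.val x‖ₑ ^ 2 ∂g.area ≤
      C * (∫⁻ x, ENNReal.ofReal √(g.gradInner w.val w.val x) ∂g.area +
        ∫⁻ x, ‖w.val x‖ₑ ∂g.area) ^ 2 := by
  let η : ContDiffBump B.center := ⟨B.radius, 2 * B.radius, B.radius_pos, by linarith [B.radius_pos]⟩
  obtain ⟨M, hM⟩ := (η.hasCompactSupport.fderiv (𝕜 := ℝ)).exists_bound_of_continuous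
    ((η.contDiff (n := 1)).continuous_fderiv one_ne_zero)
  have hM0 : 0 ≤ M := (norm_nonneg _).trans (hM 0)
  set c : NNReal := eLpNormLESNormFDerivOneConst (volume : Measure ℂ) ((2 : NNReal) : ℝ)
  set K : Set ℂ := Metric.closedBall B.center (2 * B.radius)
  have hKm : MeasurableSet K := Metric.isClosed_closedBall.measurableSet
  set a := max (√B.lower)⁻¹ (M * B.lower⁻¹) with ha
  have ha0 : 0 ≤ a := le_max_of_le_left (by positivity)
  refine ⟨Real.toNNReal B.upper * (c * Real.toNNReal a) ^ 2, fun w => ?_⟩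
  set f : ℂ → ℝ := w.val ∘ B.chart.1.symm with hf
  set W : ℂ → ℝ := fun z => η z * f z with hW
  have hfc : ContDiffOn ℝ 1 f B.chart.1.target :=
    (contDiffOn_comp_chart_symm w.contMDiff_val B.chart).of_le (by simp)
  have hsupp : tsupport η = K := η.tsupport_eq
  have hWz : ∀ z ∉ K, W =ᶠ[𝓝 z] fun _ => 0 := fun z hz => by
    filter_upwards [notMem_tsupport_iff_eventuallyEq.1 (hsupp ▸ hz)] with y hy
    simp [hW, hy]
  have hfd : ∀ z ∈ K, ContDiffAt ℝ 1 f z := fun z hz =>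
    hfc.contDiffAt (B.chart.1.open_target.mem_nhds (B.closedBall_subset hz))
  have hWc : ContDiff ℝ 1 W := by
    rw [contDiff_iff_contDiffAt]
    intro z
    by_cases hz : z ∈ K
    · exact η.contDiff.contDiffAt.mul (hfd z hz)
    · exact contDiffAt_const.congr_of_eventuallyEq (hWz z hz)
  have hWs : HasCompactSupport W := η.hasCompactSupport.mul_right
  have hgns := eLpNorm_le_eLpNorm_fderiv_one (volume : Measure ℂ) hWc hWs (p := 2) (by
    rw [Complex.finrank_real_complex]
    exact_mod_cast NNReal.HolderConjugate.two_two)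
  rw [eLpNorm_one_eq_lintegral_enorm] at hgns
  have hsq : ∫⁻ z, ‖W z‖ₑ ^ 2 ≤ (c * ∫⁻ z, ‖fderiv ℝ W z‖ₑ) ^ 2 := by
    refine le_trans (le_of_eq ?_) (pow_le_pow_left' hgns 2)
    have h3 : ∀ b : ENNReal, (b ^ (1 / 2 : ℝ)) ^ 2 = b := fun b => by
      rw [← ENNReal.rpow_natCast, ← ENNReal.rpow_mul]; norm_num
    rw [show ((2 : NNReal) : ENNReal) = 2 by norm_num,
      eLpNorm_eq_lintegral_rpow_enorm_toReal (by norm_num) (by norm_num)]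
    simp [-one_div, h3]
  set φ : S → ENNReal := fun x => ENNReal.ofReal √(g.gradInner w.val w.val x) with hφ
  have hφm : Measurable φ := w.measurable_gradInner.sqrt.ennreal_ofReal
  have hwm : Measurable fun x => ‖w.val x‖ₑ := w.continuous_val.measurable.enorm
  have hder : ∀ z, ‖fderiv ℝ W z‖ₑ ≤ K.indicator (fun z => ENNReal.ofReal a *
      (ENNReal.ofReal (g.density B.chart z) *
        (φ (B.chart.1.symm z) + ‖w.val (B.chart.1.symm z)‖ₑ))) z := by
    intro z
    by_cases hz : z ∈ K
    · rw [indicator_of_mem hz]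
      have hzt := B.closedBall_subset hz
      have h1 : fderiv ℝ W z = η z • fderiv ℝ f z + f z • fderiv ℝ η z :=
        fderiv_fun_mul (η.contDiff.differentiable one_ne_zero z)
          ((hfd z hz).differentiableAt one_ne_zero)
      have hρ := g.density_pos B.chart z hzt
      have hl := B.lower_pos
      have hlρ := B.lower_le z hz
      set G := g.gradInner w.val w.val (B.chart.1.symm z) with hG
      have hG0 : 0 ≤ G := w.gradInner_self_nonneg _
      have h2 : ‖fderiv ℝ f z‖ ≤ (√B.lower)⁻¹ * (g.density B.chart z * √G) := by
        have h4 : ‖fderiv ℝ f z‖ ≤ √(g.density B.chart z) * √G := by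
          rw [← Real.sqrt_mul hρ.le]
          exact Real.le_sqrt_of_sq_le (norm_fderiv_chart_sq_le w B.chart hzt)
        refine h4.trans ?_
        rw [← mul_assoc]
        gcongr
        rw [inv_mul_eq_div, le_div_iff₀ (Real.sqrt_pos.2 hl)]
        calc _ ≤ √(g.density B.chart z) * √(g.density B.chart z) := by gcongr
          _ = _ := Real.mul_self_sqrt hρ.le
      have h3 : |f z| * M ≤ M * B.lower⁻¹ * (g.density B.chart z * |f z|) := by
        have : 1 ≤ B.lower⁻¹ * g.density B.chart z := by
          rw [inv_mul_eq_div, one_le_div hl]; exact hlρ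
        calc |f z| * M = |f z| * M * 1 := (mul_one _).symm
          _ ≤ |f z| * M * (B.lower⁻¹ * g.density B.chart z) := by gcongr
          _ = _ := by ring
      have h5 : ‖fderiv ℝ W z‖ ≤ a * (g.density B.chart z * (√G + |f z|)) := by
        rw [h1]
        calc _ ≤ 1 * ‖fderiv ℝ f z‖ + |f z| * M := by
              refine (norm_add_le _ _).trans ?_
              rw [norm_smul, norm_smul, Real.norm_eq_abs, Real.norm_eq_abs, abs_of_nonneg η.nonneg]
              gcongr
              · exact η.le_one
              · exact hM z
          _ ≤ a * (g.density B.chart z * √G) + a * (g.density B.chart z * |f z|) := by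
              rw [one_mul]
              refine add_le_add (h2.trans ?_) (h3.trans ?_)
              · gcongr; exact le_max_left _ _
              · gcongr; exact le_max_right _ _
          _ = _ := by ring
      rw [← ofReal_norm, ← ofReal_norm, Real.norm_eq_abs, hφ,
        ← ENNReal.ofReal_add (Real.sqrt_nonneg _) (abs_nonneg _), ← ENNReal.ofReal_mul hρ.le,
        ← ENNReal.ofReal_mul ha0]
      exact ENNReal.ofReal_le_ofReal h5
    · have h0 : fderiv ℝ W z = 0 := by
        rw [(hWz z hz).fderiv_eq]
        exact fderiv_const_apply 0
      have h1 : ‖fderiv ℝ W z‖ = 0 := by rw [h0]; exact norm_zero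
      rw [← ofReal_norm, h1, ENNReal.ofReal_zero]
      exact zero_le
  have hint : ∫⁻ z, ‖fderiv ℝ W z‖ₑ ≤ ENNReal.ofReal a *
      (∫⁻ x, φ x ∂g.area + ∫⁻ x, ‖w.val x‖ₑ ∂g.area) := by
    refine (lintegral_mono hder).trans ?_
    rw [lintegral_indicator hKm, lintegral_const_mul' _ _ ENNReal.ofReal_ne_top,
      ← setLIntegral_area_chart g B.chart hKm B.closedBall_subset
        (f := fun x => φ x + ‖w.val x‖ₑ) (hφm.add hwm), ← lintegral_add_left hφm]
    gcongr
    exact Measure.restrict_le_self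
  have hball : MeasurableSet (Metric.ball B.center B.radius) := Metric.isOpen_ball.measurableSet
  calc ∫⁻ x in B.disc, ‖w.val x‖ₑ ^ 2 ∂g.area
      ≤ ENNReal.ofReal B.upper * ∫⁻ z in Metric.ball B.center B.radius, ‖f z‖ₑ ^ 2 :=
        B.setLIntegral_piece_le hball B.ball_subset_closedBall_two (hwm.pow_const 2)
    _ ≤ ENNReal.ofReal B.upper * ∫⁻ z, ‖W z‖ₑ ^ 2 := by
        refine mul_le_mul_right (le_trans (le_of_eq ?_)
          (setLIntegral_le_lintegral (Metric.ball B.center B.radius) fun z => ‖W z‖ₑ ^ 2)) _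
        refine setLIntegral_congr_fun hball fun z hz => ?_
        have : η z = 1 := η.one_of_mem_closedBall (Metric.ball_subset_closedBall hz)
        simp [hW, this]
    _ ≤ ENNReal.ofReal B.upper * (c * (ENNReal.ofReal a *
          (∫⁻ x, φ x ∂g.area + ∫⁻ x, ‖w.val x‖ₑ ∂g.area))) ^ 2 := by
        gcongr
        exact hsq.trans (by gcongr)
    _ = _ := by
        rw [ENNReal.coe_mul, ENNReal.coe_pow, ENNReal.coe_mul, ENNReal.ofReal, ENNReal.ofReal]
        ring

/-- The Sobolev inequality `‖w‖₂ ≤ C (‖∇w‖₁ + ‖w‖₁)` on the surface. -/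
theorem SmoothFunctions.sobolev_one (g : HyperbolicMetric S) :
    ∃ C : ℝ, 0 ≤ C ∧ ∀ w : SmoothFunctions g, ∫ x, w.val x ^ 2 ∂g.area ≤
      C * (∫ x, √(g.gradInner w.val w.val x) ∂g.area + ∫ x, |w.val x| ∂g.area) ^ 2 := by
  obtain ⟨T, hT⟩ := exists_finset_chartDisc g
  choose C hC using fun B : ChartDisc g => B.sobolev_one
  refine ⟨((∑ B ∈ T, C B : NNReal) : ℝ), NNReal.coe_nonneg _, fun w => ?_⟩
  have h1 := (lintegral_le_sum_disc (μ := g.area) hT fun x => ‖w.val x‖ₑ ^ 2).trans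
    (Finset.sum_le_sum fun B _ => hC B w)
  rw [← Finset.sum_mul] at h1
  have hi2 : Integrable (fun x => w.val x ^ 2) g.area :=
    (memLp_of_continuous w.continuous_val 2).integrable_sq
  have hi1 : Integrable (fun x => |w.val x|) g.area :=
    memLp_one_iff_integrable.1 (memLp_of_continuous w.continuous_val.abs 1)
  have hi3 : Integrable (fun x => √(g.gradInner w.val w.val x)) g.area :=
    memLp_one_iff_integrable.1 (memLp_of_continuous
      (g.continuous_gradInner w.contMDiff_val w.contMDiff_val).sqrt 1)
  have e1 : ∫⁻ x, ‖w.val x‖ₑ ^ 2 ∂g.area = ENNReal.ofReal (∫ x, w.val x ^ 2 ∂g.area) := by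
    rw [ofReal_integral_eq_lintegral_ofReal hi2 (ae_of_all _ fun x => sq_nonneg _)]
    refine lintegral_congr fun x => ?_
    rw [← ofReal_norm, ← ENNReal.ofReal_pow (norm_nonneg _), Real.norm_eq_abs, sq_abs]
  have e2 : ∫⁻ x, ‖w.val x‖ₑ ∂g.area = ENNReal.ofReal (∫ x, |w.val x| ∂g.area) := by
    rw [ofReal_integral_eq_lintegral_ofReal hi1 (ae_of_all _ fun x => abs_nonneg _)]
    refine lintegral_congr fun x => ?_
    rw [← ofReal_norm, Real.norm_eq_abs]
  have h3 : 0 ≤ ∫ x, √(g.gradInner w.val w.val x) ∂g.area :=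
    integral_nonneg fun x => Real.sqrt_nonneg _
  have h4 : 0 ≤ ∫ x, |w.val x| ∂g.area := integral_nonneg fun x => abs_nonneg _
  rw [e1, e2, ← ofReal_integral_eq_lintegral_ofReal hi3 (ae_of_all _ fun x => Real.sqrt_nonneg _),
    ← ENNReal.ofReal_add h3 h4, ← ENNReal.ofReal_pow (by positivity), ← ENNReal.ofNNReal_finsetSum,
    ← ENNReal.ofReal_coe_nnreal, ← ENNReal.ofReal_mul (NNReal.coe_nonneg _),
    ENNReal.ofReal_le_ofReal_iff (mul_nonneg (NNReal.coe_nonneg _) (sq_nonneg _))] at h1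
  exact h1

end SobolevOne

/-! ### Exponential integrability for smooth functions -/

/-- The Cauchy–Schwarz inequality for integrals of real functions. -/
theorem abs_integral_mul_le {α : Type*} [MeasurableSpace α] {μ : Measure α} {f h : α → ℝ}
    (hf : MemLp f 2 μ) (hh : MemLp h 2 μ) :
    |∫ x, f x * h x ∂μ| ≤ √(∫ x, f x ^ 2 ∂μ) * √(∫ x, h x ^ 2 ∂μ) := by
  have e : ∀ {a b : α → ℝ} (ha : MemLp a 2 μ) (hb : MemLp b 2 μ),
      inner ℝ (ha.toLp a) (hb.toLp b) = ∫ x, a x * b x ∂μ := by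
    intro a b ha hb
    rw [L2.inner_def]
    refine integral_congr_ae ?_
    filter_upwards [ha.coeFn_toLp, hb.coeFn_toLp] with x h1 h2
    rw [h1, h2]
    simp [mul_comm]
  have hn : ∀ {a : α → ℝ} (ha : MemLp a 2 μ), ‖ha.toLp a‖ = √(∫ x, a x ^ 2 ∂μ) := by
    intro a ha
    rw [norm_eq_sqrt_real_inner, e ha ha]
    simp_rw [sq]
  rw [← e hf hh, ← hn hf, ← hn hh]
  exact abs_real_inner_le_norm _ _

namespace Real.smoothTransition

theorem deriv_eq_zero {x : ℝ} (hx : x ≤ 0 ∨ 1 ≤ x) : deriv Real.smoothTransition x = 0 := by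
  rcases hx with hx | hx
  · have : IsLocalMin Real.smoothTransition x := Eventually.of_forall fun y => by
      rw [Real.smoothTransition.zero_of_nonpos hx]
      exact Real.smoothTransition.nonneg y
    exact this.deriv_eq_zero
  · have : IsLocalMax Real.smoothTransition x := Eventually.of_forall fun y => by
      rw [Real.smoothTransition.one_of_one_le hx]
      exact Real.smoothTransition.le_one y
    exact this.deriv_eq_zero

theorem exists_deriv_bound : ∃ L, 0 ≤ L ∧ ∀ x, |deriv Real.smoothTransition x| ≤ L := by
  have hc : Continuous (deriv Real.smoothTransition) :=
    (Real.smoothTransition.contDiff (n := 1)).continuous_deriv le_rfl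
  obtain ⟨L, hL⟩ := (isCompact_Icc (a := (0 : ℝ)) (b := 1)).exists_bound_of_continuousOn
    hc.continuousOn
  refine ⟨max L 0, le_max_right _ _, fun x => ?_⟩
  by_cases hx : x ∈ Icc (0 : ℝ) 1
  · exact (hL x hx).trans (le_max_left _ _)
  · rw [deriv_eq_zero, abs_zero]
    · exact le_max_right _ _
    · rw [mem_Icc, not_and_or, not_le, not_le] at hx
      exact hx.imp le_of_lt le_of_lt

end Real.smoothTransition

/-- A sequence with `a (k + 1) ≤ b k * a k`, where `∑ b k ≤ s`, decays faster than every geometric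
sequence; this follows from `λ b ≤ exp (λ b)`. -/
theorem le_geometric_of_summable_ratios {a b : ℕ → ℝ} (ha : ∀ k, 0 ≤ a k)
    (hab : ∀ k, a (k + 1) ≤ b k * a k) {s : ℝ} (hs : ∀ n, ∑ k ∈ Finset.range n, b k ≤ s) {l : ℝ}
    (hl : 0 < l) (n : ℕ) : a n ≤ a 0 * (l⁻¹ ^ n * Real.exp (l * s)) := by
  have h : ∀ n, a n ≤ a 0 * (l⁻¹ ^ n * Real.exp (l * ∑ k ∈ Finset.range n, b k)) := by
    intro n
    induction n with
    | zero => simp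
    | succ n ih =>
      have h1 : b n ≤ l⁻¹ * Real.exp (l * b n) := by
        rw [inv_mul_eq_div, le_div_iff₀ hl]
        linarith [Real.add_one_le_exp (l * b n)]
      calc a (n + 1) ≤ b n * a n := hab n
        _ ≤ l⁻¹ * Real.exp (l * b n) * a n := mul_le_mul_of_nonneg_right h1 (ha n)
        _ ≤ l⁻¹ * Real.exp (l * b n) *
            (a 0 * (l⁻¹ ^ n * Real.exp (l * ∑ k ∈ Finset.range n, b k))) :=
            mul_le_mul_of_nonneg_left ih (by positivity)
        _ = _ := by
            rw [Finset.sum_range_succ, mul_add, Real.exp_add, pow_succ]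
            ring
  refine (h n).trans ?_
  have := ha 0
  gcongr
  exact hs n

section Exponential

variable {S : Type*} [TopologicalSpace S] [ChartedSpace ℂ S]
  [IsManifold 𝓘(ℂ) ω S] {g : HyperbolicMetric S}

namespace SmoothFunctions

/-- A smooth function on the surface, as an element of `SmoothFunctions g`. -/
noncomputable def ofContMDiff {f : S → ℝ} (hf : ContMDiff 𝓘(ℝ, ℂ) 𝓘(ℝ, ℝ) ∞ f) : SmoothFunctions g :=
  (⟨f, hf⟩ : C^∞⟮𝓘(ℝ, ℂ), S; 𝓘(ℝ, ℝ), ℝ⟯)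

@[simp] theorem val_ofContMDiff {f : S → ℝ} (hf : ContMDiff 𝓘(ℝ, ℂ) 𝓘(ℝ, ℝ) ∞ f) :
    (ofContMDiff hf : SmoothFunctions g).val = f := rfl

/-- The composition `F ∘ u` of a smooth function with a smooth real function. -/
noncomputable def comp (u : SmoothFunctions g) {F : ℝ → ℝ} (hF : ContDiff ℝ ∞ F) : SmoothFunctions g :=
  ofContMDiff (hF.contMDiff.comp u.contMDiff_val)

@[simp] theorem val_comp (u : SmoothFunctions g) {F : ℝ → ℝ} (hF : ContDiff ℝ ∞ F) :
    (u.comp hF).val = F ∘ u.val := rfl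

theorem fderiv_comp_chart (u : SmoothFunctions g) {F : ℝ → ℝ} (hF : ContDiff ℝ ∞ F) (x : S) :
    fderiv ℝ ((u.comp hF).val ∘ (chartAt ℂ x).symm) (chartAt ℂ x x) =
      deriv F (u.val x) • fderiv ℝ (u.val ∘ (chartAt ℂ x).symm) (chartAt ℂ x x) := by
  have h1 := (hF.differentiable (by simp) ((u.val ∘ (chartAt ℂ x).symm) (chartAt ℂ x x))).hasDerivAt
  have h2 := h1.comp_hasFDerivAt _ (u.differentiableAt_chart x).hasFDerivAt
  simp only [Function.comp_apply, (chartAt ℂ x).left_inv (mem_chart_source ℂ x)] at h2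
  exact h2.fderiv

theorem gradInner_comp_comp (u : SmoothFunctions g) {F G : ℝ → ℝ} (hF : ContDiff ℝ ∞ F)
    (hG : ContDiff ℝ ∞ G) (x : S) : g.gradInner (u.comp hF).val (u.comp hG).val x =
      deriv F (u.val x) * deriv G (u.val x) * g.gradInner u.val u.val x := by
  simp only [HyperbolicMetric.gradInner, chartGradInner, fderiv_comp_chart,
    smul_apply, smul_eq_mul]
  ring

theorem gradInner_self_comp (u : SmoothFunctions g) {F : ℝ → ℝ} (hF : ContDiff ℝ ∞ F) (x : S) :
    g.gradInner u.val (u.comp hF).val x = deriv F (u.val x) * g.gradInner u.val u.val x := by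
  simp only [HyperbolicMetric.gradInner, chartGradInner, fderiv_comp_chart,
    smul_apply, smul_eq_mul]
  ring

variable [MeasurableSpace S] [BorelSpace S] [CompactSpace S]

theorem norm_sq_eq (u : SmoothFunctions g) : ‖u‖ ^ 2 =
    ∫ x, g.gradInner u.val u.val x ∂g.area + ∫ x, u.val x ^ 2 ∂g.area := by
  rw [← real_inner_self_eq_norm_sq, inner_def]
  simp_rw [sq]

/-- The areas of the superlevel sets `{j ≤ u}`: Maz'ya's truncation at consecutive levels turns the
`W^{1,1}` Sobolev inequality into a recursion. -/
theorem exists_superlevel_recursion (g : HyperbolicMetric S) :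
    ∃ C : ℝ, 0 ≤ C ∧ ∀ (u : SmoothFunctions g) (j : ℕ),
      g.area.real {x | (j : ℝ) + 1 ≤ u.val x} ≤
        C * ((∫ x in {x | (j : ℝ) ≤ u.val x}, g.gradInner u.val u.val x ∂g.area -
          ∫ x in {x | (j : ℝ) + 1 ≤ u.val x}, g.gradInner u.val u.val x ∂g.area) +
            g.area.real {x | (j : ℝ) ≤ u.val x}) * g.area.real {x | (j : ℝ) ≤ u.val x} := by
  obtain ⟨C, hC0, hC⟩ := SmoothFunctions.sobolev_one g
  obtain ⟨L, hL0, hL⟩ := Real.smoothTransition.exists_deriv_bound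
  refine ⟨C * (2 * max (L ^ 2) 1), by positivity, fun u j => ?_⟩
  have hF : ContDiff ℝ ∞ fun y : ℝ => Real.smoothTransition (y - j) :=
    Real.smoothTransition.contDiff.comp (contDiff_id.sub contDiff_const)
  set w := u.comp hF with hw
  set A : Set S := {x | (j : ℝ) ≤ u.val x}
  set A' : Set S := {x | (j : ℝ) + 1 ≤ u.val x}
  have hum := u.continuous_val.measurable
  have hA : MeasurableSet A := measurableSet_le measurable_const hum
  have hA' : MeasurableSet A' := measurableSet_le measurable_const hum
  have hAA' : A' ⊆ A := fun x (hx : (j : ℝ) + 1 ≤ u.val x) =>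
    show (j : ℝ) ≤ u.val x by linarith
  have hwv : ∀ x, w.val x = Real.smoothTransition (u.val x - j) := fun x => rfl
  have hgi := SmoothFunctions.integrable_gradInner u u
  have hg0 := u.gradInner_self_nonneg
  have hw2i : Integrable (fun x => w.val x ^ 2) g.area :=
    (memLp_of_continuous w.continuous_val 2).integrable_sq
  have hsi : Continuous fun x => √(g.gradInner u.val u.val x) :=
    (g.continuous_gradInner u.contMDiff_val u.contMDiff_val).sqrt
  have h1 : g.area.real A' ≤ ∫ x, w.val x ^ 2 ∂g.area := by
    rw [← integral_indicator_one hA']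
    refine integral_mono ((integrable_const 1).indicator hA') hw2i fun x => ?_
    by_cases hx : x ∈ A'
    · have : (1 : ℝ) ≤ u.val x - j := by
        have : (j : ℝ) + 1 ≤ u.val x := hx
        linarith
      simp [hx, hwv, Real.smoothTransition.one_of_one_le this]
    · simp only [indicator_of_notMem hx]; positivity
  have h2 : ∫ x, |w.val x| ∂g.area ≤ g.area.real A := by
    rw [← integral_indicator_one hA]
    refine integral_mono (memLp_one_iff_integrable.1 (memLp_of_continuous w.continuous_val.abs 1))
      ((integrable_const 1).indicator hA) fun x => ?_
    by_cases hx : x ∈ A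
    · simp only [hx, indicator_of_mem, Pi.one_apply, hwv,
        abs_of_nonneg (Real.smoothTransition.nonneg _)]
      exact Real.smoothTransition.le_one _
    · have : u.val x - j ≤ 0 := by
        have : ¬ (j : ℝ) ≤ u.val x := hx
        linarith
      simp [hx, hwv, Real.smoothTransition.zero_of_nonpos this]
  set m := g.area.real A
  set E := ∫ x in A, g.gradInner u.val u.val x ∂g.area -
    ∫ x in A', g.gradInner u.val u.val x ∂g.area
  have hE : E = ∫ x in A \ A', g.gradInner u.val u.val x ∂g.area :=
    (setIntegral_sdiff hA' hgi.integrableOn hAA').symm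
  have hE0 : 0 ≤ E := by rw [hE]; exact integral_nonneg hg0
  have hm0 : 0 ≤ m := measureReal_nonneg
  have h3 : ∫ x, √(g.gradInner w.val w.val x) ∂g.area ≤ L * √(m * E) := by
    have hle : ∀ x, √(g.gradInner w.val w.val x) ≤
        (A \ A').indicator (fun x => L * √(g.gradInner u.val u.val x)) x := by
      intro x
      have hd : deriv (fun y : ℝ => Real.smoothTransition (y - j)) (u.val x) =
          deriv Real.smoothTransition (u.val x - j) := deriv_comp_sub_const _ _ _
      rw [hw, gradInner_comp_comp, hd, Real.sqrt_mul (mul_self_nonneg _), Real.sqrt_mul_self_eq_abs]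
      by_cases hx : x ∈ A \ A'
      · rw [indicator_of_mem hx]
        gcongr
        exact hL _
      · rw [indicator_of_notMem hx, Real.smoothTransition.deriv_eq_zero]
        · simp
        · by_contra! hcon
          refine hx ⟨?_, fun h => ?_⟩
          · change (j : ℝ) ≤ u.val x
            linarith
          · have : (j : ℝ) + 1 ≤ u.val x := h
            linarith
    have hs2 : MemLp (fun x => √(g.gradInner u.val u.val x)) 2 (g.area.restrict (A \ A')) :=
      (memLp_of_continuous hsi 2).restrict _
    calc _ ≤ ∫ x, (A \ A').indicator (fun x => L * √(g.gradInner u.val u.val x)) x ∂g.area :=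
          integral_mono (memLp_one_iff_integrable.1 (memLp_of_continuous
              (g.continuous_gradInner w.contMDiff_val w.contMDiff_val).sqrt 1))
            (((memLp_one_iff_integrable.1 (memLp_of_continuous hsi 1)).const_mul L).indicator
              (hA.diff hA')) hle
      _ = L * ∫ x in A \ A', 1 * √(g.gradInner u.val u.val x) ∂g.area := by
          rw [integral_indicator (hA.diff hA'), integral_const_mul]
          simp
      _ ≤ L * (√(∫ x in A \ A', 1 ^ 2 ∂g.area) *
            √(∫ x in A \ A', √(g.gradInner u.val u.val x) ^ 2 ∂g.area)) := by
          gcongr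
          exact (le_abs_self _).trans (abs_integral_mul_le (memLp_const 1) hs2)
      _ ≤ L * (√m * √E) := by
          gcongr
          · simp only [one_pow, integral_const, smul_eq_mul, mul_one, measureReal_restrict_apply_univ]
            exact measureReal_mono sdiff_subset
          · rw [hE]
            simp_rw [Real.sq_sqrt (hg0 _)]
            exact le_rfl
      _ = _ := by rw [Real.sqrt_mul hm0]
  have h4 : 0 ≤ ∫ x, √(g.gradInner w.val w.val x) ∂g.area :=
    integral_nonneg fun x => Real.sqrt_nonneg _
  have h5 : 0 ≤ ∫ x, |w.val x| ∂g.area := integral_nonneg fun x => abs_nonneg _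
  calc g.area.real A' ≤ C * (∫ x, √(g.gradInner w.val w.val x) ∂g.area +
        ∫ x, |w.val x| ∂g.area) ^ 2 := h1.trans (hC w)
    _ ≤ C * (L * √(m * E) + m) ^ 2 := by gcongr
    _ ≤ C * (2 * (L ^ 2 * (m * E) + 1 * (m * m))) := by
        gcongr
        nlinarith [sq_nonneg (L * √(m * E) - m), Real.sq_sqrt (mul_nonneg hm0 hE0)]
    _ ≤ C * (2 * (max (L ^ 2) 1 * (m * E) + max (L ^ 2) 1 * (m * m))) := by
        have := mul_nonneg hm0 hE0
        gcongr
        · exact le_max_left _ _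
        · exact le_max_right _ _
    _ = _ := by ring

/-- Exponential integrability, uniformly on bounded sets of `H¹`: the areas of the superlevel sets
`{j ≤ u}` decay faster than every geometric sequence. -/
theorem exists_lintegral_exp_le (g : HyperbolicMetric S) {p : ℝ} (hp : 0 ≤ p) {R : ℝ} :
    ∃ C : ENNReal, C ≠ ⊤ ∧ ∀ u : SmoothFunctions g, ‖u‖ ≤ R →
      ∫⁻ x, ENNReal.ofReal (Real.exp (p * u.val x)) ∂g.area ≤ C := by
  obtain ⟨C, hC0, hC⟩ := exists_superlevel_recursion g
  set s := C * R ^ 2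
  set l := Real.exp (p + 1)
  have hl : 0 < l := Real.exp_pos _
  set V := g.area.real univ * Real.exp (2 * p) * Real.exp (l * s)
  set q : NNReal := ⟨Real.exp (-1), (Real.exp_pos _).le⟩
  have hq : (q : ENNReal) < 1 := by
    rw [ENNReal.coe_lt_one_iff, ← NNReal.coe_lt_one]
    change Real.exp (-1) < 1
    rw [← Real.exp_zero, Real.exp_lt_exp]
    norm_num
  refine ⟨ENNReal.ofReal (Real.exp p) * g.area univ + ENNReal.ofReal V * (1 - (q : ENNReal))⁻¹, ?_,
    fun u hu => ?_⟩
  · refine ENNReal.add_ne_top.2 ⟨ENNReal.mul_ne_top ENNReal.ofReal_ne_top (measure_ne_top _ _),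
      ENNReal.mul_ne_top ENNReal.ofReal_ne_top ?_⟩
    rw [ENNReal.inv_ne_top]
    exact (tsub_pos_of_lt hq).ne'
  have hum := u.continuous_val.measurable
  set A : ℕ → Set S := fun j => {x | (j : ℝ) ≤ u.val x}
  have hA : ∀ j, MeasurableSet (A j) := fun j => measurableSet_le measurable_const hum
  set γ : ℕ → ℝ := fun j => ∫ x in A j, g.gradInner u.val u.val x ∂g.area
  set a : ℕ → ℝ := fun k => g.area.real (A (k + 1))
  have hgi := SmoothFunctions.integrable_gradInner u u
  have hg0 := u.gradInner_self_nonneg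
  have hrec : ∀ k, a (k + 1) ≤ C * ((γ (k + 1) - γ (k + 2)) + a k) * a k := by
    intro k
    have := hC u (k + 1)
    simp only [a, γ, A]
    push_cast at this ⊢
    have e : (k : ℝ) + 2 = k + 1 + 1 := by ring
    rw [e]
    exact this
  have hsum : ∀ n, ∑ k ∈ Finset.range n, C * ((γ (k + 1) - γ (k + 2)) + a k) ≤ s := by
    intro n
    rw [← Finset.mul_sum, Finset.sum_add_distrib]
    refine mul_le_mul_of_nonneg_left ?_ hC0
    have h1 : ∑ k ∈ Finset.range n, (γ (k + 1) - γ (k + 2)) = γ 1 - γ (n + 1) :=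
      Finset.sum_range_sub' (fun k => γ (k + 1)) n
    have h2 : γ 1 ≤ ∫ x, g.gradInner u.val u.val x ∂g.area :=
      setIntegral_le_integral hgi (ae_of_all _ hg0)
    have h3 : 0 ≤ γ (n + 1) := integral_nonneg hg0
    have h4 : ∑ k ∈ Finset.range n, a k ≤ ∫ x, u.val x ^ 2 ∂g.area := by
      have e : ∀ k, a k = ∫ x, (A (k + 1)).indicator (fun _ => (1 : ℝ)) x ∂g.area := fun k =>
        (integral_indicator_one (hA _)).symm
      simp_rw [e]
      rw [← integral_finsetSum _ fun k _ => (integrable_const (1 : ℝ)).indicator (hA _)]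
      refine integral_mono (integrable_finsetSum _ fun k _ =>
        (integrable_const (1 : ℝ)).indicator (hA _))
        (memLp_of_continuous u.continuous_val 2).integrable_sq fun x => ?_
      have hn : ∀ n : ℕ, ∑ k ∈ Finset.range n, (A (k + 1)).indicator (fun _ => (1 : ℝ)) x ≤
          max 0 (u.val x) := by
        intro n
        induction n with
        | zero => simp
        | succ n ih =>
          by_cases hx : x ∈ A (n + 1)
          · have hx' : (n : ℝ) + 1 ≤ u.val x := by exact_mod_cast hx
            have : ∑ k ∈ Finset.range (n + 1), (A (k + 1)).indicator (fun _ => (1 : ℝ)) x ≤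
                ∑ k ∈ Finset.range (n + 1), (1 : ℝ) :=
              Finset.sum_le_sum fun k _ => indicator_le_self' (fun _ _ => zero_le_one) x
            refine this.trans (le_max_of_le_right ?_)
            simpa using hx'
          · rw [Finset.sum_range_succ, indicator_of_notMem hx, add_zero]
            exact ih
      by_cases hx : 1 ≤ u.val x
      · refine (hn n).trans ?_
        rw [max_eq_right (by linarith)]
        nlinarith
      · rw [Finset.sum_eq_zero]
        · positivity
        · intro k _
          refine indicator_of_notMem (fun h => hx ?_) _
          have h' : ((k + 1 : ℕ) : ℝ) ≤ u.val x := h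
          push_cast at h'
          have : (0 : ℝ) ≤ k := Nat.cast_nonneg k
          linarith
    have h5 : ‖u‖ ^ 2 ≤ R ^ 2 := by gcongr
    rw [norm_sq_eq] at h5
    rw [h1]
    linarith
  have hgeo := le_geometric_of_summable_ratios (a := a) (fun k => measureReal_nonneg) hrec hsum hl
  have hterm : ∀ k : ℕ, Real.exp (p * (k + 2)) * a k ≤ V * (q : ℝ) ^ k := by
    intro k
    have h0 : a 0 ≤ g.area.real univ := measureReal_mono (subset_univ _)
    have e1 : l⁻¹ ^ k = Real.exp (-(p + 1) * k) := by
      rw [← Real.exp_neg, ← Real.exp_nat_mul]; ring_nf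
    have e2 : (q : ℝ) ^ k = Real.exp (-k) := by
      change Real.exp (-1) ^ k = _
      rw [← Real.exp_nat_mul]; ring_nf
    calc Real.exp (p * (k + 2)) * a k
        ≤ Real.exp (p * (k + 2)) * (g.area.real univ * (l⁻¹ ^ k * Real.exp (l * s))) := by
          gcongr
          exact (hgeo k).trans (by gcongr)
      _ = g.area.real univ * Real.exp (l * s) *
            (Real.exp (p * (k + 2)) * Real.exp (-(p + 1) * k)) := by rw [e1]; ring
      _ = g.area.real univ * Real.exp (l * s) * (Real.exp (2 * p) * Real.exp (-k)) := by
          rw [← Real.exp_add, ← Real.exp_add]; ring_nf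
      _ = _ := by rw [e2]; simp only [V]; ring
  have hpt : ∀ x, ENNReal.ofReal (Real.exp (p * u.val x)) ≤ ENNReal.ofReal (Real.exp p) +
      ∑' k : ℕ, (A (k + 1)).indicator (fun _ => ENNReal.ofReal (Real.exp (p * (k + 2)))) x := by
    intro x
    by_cases hx : 1 ≤ u.val x
    · refine le_add_left (le_trans ?_ (ENNReal.le_tsum (⌊u.val x⌋₊ - 1)))
      have hfl : 1 ≤ ⌊u.val x⌋₊ := Nat.le_floor (by simpa using hx)
      have h1 : ⌊u.val x⌋₊ - 1 + 1 = ⌊u.val x⌋₊ := Nat.sub_add_cancel hfl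
      have h2 : x ∈ A (⌊u.val x⌋₊ - 1 + 1) := by
        rw [h1]
        exact Nat.floor_le (zero_le_one.trans hx)
      rw [indicator_of_mem h2]
      refine ENNReal.ofReal_le_ofReal (Real.exp_le_exp.2 (mul_le_mul_of_nonneg_left ?_ hp))
      have h3 := (Nat.lt_floor_add_one (u.val x)).le
      rw [Nat.cast_sub hfl]
      push_cast
      linarith
    · refine le_add_right (ENNReal.ofReal_le_ofReal (Real.exp_le_exp.2 ?_))
      nlinarith
  calc _ ≤ ∫⁻ x, (ENNReal.ofReal (Real.exp p) + ∑' k : ℕ, (A (k + 1)).indicator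
        (fun _ => ENNReal.ofReal (Real.exp (p * (k + 2)))) x) ∂g.area := lintegral_mono hpt
    _ = ENNReal.ofReal (Real.exp p) * g.area univ +
        ∑' k : ℕ, ENNReal.ofReal (Real.exp (p * (k + 2))) * g.area (A (k + 1)) := by
        rw [lintegral_add_left measurable_const, lintegral_const, lintegral_tsum
          fun k => (measurable_const.indicator (hA _)).aemeasurable]
        simp_rw [lintegral_indicator_const (hA _)]
    _ ≤ ENNReal.ofReal (Real.exp p) * g.area univ + ∑' k : ℕ, ENNReal.ofReal V * (q : ENNReal) ^ k := by
        refine add_le_add le_rfl (ENNReal.tsum_le_tsum fun k => ?_)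
        rw [← ofReal_measureReal (measure_ne_top _ _), ← ENNReal.ofReal_mul (Real.exp_pos _).le,
          ← ENNReal.ofReal_coe_nnreal, ← ENNReal.ofReal_pow (NNReal.coe_nonneg _),
          ← ENNReal.ofReal_mul (by positivity)]
        exact ENNReal.ofReal_le_ofReal (hterm k)
    _ = _ := by rw [ENNReal.tsum_mul_left, ENNReal.tsum_geometric]

end SmoothFunctions

end Exponential

/-! ### Calculus in `H¹(S)` -/

section SobolevCalculus

variable {S : Type*} [TopologicalSpace S] [ChartedSpace ℂ S]
  [IsManifold 𝓘(ℂ) ω S] [CompactSpace S] [MeasurableSpace S] [BorelSpace S]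
  {g : HyperbolicMetric S}

namespace SobolevH1

theorem memLp_fn (v : SobolevH1 g) : MemLp v.fn 2 g.area := Lp.memLp _

theorem aestronglyMeasurable_fn (v : SobolevH1 g) : AEStronglyMeasurable v.fn g.area :=
  v.memLp_fn.1

theorem integrable_fn (v : SobolevH1 g) : Integrable v.fn g.area :=
  v.memLp_fn.integrable (by norm_num)

theorem fn_add (v w : SobolevH1 g) : (v + w).fn =ᵐ[g.area] v.fn + w.fn := by
  rw [fn, map_add]; exact Lp.coeFn_add _ _

theorem fn_sub (v w : SobolevH1 g) : (v - w).fn =ᵐ[g.area] v.fn - w.fn := by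
  rw [fn, map_sub]; exact Lp.coeFn_sub _ _

theorem fn_smul (r : ℝ) (v : SobolevH1 g) : (r • v).fn =ᵐ[g.area] r • v.fn := by
  rw [fn, map_smul]; exact Lp.coeFn_smul _ _

theorem fn_neg (v : SobolevH1 g) : (-v).fn =ᵐ[g.area] -v.fn := by
  rw [fn, map_neg]; exact Lp.coeFn_neg _

theorem inner_toL2 (v w : SobolevH1 g) :
    inner ℝ (toL2 v) (toL2 w) = ∫ x, v.fn x * w.fn x ∂g.area := by
  rw [L2.inner_def]
  refine integral_congr_ae (ae_of_all _ fun x => ?_)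
  simp [fn, mul_comm]

theorem norm_toL2_sq (v : SobolevH1 g) : ‖toL2 v‖ ^ 2 = ∫ x, v.fn x ^ 2 ∂g.area := by
  rw [← real_inner_self_eq_norm_sq, inner_toL2]
  simp_rw [sq]

theorem gradPairing_comm (v w : SobolevH1 g) : v.gradPairing w = w.gradPairing v := by
  rw [gradPairing, gradPairing, real_inner_comm, real_inner_comm (toL2 w)]

theorem gradPairing_add_left (u v w : SobolevH1 g) :
    (u + v).gradPairing w = u.gradPairing w + v.gradPairing w := by
  simp only [gradPairing, map_add, inner_add_left]; ring

theorem gradPairing_sub_left (u v w : SobolevH1 g) :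
    (u - v).gradPairing w = u.gradPairing w - v.gradPairing w := by
  simp only [gradPairing, map_sub, inner_sub_left]; ring

theorem gradPairing_smul_left (r : ℝ) (u v : SobolevH1 g) :
    (r • u).gradPairing v = r * u.gradPairing v := by
  simp only [gradPairing, map_smul, real_inner_smul_left]; ring

theorem gradPairing_add_right (u v w : SobolevH1 g) :
    u.gradPairing (v + w) = u.gradPairing v + u.gradPairing w := by
  simp only [gradPairing_comm u, gradPairing_add_left]

theorem gradPairing_sub_right (u v w : SobolevH1 g) :
    u.gradPairing (v - w) = u.gradPairing v - u.gradPairing w := by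
  simp only [gradPairing_comm u, gradPairing_sub_left]

theorem gradPairing_smul_right (r : ℝ) (u v : SobolevH1 g) :
    u.gradPairing (r • v) = r * u.gradPairing v := by
  simp only [gradPairing_comm u, gradPairing_smul_left]

theorem gradPairing_self (v : SobolevH1 g) :
    v.gradPairing v = ‖v‖ ^ 2 - ‖toL2 v‖ ^ 2 := by
  rw [gradPairing, real_inner_self_eq_norm_sq, real_inner_self_eq_norm_sq]

theorem continuous_gradPairing_self :
    Continuous fun v : SobolevH1 g => v.gradPairing v := by
  simp_rw [gradPairing_self]
  fun_prop

theorem gradPairing_self_nonneg (v : SobolevH1 g) : 0 ≤ v.gradPairing v := by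
  induction v using UniformSpace.Completion.induction_on with
  | hp => exact isClosed_le continuous_const continuous_gradPairing_self
  | ih u =>
    rw [gradPairing_coe]
    exact integral_nonneg u.gradInner_self_nonneg

theorem norm_sq_eq (v : SobolevH1 g) : ‖v‖ ^ 2 = v.gradPairing v + ‖toL2 v‖ ^ 2 := by
  rw [gradPairing_self]; ring

theorem norm_toL2_le (v : SobolevH1 g) : ‖toL2 v‖ ≤ ‖v‖ := by
  have h := v.gradPairing_self_nonneg
  rw [gradPairing_self] at h
  exact le_of_sq_le_sq (by linarith) (norm_nonneg _)

theorem gradPairing_self_le (v : SobolevH1 g) : v.gradPairing v ≤ ‖v‖ ^ 2 := by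
  rw [gradPairing_self]
  linarith [sq_nonneg ‖toL2 v‖]

theorem abs_gradPairing_le (v w : SobolevH1 g) : |v.gradPairing w| ≤ 2 * (‖v‖ * ‖w‖) := by
  have h1 := abs_real_inner_le_norm v w
  have h2 := (abs_real_inner_le_norm (toL2 v) (toL2 w)).trans
    (mul_le_mul v.norm_toL2_le w.norm_toL2_le (norm_nonneg _) (norm_nonneg _))
  rw [gradPairing]
  refine (abs_sub _ _).trans (by linarith)

/-- A positive semidefinite form vanishes against each of its null vectors. -/
theorem gradPairing_eq_zero_of_self {v : SobolevH1 g} (hv : v.gradPairing v = 0)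
    (w : SobolevH1 g) : v.gradPairing w = 0 := by
  by_contra hne
  have h : ∀ t : ℝ, 0 ≤ 2 * t * v.gradPairing w + w.gradPairing w := fun t => by
    have := (t • v + w).gradPairing_self_nonneg
    simp only [gradPairing_add_left, gradPairing_add_right, gradPairing_smul_left,
      gradPairing_smul_right, hv, gradPairing_comm w v] at this
    linarith
  have h1 := h (-(w.gradPairing w + 1) / (2 * v.gradPairing w))
  rw [show 2 * (-(w.gradPairing w + 1) / (2 * v.gradPairing w)) * v.gradPairing w =
    -(w.gradPairing w + 1) by field_simp] at h1
  linarith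

/-- The constant function `c`. -/
noncomputable def const (g : HyperbolicMetric S) (c : ℝ) : SobolevH1 g :=
  ((SmoothFunctions.ofContMDiff (contMDiff_const (c := c)) : SmoothFunctions g) : SobolevH1 g)

theorem fn_const (g : HyperbolicMetric S) (c : ℝ) : (const g c).fn =ᵐ[g.area] fun _ => c :=
  fn_coe _

theorem gradPairing_const_self (c : ℝ) : (const g c).gradPairing (const g c) = 0 := by
  rw [const, gradPairing_coe]
  refine integral_eq_zero_of_ae (ae_of_all _ fun x => ?_)
  have : fderiv ℝ ((fun _ : S => c) ∘ (chartAt ℂ x).symm) (chartAt ℂ x x) = 0 :=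
    fderiv_const_apply c
  simp [HyperbolicMetric.gradInner, chartGradInner, this]

theorem gradPairing_const_left (c : ℝ) (v : SobolevH1 g) : (const g c).gradPairing v = 0 :=
  gradPairing_eq_zero_of_self (gradPairing_const_self c) v

theorem gradPairing_const_right (c : ℝ) (v : SobolevH1 g) : v.gradPairing (const g c) = 0 := by
  rw [gradPairing_comm, gradPairing_const_left]

theorem setIntegral_fn_eq_inner {Q : Set S} (hQ : MeasurableSet Q) (v : SobolevH1 g) :
    ∫ x in Q, v.fn x ∂g.area =
      inner ℝ (indicatorConstLp 2 hQ (measure_ne_top g.area Q) (1 : ℝ)) (toL2 v) :=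
  (L2.inner_indicatorConstLp_one hQ (measure_ne_top _ _) (toL2 v)).symm

theorem continuous_setIntegral_fn {Q : Set S} (hQ : MeasurableSet Q) :
    Continuous fun v : SobolevH1 g => ∫ x in Q, v.fn x ∂g.area := by
  simp_rw [setIntegral_fn_eq_inner hQ]
  exact continuous_const.inner toL2.continuous

theorem setIntegral_fn_coe (u : SmoothFunctions g) (Q : Set S) :
    ∫ x in Q, fn (u : SobolevH1 g) x ∂g.area = ∫ x in Q, u.val x ∂g.area :=
  integral_congr_ae (ae_restrict_of_ae (fn_coe u))

theorem rellich (g : HyperbolicMetric S) {ε : ℝ} (hε : 0 < ε) :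
    ∃ (F : Finset (Σ _ : ChartDisc g, ℤ × ℤ)) (Q : (Σ _ : ChartDisc g, ℤ × ℤ) → Set S)
      (w : (Σ _ : ChartDisc g, ℤ × ℤ) → ℝ), (∀ p, MeasurableSet (Q p)) ∧
      ∀ v : SobolevH1 g, ‖toL2 v‖ ^ 2 ≤ ε * v.gradPairing v +
          ∑ p ∈ F, w p * (∫ x in Q p, v.fn x ∂g.area) ^ 2 := by
  obtain ⟨F, Q, w, hQ, h⟩ := SmoothFunctions.rellich g hε
  refine ⟨F, Q, w, hQ, fun v => ?_⟩
  induction v using UniformSpace.Completion.induction_on with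
  | hp =>
    refine isClosed_le (by fun_prop) ((continuous_const.mul continuous_gradPairing_self).add
      (continuous_finsetSum _ fun p _ => continuous_const.mul
        ((continuous_setIntegral_fn (hQ p)).pow 2)))
  | ih u =>
    rw [gradPairing_coe, norm_toL2_sq,
      Finset.sum_congr rfl fun p _ => by rw [setIntegral_fn_coe u (Q p)]]
    refine le_trans (le_of_eq (integral_congr_ae ?_)) (h u)
    filter_upwards [fn_coe u] with x hx
    rw [hx]

/-- The sequence `v` is bounded and converges weakly to `w` along a fixed nonprincipal
ultrafilter. -/
def IsWeakLimit (v : ℕ → SobolevH1 g) (w : SobolevH1 g) : Prop :=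
  (∃ R, ∀ n, ‖v n‖ ≤ R) ∧
    ∀ y, Tendsto (fun n => inner ℝ (v n) y) (hyperfilter ℕ) (𝓝 (inner ℝ w y))

theorem exists_isWeakLimit (v : ℕ → SobolevH1 g) {R : ℝ} (hv : ∀ n, ‖v n‖ ≤ R) :
    ∃ w, IsWeakLimit v w := by
  obtain ⟨w, -, hw⟩ := exists_weak_limit (hyperfilter ℕ) v R hv
  exact ⟨w, ⟨R, hv⟩, hw⟩

/-- The compactness of the inclusion of `H¹(S)` into `L²(S)`. -/
theorem IsWeakLimit.tendsto_toL2 {v : ℕ → SobolevH1 g} {w : SobolevH1 g} (h : IsWeakLimit v w) :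
    Tendsto (fun n => toL2 (v n)) (hyperfilter ℕ) (𝓝 (toL2 w)) := by
  obtain ⟨⟨R, hR⟩, hw⟩ := h
  set M := (R + ‖w‖) ^ 2
  have hM : ∀ n, (v n - w).gradPairing (v n - w) ≤ M := fun n => by
    refine (gradPairing_self_le _).trans ?_
    have : ‖v n - w‖ ≤ R + ‖w‖ := (norm_sub_le _ _).trans (by linarith [hR n])
    exact pow_le_pow_left₀ (norm_nonneg _) this 2
  have hM0 : 0 ≤ M := sq_nonneg _
  have key : Tendsto (fun n => ‖toL2 (v n) - toL2 w‖ ^ 2) (hyperfilter ℕ) (𝓝 0) := by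
    rw [Metric.tendsto_nhds]
    intro ε hε
    obtain ⟨F, Q, c, hQ, hF⟩ := rellich g (show 0 < ε / (2 * (M + 1)) by positivity)
    have hlin : ∀ p, Tendsto (fun n => ∫ x in Q p, (v n - w).fn x ∂g.area) (hyperfilter ℕ)
        (𝓝 0) := fun p => by
      set q := indicatorConstLp 2 (hQ p) (measure_ne_top g.area (Q p)) (1 : ℝ)
      have h1 := hw (ContinuousLinearMap.adjoint toL2 q)
      have h2 : Tendsto (fun n => inner ℝ (v n - w) (ContinuousLinearMap.adjoint toL2 q))
          (hyperfilter ℕ) (𝓝 0) := by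
        simp_rw [inner_sub_left]
        simpa using h1.sub_const (inner ℝ w (ContinuousLinearMap.adjoint toL2 q))
      refine h2.congr fun n => ?_
      rw [setIntegral_fn_eq_inner (hQ p), ContinuousLinearMap.adjoint_inner_right, real_inner_comm]
    have hsum : Tendsto (fun n => ∑ p ∈ F, c p * (∫ x in Q p, (v n - w).fn x ∂g.area) ^ 2)
        (hyperfilter ℕ) (𝓝 0) := by
      have := tendsto_finsetSum F fun p (_ : p ∈ F) => ((hlin p).pow 2).const_mul (c p)
      simpa using this
    filter_upwards [hsum.eventually (gt_mem_nhds (half_pos hε))] with n hn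
    rw [Real.dist_eq, sub_zero, abs_of_nonneg (sq_nonneg _), ← map_sub]
    have h3 : ε / (2 * (M + 1)) * (v n - w).gradPairing (v n - w) ≤ ε / 2 := by
      calc _ ≤ ε / (2 * (M + 1)) * (M + 1) := by
            gcongr
            linarith [hM n]
        _ = ε / 2 := by field_simp
    linarith [hF (v n - w)]
  rw [tendsto_iff_norm_sub_tendsto_zero]
  have := key.sqrt
  simpa using this

theorem IsWeakLimit.tendsto_gradPairing {v : ℕ → SobolevH1 g} {w : SobolevH1 g}
    (h : IsWeakLimit v w) (y : SobolevH1 g) :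
    Tendsto (fun n => (v n).gradPairing y) (hyperfilter ℕ) (𝓝 (w.gradPairing y)) :=
  (h.2 y).sub (h.tendsto_toL2.inner tendsto_const_nhds)

/-- The Dirichlet energy is weakly lower semicontinuous. -/
theorem IsWeakLimit.gradPairing_le {v : ℕ → SobolevH1 g} {w : SobolevH1 g}
    (h : IsWeakLimit v w) {c : ℕ → ℝ} {c₀ : ℝ} (hc : Tendsto c (hyperfilter ℕ) (𝓝 c₀))
    (hle : ∀ n, (v n).gradPairing (v n) ≤ c n) : w.gradPairing w ≤ c₀ := by
  have h1 := ((h.tendsto_gradPairing w).const_mul 2).sub_const (w.gradPairing w)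
  have h2 := le_of_tendsto_of_tendsto' h1 hc fun n => by
    have := (v n - w).gradPairing_self_nonneg
    rw [gradPairing_sub_left, gradPairing_sub_right, gradPairing_sub_right,
      gradPairing_comm w] at this
    linarith [hle n]
  linarith

theorem exists_subseq_ae_tendsto {f : ℕ → Lp ℝ 2 g.area} {f₀ : Lp ℝ 2 g.area}
    (h : Tendsto f atTop (𝓝 f₀)) : ∃ k : ℕ → ℕ, StrictMono k ∧
      ∀ᵐ x ∂g.area, Tendsto (fun n => f (k n) x) atTop (𝓝 (f₀ x)) :=
  (tendstoInMeasure_of_tendsto_Lp h).exists_seq_tendsto_ae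

theorem exists_subseq_of_hyperfilter {X : Type*} [TopologicalSpace X] [FirstCountableTopology X]
    {f : ℕ → X} {a : X} (h : Tendsto f (hyperfilter ℕ) (𝓝 a)) :
    ∃ k : ℕ → ℕ, StrictMono k ∧ Tendsto (fun n => f (k n)) atTop (𝓝 a) := by
  have h1 : MapClusterPt a (hyperfilter ℕ : Filter ℕ) f := h.mapClusterPt
  have h2 : MapClusterPt a atTop f := h1.mono Nat.hyperfilter_le_atTop
  obtain ⟨k, hk, hk2⟩ := h2.tendsto_subseq
  exact ⟨k, hk, hk2⟩

theorem exists_smooth_seq (v : SobolevH1 g) : ∃ u : ℕ → SmoothFunctions g,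
    Tendsto (fun n => (u n : SobolevH1 g)) atTop (𝓝 v) ∧
      ∀ᵐ x ∂g.area, Tendsto (fun n => (u n).val x) atTop (𝓝 (v.fn x)) := by
  obtain ⟨x, hx, hxv⟩ := mem_closure_iff_seq_limit.1 (UniformSpace.Completion.denseRange_coe v)
  choose u hu using hx
  obtain rfl : (fun n => (u n : SobolevH1 g)) = x := funext hu
  obtain ⟨k, hk, hae⟩ := exists_subseq_ae_tendsto ((toL2.continuous.tendsto v).comp hxv)
  refine ⟨fun n => u (k n), hxv.comp hk.tendsto_atTop, ?_⟩
  have h2 : ∀ᵐ x ∂g.area, ∀ n, fn (u (k n) : SobolevH1 g) x = (u (k n)).val x :=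
    ae_all_iff.2 fun n => fn_coe _
  filter_upwards [hae, h2] with x h1 h2
  exact h1.congr fun n => h2 n

/-- The weak limit of smooth functions that converge almost everywhere is the pointwise limit. -/
theorem IsWeakLimit.fn_ae_eq {u : ℕ → SmoothFunctions g} {w : SobolevH1 g}
    (h : IsWeakLimit (fun n => (u n : SobolevH1 g)) w) {f : S → ℝ}
    (hf : ∀ᵐ x ∂g.area, Tendsto (fun n => (u n).val x) atTop (𝓝 (f x))) : w.fn =ᵐ[g.area] f := by
  obtain ⟨k, hk, hk2⟩ := exists_subseq_of_hyperfilter h.tendsto_toL2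
  obtain ⟨l, hl, hae⟩ := exists_subseq_ae_tendsto hk2
  have h2 : ∀ᵐ x ∂g.area, ∀ n, fn (u n : SobolevH1 g) x = (u n).val x :=
    ae_all_iff.2 fun n => fn_coe _
  filter_upwards [hf, hae, h2] with x h1 h3 h2
  exact tendsto_nhds_unique h3 ((h1.comp (hk.comp hl).tendsto_atTop).congr fun n => (h2 _).symm)

theorem norm_comp_coe_le (u : SmoothFunctions g) {F : ℝ → ℝ} (hF : ContDiff ℝ ∞ F) {L : ℝ}
    (hL : ∀ x, |deriv F x| ≤ L) :
    ‖((u.comp hF : SmoothFunctions g) : SobolevH1 g)‖ ^ 2 ≤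
      2 * L ^ 2 * ‖u‖ ^ 2 + 2 * F 0 ^ 2 * g.area.real univ := by
  have hL0 : 0 ≤ L := (abs_nonneg _).trans (hL 0)
  have hgi := SmoothFunctions.integrable_gradInner u u
  have hui : Integrable (fun x => u.val x ^ 2) g.area :=
    (memLp_of_continuous u.continuous_val 2).integrable_sq
  rw [UniformSpace.Completion.norm_coe, SmoothFunctions.norm_sq_eq, SmoothFunctions.norm_sq_eq]
  have h1 : ∫ x, g.gradInner (u.comp hF).val (u.comp hF).val x ∂g.area ≤
      L ^ 2 * ∫ x, g.gradInner u.val u.val x ∂g.area := by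
    rw [← integral_const_mul]
    refine integral_mono (SmoothFunctions.integrable_gradInner _ _) (hgi.const_mul _) fun x => ?_
    change g.gradInner _ _ x ≤ _
    rw [SmoothFunctions.gradInner_comp_comp]
    refine mul_le_mul_of_nonneg_right ?_ (u.gradInner_self_nonneg x)
    rw [← sq, ← sq_abs]
    have := hL (u.val x)
    gcongr
  have h2 : ∫ x, (u.comp hF).val x ^ 2 ∂g.area ≤
      2 * L ^ 2 * ∫ x, u.val x ^ 2 ∂g.area + 2 * F 0 ^ 2 * g.area.real univ := by
    rw [← integral_const_mul, mul_comm _ (g.area.real univ), ← smul_eq_mul (g.area.real univ),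
      ← integral_const, ← integral_add (hui.const_mul _) (integrable_const _)]
    refine integral_mono (memLp_of_continuous (u.comp hF).continuous_val 2).integrable_sq
      ((hui.const_mul _).add (integrable_const _)) fun x => ?_
    have h3 : |F (u.val x) - F 0| ≤ L * |u.val x| := by
      have := Convex.norm_image_sub_le_of_norm_deriv_le (f := F) (s := univ) (x := 0) (y := u.val x)
        (fun y _ => (hF.differentiable (by simp)) y) (fun y _ => hL y) convex_univ trivial trivial
      simpa using this
    have h4 : (F (u.val x) - F 0) ^ 2 ≤ L ^ 2 * u.val x ^ 2 := by
      rw [← sq_abs, ← sq_abs (u.val x), ← mul_pow]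
      gcongr
    simp only [SmoothFunctions.val_comp, Function.comp_apply]
    nlinarith [sq_nonneg (F (u.val x) - 2 * F 0)]
  have h3 : 0 ≤ ∫ x, g.gradInner u.val u.val x ∂g.area := integral_nonneg u.gradInner_self_nonneg
  nlinarith [mul_nonneg (sq_nonneg L) h3]

theorem exists_norm_bound_of_tendsto {u : ℕ → SmoothFunctions g} {v : SobolevH1 g}
    (hu : Tendsto (fun n => (u n : SobolevH1 g)) atTop (𝓝 v)) : ∃ R, ∀ n, ‖u n‖ ≤ R := by
  obtain ⟨R, hR⟩ := hu.norm.bddAbove_range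
  exact ⟨R, fun n => by rw [← UniformSpace.Completion.norm_coe]; exact hR ⟨n, rfl⟩⟩

theorem exists_isWeakLimit_comp {u : ℕ → SmoothFunctions g} {v : SobolevH1 g}
    (hu : Tendsto (fun n => (u n : SobolevH1 g)) atTop (𝓝 v)) {F : ℕ → ℝ → ℝ}
    (hF : ∀ n, ContDiff ℝ ∞ (F n)) {L M : ℝ} (hL : ∀ n x, |deriv (F n) x| ≤ L)
    (hM : ∀ n, F n 0 ^ 2 ≤ M) :
    ∃ w, IsWeakLimit (fun n => (((u n).comp (hF n) : SmoothFunctions g) : SobolevH1 g)) w := by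
  obtain ⟨R, hR⟩ := exists_norm_bound_of_tendsto hu
  refine exists_isWeakLimit _ (R := √(2 * L ^ 2 * R ^ 2 + 2 * M * g.area.real univ)) fun n => ?_
  refine Real.le_sqrt_of_sq_le ((norm_comp_coe_le (u n) (hF n) (hL n)).trans ?_)
  have := hM n
  have := hR n
  gcongr

/-- A weak form of the chain rule: if `G'² ≤ F'`, then `‖∇ (G ∘ v)‖² ≤ ∫ ⟨∇ v, ∇ (F ∘ v)⟩`. -/
theorem exists_comp (v : SobolevH1 g) {F G : ℝ → ℝ} (hF : ContDiff ℝ ∞ F) (hG : ContDiff ℝ ∞ G)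
    {L : ℝ} (hFL : ∀ x, |deriv F x| ≤ L) (hGL : ∀ x, |deriv G x| ≤ L)
    (hFG : ∀ x, deriv G x ^ 2 ≤ deriv F x) :
    ∃ φ γ : SobolevH1 g, φ.fn =ᵐ[g.area] (fun x => F (v.fn x)) ∧
      γ.fn =ᵐ[g.area] (fun x => G (v.fn x)) ∧ γ.gradPairing γ ≤ v.gradPairing φ := by
  obtain ⟨u, hu, hae⟩ := exists_smooth_seq v
  obtain ⟨φ, hφ⟩ := exists_isWeakLimit_comp hu (fun _ => hF) (fun _ => hFL) fun _ => le_rfl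
  obtain ⟨γ, hγ⟩ := exists_isWeakLimit_comp hu (fun _ => hG) (fun _ => hGL) fun _ => le_rfl
  refine ⟨φ, γ, hφ.fn_ae_eq ?_, hγ.fn_ae_eq ?_, ?_⟩
  · filter_upwards [hae] with x hx using (hF.continuous.tendsto _).comp hx
  · filter_upwards [hae] with x hx using (hG.continuous.tendsto _).comp hx
  · obtain ⟨R, hR⟩ := hφ.1
    have h1 : Tendsto (fun n => gradPairing ((u n : SobolevH1 g) - v) ((u n).comp hF : SmoothFunctions g))
        (hyperfilter ℕ) (𝓝 0) := by
      have h3 : Tendsto (fun n => 2 * (‖(u n : SobolevH1 g) - v‖ * R)) (hyperfilter ℕ) (𝓝 0) := by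
        have := ((tendsto_iff_norm_sub_tendsto_zero.1 hu).mul_const R).const_mul 2
        simpa using this.mono_left Nat.hyperfilter_le_atTop
      refine squeeze_zero_norm (fun n => ?_) h3
      refine (abs_gradPairing_le _ _).trans ?_
      have := hR n
      gcongr
    have h2 : Tendsto (fun n => gradPairing (u n : SobolevH1 g) ((u n).comp hF : SmoothFunctions g))
        (hyperfilter ℕ) (𝓝 (v.gradPairing φ)) := by
      have h4 := h1.add (hφ.tendsto_gradPairing v)
      rw [zero_add, gradPairing_comm φ] at h4
      refine h4.congr fun n => ?_
      rw [gradPairing_sub_left, gradPairing_comm _ v]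
      ring
    refine hγ.gradPairing_le h2 fun n => ?_
    rw [gradPairing_coe, gradPairing_coe]
    refine integral_mono (SmoothFunctions.integrable_gradInner _ _)
      (SmoothFunctions.integrable_gradInner _ _) fun x => ?_
    change g.gradInner _ _ x ≤ g.gradInner _ _ x
    rw [SmoothFunctions.gradInner_comp_comp, SmoothFunctions.gradInner_self_comp, ← sq]
    exact mul_le_mul_of_nonneg_right (hFG _) ((u n).gradInner_self_nonneg x)

theorem contDiff_sqrt_sq_add {a : ℝ} (ha : 0 < a) : ContDiff ℝ ∞ fun x : ℝ => √(x ^ 2 + a) :=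
  ((contDiff_id.pow 2).add contDiff_const).sqrt fun x => by
    have := sq_nonneg (id x); positivity

theorem hasDerivAt_sqrt_sq_add {a : ℝ} (ha : 0 < a) (x : ℝ) :
    HasDerivAt (fun x : ℝ => √(x ^ 2 + a)) (x / √(x ^ 2 + a)) x := by
  have h := ((hasDerivAt_pow 2 x).add_const a).sqrt (by positivity)
  convert h using 1
  rw [Nat.cast_ofNat, Nat.add_one_sub_one, pow_one, mul_div_mul_left _ _ two_ne_zero]

/-- The absolute value of an element of `H¹(S)` is in `H¹(S)`, with no larger energy. -/
theorem exists_abs (v : SobolevH1 g) : ∃ ψ : SobolevH1 g,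
    ψ.fn =ᵐ[g.area] (fun x => |v.fn x|) ∧ ψ.gradPairing ψ ≤ v.gradPairing v := by
  obtain ⟨u, hu, hae⟩ := exists_smooth_seq v
  have hpos : ∀ n : ℕ, (0 : ℝ) < 1 / (n + 1) := fun n => by positivity
  have hder : ∀ (n : ℕ) x, |deriv (fun x : ℝ => √(x ^ 2 + 1 / ((n : ℝ) + 1))) x| ≤ 1 := by
    intro n x
    have h0 : 0 < √(x ^ 2 + 1 / ((n : ℝ) + 1)) := Real.sqrt_pos.2 (by have := hpos n; positivity)
    rw [(hasDerivAt_sqrt_sq_add (hpos n) x).deriv, abs_div, abs_of_pos h0, div_le_one h0]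
    exact Real.abs_le_sqrt (by linarith [hpos n])
  obtain ⟨ψ, hψ⟩ := exists_isWeakLimit_comp hu (fun n => contDiff_sqrt_sq_add (hpos n)) hder
    (M := 1) fun n => by
      rw [Real.sq_sqrt (by have := hpos n; positivity)]
      simp only [ne_eq, OfNat.ofNat_ne_zero, not_false_eq_true, zero_pow, zero_add]
      rw [div_le_one (by positivity)]
      linarith [Nat.cast_nonneg (α := ℝ) n]
  refine ⟨ψ, hψ.fn_ae_eq ?_, ?_⟩
  · filter_upwards [hae] with x hx
    have := ((hx.pow 2).add tendsto_one_div_add_atTop_nhds_zero_nat).sqrt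
    rwa [add_zero, Real.sqrt_sq_eq_abs] at this
  · refine hψ.gradPairing_le (c := fun n => gradPairing (u n : SobolevH1 g) (u n : SobolevH1 g))
      (((continuous_gradPairing_self.tendsto v).comp hu).mono_left Nat.hyperfilter_le_atTop)
      fun n => ?_
    rw [gradPairing_coe, gradPairing_coe]
    refine integral_mono (SmoothFunctions.integrable_gradInner _ _)
      (SmoothFunctions.integrable_gradInner _ _) fun x => ?_
    change g.gradInner _ _ x ≤ g.gradInner _ _ x
    rw [SmoothFunctions.gradInner_comp_comp, ← sq, ← sq_abs]
    refine mul_le_of_le_one_left ((u n).gradInner_self_nonneg x) ?_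
    exact pow_le_one₀ (abs_nonneg _) (hder n _)

/-- The positive part of an element of `H¹(S)`, with the Stampacchia inequality. -/
theorem exists_posPart (v : SobolevH1 g) : ∃ φ : SobolevH1 g,
    φ.fn =ᵐ[g.area] (fun x => max (v.fn x) 0) ∧ φ.gradPairing φ ≤ v.gradPairing φ := by
  obtain ⟨ψ, hψ, hE⟩ := v.exists_abs
  refine ⟨(1 / 2 : ℝ) • (v + ψ), ?_, ?_⟩
  · filter_upwards [fn_smul (1 / 2) (v + ψ), fn_add v ψ, hψ] with x h1 h2 h3
    rw [h1, Pi.smul_apply, h2, Pi.add_apply, h3, smul_eq_mul]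
    rcases le_total 0 (v.fn x) with h | h
    · rw [abs_of_nonneg h, max_eq_left h]; ring
    · rw [abs_of_nonpos h, max_eq_right h]; ring
  · simp only [gradPairing_smul_left, gradPairing_smul_right, gradPairing_add_left,
      gradPairing_add_right, gradPairing_comm ψ v]
    linarith

end SobolevH1

end SobolevCalculus

/-! ### Exponentials of functions in `H¹(S)` -/

section ExponentialSobolev

variable {S : Type*} [TopologicalSpace S] [ChartedSpace ℂ S]
  [IsManifold 𝓘(ℂ) ω S] [CompactSpace S] [MeasurableSpace S] [BorelSpace S]
  {g : HyperbolicMetric S}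

namespace SobolevH1

theorem exists_lintegral_exp_abs_le (g : HyperbolicMetric S) {p : ℝ} (hp : 0 ≤ p) (R : ℝ) :
    ∃ C : ENNReal, C ≠ ⊤ ∧ ∀ v : SobolevH1 g, ‖v‖ ≤ R →
      ∫⁻ x, ENNReal.ofReal (Real.exp (p * |v.fn x|)) ∂g.area ≤ C := by
  obtain ⟨C, hC, h⟩ := SmoothFunctions.exists_lintegral_exp_le g hp (R := R + 1)
  refine ⟨C + C, ENNReal.add_ne_top.2 ⟨hC, hC⟩, fun v hv => ?_⟩
  obtain ⟨u, hu, hae⟩ := exists_smooth_seq v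
  have hsm : ∀ w : SmoothFunctions g, ‖w‖ ≤ R + 1 →
      ∫⁻ x, ENNReal.ofReal (Real.exp (p * |w.val x|)) ∂g.area ≤ C + C := by
    intro w hw
    have hneg : ‖-w‖ ≤ R + 1 := by rwa [norm_neg]
    refine le_trans ?_ (add_le_add (h w hw) (h (-w) hneg))
    rw [← lintegral_add_left (by
      exact (Real.measurable_exp.comp (w.continuous_val.measurable.const_mul p)).ennreal_ofReal)]
    refine lintegral_mono fun x => ?_
    rw [← ENNReal.ofReal_add (Real.exp_pos _).le (Real.exp_pos _).le]
    refine ENNReal.ofReal_le_ofReal ?_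
    change _ ≤ Real.exp (p * w.val x) + Real.exp (p * -w.val x)
    have h1 := Real.exp_pos (p * w.val x)
    have h2 := Real.exp_pos (p * -w.val x)
    rcases abs_cases (w.val x) with ⟨h, -⟩ | ⟨h, -⟩ <;> rw [h] <;> linarith
  have hev : ∀ᶠ n in atTop, ∫⁻ x, ENNReal.ofReal (Real.exp (p * |(u n).val x|)) ∂g.area ≤ C + C := by
    have h1 := hu.norm.eventually (gt_mem_nhds (lt_of_le_of_lt hv (lt_add_one R)))
    filter_upwards [h1] with n hn
    rw [UniformSpace.Completion.norm_coe] at hn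
    exact hsm _ hn.le
  calc ∫⁻ x, ENNReal.ofReal (Real.exp (p * |v.fn x|)) ∂g.area
      = ∫⁻ x, liminf (fun n => ENNReal.ofReal (Real.exp (p * |(u n).val x|))) atTop ∂g.area := by
        refine lintegral_congr_ae ?_
        filter_upwards [hae] with x hx
        exact (ENNReal.tendsto_ofReal ((Real.continuous_exp.tendsto _).comp
          (hx.abs.const_mul p))).liminf_eq.symm
    _ ≤ liminf (fun n => ∫⁻ x, ENNReal.ofReal (Real.exp (p * |(u n).val x|)) ∂g.area) atTop :=
        lintegral_liminf_le fun n => (Real.measurable_exp.comp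
          ((u n).continuous_val.measurable.abs.const_mul p)).ennreal_ofReal
    _ ≤ C + C := by
        refine (liminf_le_liminf hev).trans ?_
        simp

theorem aestronglyMeasurable_exp_abs (v : SobolevH1 g) (p : ℝ) :
    AEStronglyMeasurable (fun x => Real.exp (p * |v.fn x|)) g.area :=
  (by fun_prop : Continuous fun y : ℝ => Real.exp (p * |y|)).comp_aestronglyMeasurable
    v.aestronglyMeasurable_fn

/-- Exponentials of functions in `H¹(S)` are integrable, uniformly on bounded sets. -/
theorem exists_integral_exp_abs_le (g : HyperbolicMetric S) {p : ℝ} (hp : 0 ≤ p) (R : ℝ) :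
    ∃ C : ℝ, 0 ≤ C ∧ ∀ v : SobolevH1 g, ‖v‖ ≤ R →
      Integrable (fun x => Real.exp (p * |v.fn x|)) g.area ∧
        ∫ x, Real.exp (p * |v.fn x|) ∂g.area ≤ C := by
  obtain ⟨C, hC, h⟩ := exists_lintegral_exp_abs_le g hp R
  refine ⟨C.toReal, ENNReal.toReal_nonneg, fun v hv => ?_⟩
  have hm := v.aestronglyMeasurable_exp_abs p
  have h0 : 0 ≤ᵐ[g.area] fun x => Real.exp (p * |v.fn x|) :=
    ae_of_all _ fun x => (Real.exp_pos _).le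
  refine ⟨⟨hm, ?_⟩, ?_⟩
  · rw [hasFiniteIntegral_iff_ofReal h0]
    exact (h v hv).trans_lt hC.lt_top
  · rw [integral_eq_lintegral_of_nonneg_ae h0 hm]
    exact ENNReal.toReal_mono hC (h v hv)

theorem exp_abs_mul_le (p v a b c : ℝ) : Real.exp (p * |v|) * (|a| * |b| * |c|) ≤
    Real.exp (4 * p * |v|) + Real.exp (4 * |a|) + Real.exp (4 * |b|) + Real.exp (4 * |c|) := by
  have hx : ∀ y : ℝ, |y| ≤ Real.exp |y| := fun y => by linarith [Real.add_one_le_exp |y|]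
  have h1 : Real.exp (p * |v|) * (|a| * |b| * |c|) ≤ Real.exp (p * |v| + |a| + |b| + |c|) := by
    rw [Real.exp_add, Real.exp_add, Real.exp_add, mul_assoc, mul_assoc, mul_assoc]
    gcongr
    · exact hx a
    · exact hx b
    · exact hx c
  refine h1.trans ?_
  have key : ∀ {m : ℝ}, p * |v| ≤ m → |a| ≤ m → |b| ≤ m → |c| ≤ m →
      Real.exp (p * |v| + |a| + |b| + |c|) ≤ Real.exp (4 * m) := fun h1 h2 h3 h4 =>
    Real.exp_le_exp.2 (by linarith)
  have e1 := Real.exp_pos (4 * p * |v|)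
  have e2 := Real.exp_pos (4 * |a|)
  have e3 := Real.exp_pos (4 * |b|)
  have e4 := Real.exp_pos (4 * |c|)
  rw [mul_assoc] at e1 ⊢
  obtain ⟨m, hm, h2, h3, h4, h5⟩ : ∃ m, (m = p * |v| ∨ m = |a| ∨ m = |b| ∨ m = |c|) ∧
      p * |v| ≤ m ∧ |a| ≤ m ∧ |b| ≤ m ∧ |c| ≤ m := by
    refine ⟨max (max (p * |v|) |a|) (max |b| |c|), ?_, by simp, by simp, by simp, by simp⟩
    rcases max_choice (max (p * |v|) |a|) (max |b| |c|) with h | h <;> rw [h]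
    · rcases max_choice (p * |v|) |a| with h | h <;> simp [h]
    · rcases max_choice |b| |c| with h | h <;> simp [h]
  have hk := key h2 h3 h4 h5
  rcases hm with rfl | rfl | rfl | rfl <;> linarith

/-- The basic estimate for exponential nonlinearities. By homogeneity it reduces to unit vectors,
for which it follows from exponential integrability. -/
theorem exists_integral_exp_mul_le (g : HyperbolicMetric S) {p : ℝ} (hp : 0 ≤ p) (R : ℝ) :
    ∃ C : ℝ, 0 ≤ C ∧ ∀ v a b c : SobolevH1 g, ‖v‖ ≤ R →
      Integrable (fun x => Real.exp (p * |v.fn x|) * (|a.fn x| * |b.fn x| * |c.fn x|)) g.area ∧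
        ∫ x, Real.exp (p * |v.fn x|) * (|a.fn x| * |b.fn x| * |c.fn x|) ∂g.area ≤
          C * (‖a‖ * ‖b‖ * ‖c‖) := by
  obtain ⟨C₁, hC₁, h₁⟩ := exists_integral_exp_abs_le g (show 0 ≤ 4 * p by positivity) R
  obtain ⟨C₂, hC₂, h₂⟩ := exists_integral_exp_abs_le g (show (0 : ℝ) ≤ 4 by norm_num) 1
  refine ⟨C₁ + C₂ + C₂ + C₂, by positivity, ?_⟩
  have hunit : ∀ v a b c : SobolevH1 g, ‖v‖ ≤ R → ‖a‖ ≤ 1 → ‖b‖ ≤ 1 → ‖c‖ ≤ 1 →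
      Integrable (fun x => Real.exp (p * |v.fn x|) * (|a.fn x| * |b.fn x| * |c.fn x|)) g.area ∧
        ∫ x, Real.exp (p * |v.fn x|) * (|a.fn x| * |b.fn x| * |c.fn x|) ∂g.area ≤
          C₁ + C₂ + C₂ + C₂ := by
    intro v a b c hv ha hb hc
    obtain ⟨iv, bv⟩ := h₁ v hv
    obtain ⟨ia, ba⟩ := h₂ a ha
    obtain ⟨ib, bb⟩ := h₂ b hb
    obtain ⟨ic, bc⟩ := h₂ c hc
    have hsum := ((iv.add ia).add ib).add ic
    have hi : Integrable (fun x => Real.exp (p * |v.fn x|) * (|a.fn x| * |b.fn x| * |c.fn x|))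
        g.area := by
      refine hsum.mono' ((v.aestronglyMeasurable_exp_abs p).mul
        ((a.aestronglyMeasurable_fn.norm.mul b.aestronglyMeasurable_fn.norm).mul
          c.aestronglyMeasurable_fn.norm)) (ae_of_all _ fun x => ?_)
      rw [Real.norm_of_nonneg (by positivity)]
      exact exp_abs_mul_le _ _ _ _ _
    refine ⟨hi, (integral_mono hi hsum fun x => exp_abs_mul_le _ _ _ _ _).trans ?_⟩
    simp only [Pi.add_apply]
    rw [integral_add (by exact (iv.add ia).add ib) ic, integral_add (by exact iv.add ia) ib,
      integral_add iv ia]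
    linarith
  intro v a b c hv
  have hz : ∀ {a : SobolevH1 g}, ‖a‖ = 0 → a.fn =ᵐ[g.area] 0 := fun {a} h => by
    rw [norm_eq_zero.1 h, fn, map_zero]
    exact Lp.coeFn_zero _ _ _
  by_cases h0 : ‖a‖ = 0 ∨ ‖b‖ = 0 ∨ ‖c‖ = 0
  · have hzero : (fun x => Real.exp (p * |v.fn x|) * (|a.fn x| * |b.fn x| * |c.fn x|))
        =ᵐ[g.area] fun _ => 0 := by
      rcases h0 with h | h | h <;> filter_upwards [hz h] with x hx <;> simp [hx]
    refine ⟨(integrable_congr hzero).2 (integrable_zero _ _ _), ?_⟩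
    rw [integral_congr_ae hzero, integral_zero]
    positivity
  · simp only [not_or] at h0
    obtain ⟨ha, hb, hc⟩ := h0
    have hn : ∀ {a : SobolevH1 g}, ‖a‖ ≠ 0 → ‖‖a‖⁻¹ • a‖ ≤ 1 := fun {a} h => by
      rw [norm_smul, norm_inv, norm_norm, inv_mul_cancel₀ h]
    have hf : ∀ a : SobolevH1 g, ‖a‖ ≠ 0 →
        ∀ᵐ x ∂g.area, |a.fn x| = ‖a‖ * |(‖a‖⁻¹ • a).fn x| := by
      intro a h
      filter_upwards [fn_smul ‖a‖⁻¹ a] with x hx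
      rw [hx, Pi.smul_apply, smul_eq_mul, abs_mul, abs_inv, abs_norm, mul_inv_cancel_left₀ h]
    obtain ⟨hi, hle⟩ := hunit v _ _ _ hv (hn ha) (hn hb) (hn hc)
    have heq : (fun x => Real.exp (p * |v.fn x|) * (|a.fn x| * |b.fn x| * |c.fn x|))
        =ᵐ[g.area] fun x => (‖a‖ * ‖b‖ * ‖c‖) * (Real.exp (p * |v.fn x|) *
          (|(‖a‖⁻¹ • a).fn x| * |(‖b‖⁻¹ • b).fn x| * |(‖c‖⁻¹ • c).fn x|)) := by
      filter_upwards [hf a ha, hf b hb, hf c hc] with x h1 h2 h3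
      rw [h1, h2, h3]
      ring
    refine ⟨(integrable_congr heq).2 (hi.const_mul _), ?_⟩
    rw [integral_congr_ae heq, integral_const_mul, mul_comm]
    gcongr

theorem exists_integral_exp_mul_mul_le (g : HyperbolicMetric S) {p : ℝ} (hp : 0 ≤ p) (R : ℝ) :
    ∃ C : ℝ, 0 ≤ C ∧ ∀ v a b : SobolevH1 g, ‖v‖ ≤ R →
      Integrable (fun x => Real.exp (p * |v.fn x|) * (|a.fn x| * |b.fn x|)) g.area ∧
        ∫ x, Real.exp (p * |v.fn x|) * (|a.fn x| * |b.fn x|) ∂g.area ≤ C * (‖a‖ * ‖b‖) := by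
  obtain ⟨C, hC, h⟩ := exists_integral_exp_mul_le g hp R
  refine ⟨C * ‖const g 1‖, by positivity, fun v a b hv => ?_⟩
  obtain ⟨hi, hle⟩ := h v a b (const g 1) hv
  have heq : (fun x => Real.exp (p * |v.fn x|) * (|a.fn x| * |b.fn x| * |(const g 1).fn x|))
      =ᵐ[g.area] fun x => Real.exp (p * |v.fn x|) * (|a.fn x| * |b.fn x|) := by
    filter_upwards [fn_const g 1] with x hx
    rw [hx]; simp
  refine ⟨(integrable_congr heq).1 hi, ?_⟩
  rw [← integral_congr_ae heq]
  refine hle.trans (le_of_eq (by ring))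

theorem integrable_exp_mul_mul (v a b : SobolevH1 g) {w : S → ℝ} {W : ℝ} (hw : Measurable w)
    (hW : ∀ x, |w x| ≤ W) :
    Integrable (fun x => w x * Real.exp (v.fn x) * (a.fn x * b.fn x)) g.area := by
  obtain ⟨C, hC, h⟩ := exists_integral_exp_mul_mul_le g zero_le_one ‖v‖
  refine ((h v a b le_rfl).1.const_mul W).mono' ((hw.aestronglyMeasurable.mul
    (Real.continuous_exp.comp_aestronglyMeasurable v.aestronglyMeasurable_fn)).mul
      (a.aestronglyMeasurable_fn.mul b.aestronglyMeasurable_fn)) (ae_of_all _ fun x => ?_)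
  rw [norm_mul, norm_mul, norm_mul, Real.norm_eq_abs, Real.norm_eq_abs, Real.norm_eq_abs,
    Real.norm_eq_abs, Real.abs_exp, one_mul, mul_assoc]
  have hW0 : 0 ≤ W := (abs_nonneg _).trans (hW x)
  gcongr
  · exact hW x
  · exact le_abs_self _

theorem integrable_exp_mul (v a : SobolevH1 g) {w : S → ℝ} {W : ℝ} (hw : Measurable w)
    (hW : ∀ x, |w x| ≤ W) : Integrable (fun x => w x * Real.exp (v.fn x) * a.fn x) g.area := by
  refine (integrable_congr ?_).1 (v.integrable_exp_mul_mul a (const g 1) hw hW)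
  filter_upwards [fn_const g 1] with x hx
  rw [hx, mul_one]

theorem integrable_exp (v : SobolevH1 g) {w : S → ℝ} {W : ℝ} (hw : Measurable w)
    (hW : ∀ x, |w x| ≤ W) : Integrable (fun x => w x * Real.exp (v.fn x)) g.area := by
  refine (integrable_congr ?_).1 (v.integrable_exp_mul (const g 1) hw hW)
  filter_upwards [fn_const g 1] with x hx
  rw [hx, mul_one]

end SobolevH1

theorem abs_exp_sub_one_le (y : ℝ) : |Real.exp y - 1| ≤ |y| * Real.exp |y| := by
  have h1 := Real.add_one_le_exp (-y)
  have h2 := Real.add_one_le_exp y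
  have h3 : Real.exp (-y) * Real.exp y = 1 := by rw [← Real.exp_add]; simp
  have h4 := Real.exp_pos y
  rcases abs_cases y with ⟨h, h0⟩ | ⟨h, h0⟩ <;> rw [h]
  · rw [abs_of_nonneg (by linarith)]
    nlinarith
  · have h5 : 1 ≤ Real.exp (-y) := Real.one_le_exp (by linarith)
    rw [abs_of_nonpos (by nlinarith)]
    nlinarith

theorem abs_exp_sub_one_sub_le (y : ℝ) : |Real.exp y - 1 - y| ≤ |y| * |y| * Real.exp |y| := by
  have h1 := Real.add_one_le_exp y
  rw [abs_of_nonneg (by linarith)]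
  have h2 := Real.add_one_le_exp (-y)
  have h3 : Real.exp (-y) * Real.exp y = 1 := by rw [← Real.exp_add]; simp
  have h4 := Real.exp_pos y
  rcases abs_cases y with ⟨h, h0⟩ | ⟨h, h0⟩ <;> rw [h]
  · nlinarith [mul_nonneg h0 h4.le]
  · have h5 : 1 ≤ Real.exp (-y) := Real.one_le_exp (by linarith)
    nlinarith [mul_self_nonneg y]

section ExpFunctional

open SobolevH1

variable {w : S → ℝ} {W : ℝ}

/-- A bounded weight `w` and `v ∈ H¹(S)` define the continuous functional `φ ↦ ∫ w e^v φ dA`. -/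
noncomputable def expFunctionalDeriv (w : S → ℝ) (W : ℝ) (hw : Measurable w) (hW : ∀ x, |w x| ≤ W)
    (v : SobolevH1 g) : SobolevH1 g →L[ℝ] ℝ :=
  (LinearMap.mkContinuousOfExistsBound
    { toFun := fun φ => ∫ x, w x * Real.exp (v.fn x) * φ.fn x ∂g.area
      map_add' := fun a b => by
        rw [← integral_add (v.integrable_exp_mul a hw hW) (v.integrable_exp_mul b hw hW)]
        refine integral_congr_ae ?_
        filter_upwards [fn_add a b] with x hx
        rw [hx, Pi.add_apply]; ring
      map_smul' := fun r a => by
        rw [RingHom.id_apply, smul_eq_mul, ← integral_const_mul]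
        refine integral_congr_ae ?_
        filter_upwards [fn_smul r a] with x hx
        rw [hx, Pi.smul_apply, smul_eq_mul]; ring }
    (by
      obtain ⟨C, hC, h⟩ := exists_integral_exp_mul_mul_le g zero_le_one ‖v‖
      refine ⟨|W| * (C * ‖const g 1‖), fun φ => ?_⟩
      obtain ⟨hi, hle⟩ := h v (const g 1) φ le_rfl
      refine (norm_integral_le_of_norm_le (hi.const_mul |W|) ?_).trans ?_
      · filter_upwards [fn_const g 1] with x hx
        rw [norm_mul, norm_mul, Real.norm_eq_abs, Real.norm_eq_abs, Real.norm_eq_abs, Real.abs_exp,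
          hx, abs_one, one_mul, one_mul, mul_assoc]
        refine mul_le_mul ((hW x).trans (le_abs_self W)) ?_ (by positivity) (abs_nonneg _)
        gcongr
        exact le_abs_self _
      · rw [integral_const_mul]
        calc _ ≤ |W| * (C * (‖const g 1‖ * ‖φ‖)) := by gcongr
          _ = _ := by ring))

theorem expFunctionalDeriv_apply (hw : Measurable w) (hW : ∀ x, |w x| ≤ W) (v φ : SobolevH1 g) :
    expFunctionalDeriv w W hw hW v φ = ∫ x, w x * Real.exp (v.fn x) * φ.fn x ∂g.area := rfl

theorem norm_integral_weight_le (hW : ∀ x, |w x| ≤ W) {f h : S → ℝ}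
    (hh : Integrable h g.area) (hle : ∀ᵐ x ∂g.area, |f x| ≤ h x) :
    |∫ x, w x * f x ∂g.area| ≤ |W| * ∫ x, h x ∂g.area := by
  rw [← integral_const_mul]
  refine norm_integral_le_of_norm_le (f := fun x => w x * f x) (hh.const_mul |W|) ?_
  filter_upwards [hle] with x hx
  rw [norm_mul, Real.norm_eq_abs, Real.norm_eq_abs]
  exact mul_le_mul ((hW x).trans (le_abs_self W)) hx (abs_nonneg _) (abs_nonneg _)

theorem exp_abs_add_abs_le (a b : ℝ) :
    Real.exp |a| * Real.exp |b| ≤ Real.exp (2 * |a|) + Real.exp (2 * |b|) := by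
  rw [two_mul, two_mul, Real.exp_add, Real.exp_add]
  nlinarith [sq_nonneg (Real.exp |a| - Real.exp |b|), Real.exp_pos |a|, Real.exp_pos |b|]

/-- The estimate `∫ e^{|v| + |h|} |a| |b| dA ≤ C ‖a‖ ‖b‖` for `v` bounded and `‖h‖ ≤ 1`. -/
theorem exists_integral_exp_add_mul_mul_le (g : HyperbolicMetric S) (R : ℝ) :
    ∃ C : ℝ, 0 ≤ C ∧ ∀ v h a b : SobolevH1 g, ‖v‖ ≤ R → ‖h‖ ≤ 1 →
      Integrable (fun x => Real.exp |v.fn x| * Real.exp |h.fn x| * (|a.fn x| * |b.fn x|)) g.area ∧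
        ∫ x, Real.exp |v.fn x| * Real.exp |h.fn x| * (|a.fn x| * |b.fn x|) ∂g.area ≤
          C * (‖a‖ * ‖b‖) := by
  obtain ⟨C₁, hC₁, h₁⟩ := exists_integral_exp_mul_mul_le g (show (0 : ℝ) ≤ 2 by norm_num) R
  obtain ⟨C₂, hC₂, h₂⟩ := exists_integral_exp_mul_mul_le g (show (0 : ℝ) ≤ 2 by norm_num) 1
  refine ⟨C₁ + C₂, by positivity, fun v h a b hv hh => ?_⟩
  obtain ⟨i₁, b₁⟩ := h₁ v a b hv
  obtain ⟨i₂, b₂⟩ := h₂ h a b hh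
  have hpt : ∀ x, Real.exp |v.fn x| * Real.exp |h.fn x| * (|a.fn x| * |b.fn x|) ≤
      Real.exp (2 * |v.fn x|) * (|a.fn x| * |b.fn x|) +
        Real.exp (2 * |h.fn x|) * (|a.fn x| * |b.fn x|) := fun x => by
    rw [← add_mul]
    gcongr
    exact exp_abs_add_abs_le _ _
  have hm : ∀ v : SobolevH1 g, AEStronglyMeasurable (fun x => Real.exp |v.fn x|) g.area :=
    fun v => (by fun_prop : Continuous fun y : ℝ => Real.exp |y|).comp_aestronglyMeasurable
      v.aestronglyMeasurable_fn
  have hi : Integrable (fun x => Real.exp |v.fn x| * Real.exp |h.fn x| *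
      (|a.fn x| * |b.fn x|)) g.area := by
    refine (i₁.add i₂).mono' (((hm v).mul (hm h)).mul
      (a.aestronglyMeasurable_fn.norm.mul b.aestronglyMeasurable_fn.norm)) (ae_of_all _ fun x => ?_)
    rw [Real.norm_of_nonneg (by positivity)]
    exact hpt x
  refine ⟨hi, (integral_mono hi (i₁.add i₂) hpt).trans ?_⟩
  simp only [Pi.add_apply]
  rw [integral_add i₁ i₂]
  linarith

theorem hasFDerivAt_expFunctional (hw : Measurable w) (hW : ∀ x, |w x| ≤ W) (v : SobolevH1 g) :
    HasFDerivAt (fun v : SobolevH1 g => ∫ x, w x * Real.exp (v.fn x) ∂g.area)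
      (expFunctionalDeriv w W hw hW v) v := by
  obtain ⟨C, hC, hest⟩ := exists_integral_exp_add_mul_mul_le g ‖v‖
  rw [hasFDerivAt_iff_isLittleO_nhds_zero]
  have hO : (fun h : SobolevH1 g => ∫ x, w x * Real.exp ((v + h).fn x) ∂g.area -
      ∫ x, w x * Real.exp (v.fn x) ∂g.area - expFunctionalDeriv w W hw hW v h)
      =O[𝓝 0] fun h => ‖h‖ ^ 2 := by
    refine Asymptotics.IsBigO.of_bound (|W| * C) ?_
    filter_upwards [Metric.ball_mem_nhds (0 : SobolevH1 g) one_pos] with h hh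
    have hh1 : ‖h‖ ≤ 1 := (mem_ball_zero_iff.1 hh).le
    obtain ⟨hi, hle⟩ := hest v h h h le_rfl hh1
    rw [expFunctionalDeriv_apply, ← integral_sub ((v + h).integrable_exp hw hW)
      (v.integrable_exp hw hW), ← integral_sub (by
        exact ((v + h).integrable_exp hw hW).sub (v.integrable_exp hw hW))
      (v.integrable_exp_mul h hw hW)]
    have heq : ∀ x, w x * Real.exp ((v + h).fn x) - w x * Real.exp (v.fn x) -
        w x * Real.exp (v.fn x) * h.fn x = w x * (Real.exp ((v + h).fn x) - Real.exp (v.fn x) -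
          Real.exp (v.fn x) * h.fn x) := fun x => by ring
    simp_rw [heq]
    refine (norm_integral_weight_le hW hi ?_).trans ?_
    · filter_upwards [fn_add v h] with x hx
      rw [hx, Pi.add_apply, Real.exp_add, show Real.exp (v.fn x) * Real.exp (h.fn x) -
        Real.exp (v.fn x) - Real.exp (v.fn x) * h.fn x =
          Real.exp (v.fn x) * (Real.exp (h.fn x) - 1 - h.fn x) by ring, abs_mul, Real.abs_exp,
        mul_assoc, mul_comm (Real.exp |h.fn x|)]
      gcongr
      · exact le_abs_self _
      · exact abs_exp_sub_one_sub_le _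
    · rw [norm_pow, norm_norm, mul_assoc]
      refine mul_le_mul_of_nonneg_left (hle.trans (le_of_eq (by ring))) (abs_nonneg _)
  refine hO.trans_isLittleO ?_
  have := Asymptotics.isLittleO_norm_pow_id (E' := SobolevH1 g) one_lt_two
  exact this

theorem continuous_expFunctionalDeriv (hw : Measurable w) (hW : ∀ x, |w x| ≤ W) :
    Continuous (expFunctionalDeriv (g := g) w W hw hW) := by
  rw [continuous_iff_continuousAt]
  intro v
  obtain ⟨C, hC, hest⟩ := exists_integral_exp_add_mul_mul_le g ‖v‖
  refine (tendsto_iff_norm_sub_tendsto_zero (E := SobolevH1 g →L[ℝ] ℝ)).2 ?_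
  have h0 : Tendsto (fun u : SobolevH1 g => |W| * C * ‖u - v‖) (𝓝 v) (𝓝 0) := by
    have : Continuous fun u : SobolevH1 g => |W| * C * ‖u - v‖ := by fun_prop
    simpa using this.tendsto v
  refine squeeze_zero' (Eventually.of_forall fun u => by positivity) ?_ h0
  filter_upwards [Metric.ball_mem_nhds v one_pos] with u hu
  have hh1 : ‖u - v‖ ≤ 1 := (mem_ball_iff_norm.1 hu).le
  refine ContinuousLinearMap.opNorm_le_bound _ (by positivity) fun φ => ?_
  obtain ⟨hi, hle⟩ := hest v (u - v) (u - v) φ le_rfl hh1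
  rw [sub_apply, expFunctionalDeriv_apply, expFunctionalDeriv_apply,
    ← integral_sub (u.integrable_exp_mul φ hw hW) (v.integrable_exp_mul φ hw hW)]
  have heq : ∀ x, w x * Real.exp (u.fn x) * φ.fn x - w x * Real.exp (v.fn x) * φ.fn x =
      w x * ((Real.exp (u.fn x) - Real.exp (v.fn x)) * φ.fn x) := fun x => by ring
  simp_rw [heq]
  refine (norm_integral_weight_le hW hi ?_).trans ?_
  · filter_upwards [fn_sub u v] with x hx
    rw [hx, Pi.sub_apply]
    have h1 := abs_exp_sub_one_le (u.fn x - v.fn x)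
    have h2 : Real.exp (u.fn x) - Real.exp (v.fn x) =
        Real.exp (v.fn x) * (Real.exp (u.fn x - v.fn x) - 1) := by
      rw [mul_sub, ← Real.exp_add]; ring_nf
    rw [h2, abs_mul, abs_mul, Real.abs_exp]
    calc _ ≤ Real.exp |v.fn x| * (|u.fn x - v.fn x| * Real.exp |u.fn x - v.fn x|) * |φ.fn x| := by
          gcongr
          exact le_abs_self _
      _ = _ := by ring
  · rw [mul_assoc, mul_assoc]
    exact mul_le_mul_of_nonneg_left hle (abs_nonneg _)

end ExpFunctional

end ExponentialSobolev

/-! ### The Poincaré inequality on the surface -/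

section GlobalPoincare

variable {S : Type*} [TopologicalSpace S] [ChartedSpace ℂ S]
  [IsManifold 𝓘(ℂ) ω S] [MeasurableSpace S] [BorelSpace S]
  {g : HyperbolicMetric S}

instance isOpenPosMeasure_area (g : HyperbolicMetric S) : g.area.IsOpenPosMeasure := by
  constructor
  rintro O hO ⟨x, hx⟩ h0
  obtain ⟨B, hB⟩ := exists_chartDisc g x
  set D := Metric.ball B.center B.radius ∩ B.chart.1.symm ⁻¹' O
  have hDo : IsOpen D :=
    (B.chart.1.continuousOn_symm.mono B.ball_subset_target).isOpen_inter_preimage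
      Metric.isOpen_ball hO
  have hne : D.Nonempty := ⟨B.chart.1 x, hB.2, by rwa [mem_preimage, B.chart.1.left_inv hB.1]⟩
  have h1 := B.le_setLIntegral_piece hDo.measurableSet
    (inter_subset_left.trans B.ball_subset_closedBall_two) (f := fun _ => 1) measurable_const
  have h2 : g.area (B.piece D) = 0 := by
    refine measure_mono_null ?_ h0
    rintro y ⟨hy, -, hyO⟩
    rwa [mem_preimage, B.chart.1.left_inv hy] at hyO
  have h3 : volume D = 0 := by simpa [h2] using h1
  exact (hDo.measure_pos volume hne).ne' h3

variable [CompactSpace S]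

namespace SobolevH1

theorem ae_const_on_disc_of_gradPairing_eq_zero {v : SobolevH1 g} (hv : v.gradPairing v = 0)
    (B : ChartDisc g) : ∃ c, ∀ᵐ x ∂g.area.restrict B.disc, v.fn x = c := by
  have hQ : MeasurableSet B.disc := B.isOpen_disc.measurableSet
  set C := 2 * B.upper ^ 2 * B.lower⁻¹ * (2 * B.radius) ^ 2 * g.area.real B.disc
  have hC : 0 ≤ C := by
    have h1 := B.upper_pos
    have h2 := B.lower_pos
    positivity
  let ρ := LpToLpRestrictCLM S ℝ ℝ g.area 2 B.disc
  have hρ : ∀ v : SobolevH1 g, ‖ρ (toL2 v)‖ ^ 2 = ∫ x in B.disc, v.fn x ^ 2 ∂g.area := by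
    intro v
    rw [← real_inner_self_eq_norm_sq, L2.inner_def]
    refine integral_congr_ae ?_
    filter_upwards [LpToLpRestrictCLM_coeFn ℝ B.disc (toL2 v)] with x hx
    change inner ℝ (ρ (toL2 v) x) (ρ (toL2 v) x) = _
    rw [hx]
    simp [fn, sq]
  have hpoin : ∀ v : SobolevH1 g, g.area.real B.disc * ∫ x in B.disc, v.fn x ^ 2 ∂g.area -
      (∫ x in B.disc, v.fn x ∂g.area) ^ 2 ≤ C * v.gradPairing v := by
    intro v
    rw [← hρ]
    induction v using UniformSpace.Completion.induction_on with
    | hp =>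
      refine isClosed_le ((continuous_const.mul ((ρ.continuous.comp toL2.continuous).norm.pow 2)).sub
        ((continuous_setIntegral_fn hQ).pow 2)) (continuous_const.mul continuous_gradPairing_self)
    | ih u =>
      rw [hρ, setIntegral_fn_coe, gradPairing_coe]
      have h1 : ∫ x in B.disc, fn (u : SobolevH1 g) x ^ 2 ∂g.area =
          ∫ x in B.disc, u.val x ^ 2 ∂g.area := by
        refine integral_congr_ae (ae_restrict_of_ae ?_)
        filter_upwards [fn_coe u] with x hx
        rw [hx]
      rw [h1]
      refine (B.poincare u (convex_ball _ _) Metric.isOpen_ball.measurableSet subset_rfl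
        (d := 2 * B.radius) (by have := B.radius_pos; positivity) fun x hx y hy => ?_).trans ?_
      · rw [← dist_eq_norm]
        have h1 := Metric.mem_ball.1 hx
        have h2 := Metric.mem_ball'.1 hy
        linarith [dist_triangle x B.center y]
      · refine mul_le_mul_of_nonneg_left ?_ hC
        exact setIntegral_le_integral (SmoothFunctions.integrable_gradInner u u)
          (ae_of_all _ u.gradInner_self_nonneg)
  have h := hpoin v
  rw [hv, mul_zero] at h
  set m := g.area.real B.disc
  set a := ∫ x in B.disc, v.fn x ∂g.area
  have hi1 : Integrable v.fn (g.area.restrict B.disc) := v.integrable_fn.integrableOn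
  have hi2 : Integrable (fun x => v.fn x ^ 2) (g.area.restrict B.disc) :=
    v.memLp_fn.integrable_sq.integrableOn
  have hi3 : Integrable (fun x => m ^ 2 * v.fn x ^ 2 - 2 * m * a * v.fn x)
      (g.area.restrict B.disc) := (hi2.const_mul _).sub (hi1.const_mul _)
  have hexp : ∀ x, (m * v.fn x - a) ^ 2 = m ^ 2 * v.fn x ^ 2 - 2 * m * a * v.fn x + a ^ 2 :=
    fun x => by ring
  have hzero : ∫ x in B.disc, (m * v.fn x - a) ^ 2 ∂g.area ≤ 0 := by
    simp_rw [hexp]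
    rw [integral_add hi3 (integrable_const _), integral_sub (hi2.const_mul _) (hi1.const_mul _),
      integral_const_mul, integral_const_mul, integral_const, smul_eq_mul,
      measureReal_restrict_apply_univ]
    change m ^ 2 * _ - 2 * m * a * a + m * a ^ 2 ≤ 0
    have hm : 0 ≤ m := measureReal_nonneg
    nlinarith [mul_le_mul_of_nonneg_left h hm]
  have hi : Integrable (fun x => (m * v.fn x - a) ^ 2) (g.area.restrict B.disc) := by
    simp_rw [hexp]
    exact hi3.add (integrable_const _)
  have h0 := (integral_eq_zero_iff_of_nonneg (fun x => sq_nonneg _) hi).1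
    (le_antisymm hzero (integral_nonneg fun x => sq_nonneg _))
  rcases (measureReal_nonneg (μ := g.area) (s := B.disc)).eq_or_lt' with hm | hm
  · refine ⟨0, ?_⟩
    rw [Measure.restrict_eq_zero.2 ((measureReal_eq_zero_iff (measure_ne_top _ _)).1 hm)]
    simp
  · refine ⟨a / m, ?_⟩
    filter_upwards [h0] with x hx
    have : m * v.fn x - a = 0 := by simpa using hx
    rw [eq_div_iff hm.ne']
    linarith

/-- On a connected surface, functions of zero energy are constant. -/
theorem ae_const_of_gradPairing_eq_zero [ConnectedSpace S] {v : SobolevH1 g}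
    (hv : v.gradPairing v = 0) : ∃ c, ∀ᵐ x ∂g.area, v.fn x = c := by
  choose c hc using ae_const_on_disc_of_gradPairing_eq_zero hv
  have huniq : ∀ B B' : ChartDisc g, (B.disc ∩ B'.disc).Nonempty → c B = c B' := by
    intro B B' hne
    have hpos := (B.isOpen_disc.inter B'.isOpen_disc).measure_pos g.area hne
    have h1 := ae_restrict_of_ae_restrict_of_subset (inter_subset_left (t := B'.disc)) (hc B)
    have h2 := ae_restrict_of_ae_restrict_of_subset (inter_subset_right (s := B.disc)) (hc B')
    have : (ae (g.area.restrict (B.disc ∩ B'.disc))).NeBot := by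
      rw [ae_neBot, Ne, Measure.restrict_eq_zero]
      exact hpos.ne'
    obtain ⟨x, hx, hx'⟩ := (h1.and h2).exists
    exact hx.symm.trans hx'
  choose B hB using exists_chartDisc g
  have hloc : IsLocallyConstant fun x => c (B x) := by
    rw [IsLocallyConstant.iff_exists_open]
    intro x
    exact ⟨(B x).disc, (B x).isOpen_disc, hB x, fun y hy => huniq _ _ ⟨y, hB y, hy⟩⟩
  obtain ⟨k, hk⟩ := hloc.exists_eq_const
  refine ⟨k, ?_⟩
  obtain ⟨T, hT⟩ := exists_finset_chartDisc g
  have h2 : ∀ᵐ x ∂g.area, ∀ B ∈ T, x ∈ B.disc → v.fn x = c B :=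
    (ae_ball_iff T.countable_toSet).2 fun B _ =>
      (ae_restrict_iff' B.isOpen_disc.measurableSet).1 (hc B)
  filter_upwards [h2] with x hx
  obtain ⟨B', hB', hxB⟩ := mem_iUnion₂.1 (hT.symm ▸ mem_univ x : x ∈ ⋃ B ∈ T, B.disc)
  rw [hx B' hB' hxB, huniq B' (B x) ⟨x, hxB, hB x⟩]
  exact congrFun hk x

theorem integral_fn_smul (r : ℝ) (v : SobolevH1 g) :
    ∫ x, (r • v).fn x ∂g.area = r * ∫ x, v.fn x ∂g.area := by
  rw [← integral_const_mul]
  exact integral_congr_ae (fn_smul r v)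

/-- The Poincaré inequality for functions of mean zero. -/
theorem exists_poincare [ConnectedSpace S] (g : HyperbolicMetric S) : ∃ C : ℝ, 0 ≤ C ∧
    ∀ v : SobolevH1 g, ∫ x, v.fn x ∂g.area = 0 → ‖toL2 v‖ ^ 2 ≤ C * v.gradPairing v := by
  by_contra! hcon
  have h : ∀ n : ℕ, ∃ v : SobolevH1 g, ∫ x, v.fn x ∂g.area = 0 ∧ ‖toL2 v‖ = 1 ∧
      v.gradPairing v ≤ 1 / ((n : ℝ) + 1) := by
    intro n
    obtain ⟨v, h0, hv⟩ := hcon (n + 1) (by positivity)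
    have hE := v.gradPairing_self_nonneg
    have hpos : 0 < ‖toL2 v‖ := by
      by_contra! hle
      have : ‖toL2 v‖ = 0 := le_antisymm hle (norm_nonneg _)
      rw [this] at hv
      have : (0 : ℝ) ≤ (n + 1) * v.gradPairing v := by positivity
      linarith
    refine ⟨‖toL2 v‖⁻¹ • v, ?_, ?_, ?_⟩
    · rw [integral_fn_smul, h0, mul_zero]
    · rw [map_smul, norm_smul, norm_inv, norm_norm, inv_mul_cancel₀ hpos.ne']
    · rw [gradPairing_smul_left, gradPairing_smul_right, ← mul_assoc, ← mul_inv, ← sq,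
        inv_mul_eq_div, div_le_div_iff₀ (by positivity) (by positivity)]
      linarith
  choose v hv0 hv1 hvE using h
  have hle1 : ∀ n : ℕ, 1 / ((n : ℝ) + 1) ≤ 1 := fun n => by
    rw [div_le_one (by positivity)]
    linarith [Nat.cast_nonneg (α := ℝ) n]
  have hb : ∀ n, ‖v n‖ ≤ 2 := fun n => by
    refine le_of_sq_le_sq ?_ (by norm_num)
    rw [norm_sq_eq, hv1]
    linarith [hvE n, hle1 n]
  obtain ⟨w, hw⟩ := exists_isWeakLimit v hb
  have hL2 := hw.tendsto_toL2
  have hw1 : ‖toL2 w‖ = 1 := tendsto_nhds_unique hL2.norm (by simp [hv1])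
  have hw0 : ∫ x, w.fn x ∂g.area = 0 := by
    have h1 : ∀ v : SobolevH1 g, ∫ x, v.fn x ∂g.area =
        inner ℝ (indicatorConstLp 2 MeasurableSet.univ (measure_ne_top g.area univ) (1 : ℝ))
          (toL2 v) := fun v => by
      rw [← setIntegral_fn_eq_inner, setIntegral_univ]
    simp_rw [h1] at hv0 ⊢
    exact tendsto_nhds_unique ((tendsto_const_nhds (x := indicatorConstLp 2 MeasurableSet.univ
      (measure_ne_top g.area univ) (1 : ℝ))).inner hL2) (by simp only [hv0, tendsto_const_nhds])
  have hwE : w.gradPairing w = 0 := le_antisymm (hw.gradPairing_le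
    (tendsto_one_div_add_atTop_nhds_zero_nat.mono_left Nat.hyperfilter_le_atTop) hvE)
    w.gradPairing_self_nonneg
  obtain ⟨c, hc⟩ := ae_const_of_gradPairing_eq_zero hwE
  have hμ : 0 < g.area.real univ := by
    rw [measureReal_def, ENNReal.toReal_pos_iff]
    exact ⟨isOpen_univ.measure_pos g.area univ_nonempty, measure_lt_top _ _⟩
  rw [integral_congr_ae hc, integral_const, smul_eq_mul] at hw0
  have hc0 : c = 0 := (mul_eq_zero.1 hw0).resolve_left hμ.ne'
  have : ‖toL2 w‖ ^ 2 = 0 := by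
    rw [norm_toL2_sq]
    refine integral_eq_zero_of_ae ?_
    filter_upwards [hc] with x hx
    simp [hx, hc0]
  rw [hw1] at this
  norm_num at this

end SobolevH1

end GlobalPoincare

/-! ### The squared length of a holomorphic quadratic differential -/

section QuadraticDifferential

variable {S : Type*} [TopologicalSpace S] [ChartedSpace ℂ S]
  [IsManifold 𝓘(ℂ) ω S] {g : HyperbolicMetric S}

namespace HolomorphicQuadraticDifferential

theorem normSq_eq (α : HolomorphicQuadraticDifferential S) (g : HyperbolicMetric S)
    (e : atlas ℂ S) {x : S} (hx : x ∈ e.1.source) :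
    α.normSq g x = ‖α.coeff e (e.1 x)‖ ^ 2 / g.density e (e.1 x) ^ 2 := by
  have hx' : x ∈ (chartOf x).1.source := mem_chart_source ℂ x
  have h1 := α.coeff_compat e (chartOf x) x ⟨hx, hx'⟩
  have h2 := g.density_compat e (chartOf x) x ⟨hx, hx'⟩
  have hpos := g.density_pos e (e.1 x) (e.1.map_source hx)
  set a := deriv (transitionMap e.1 (chartOf x).1) (e.1 x)
  have ha : ‖a‖ ≠ 0 := by
    intro h
    rw [h] at h2
    simp only [ne_eq, OfNat.ofNat_ne_zero, not_false_eq_true, zero_pow, mul_zero] at h2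
    exact hpos.ne' h2
  rw [h1, h2, norm_mul, norm_pow, mul_pow, mul_pow, mul_div_mul_right _ _ (by positivity)]
  rfl

theorem normSq_nonneg (α : HolomorphicQuadraticDifferential S) (g : HyperbolicMetric S) (x : S) :
    0 ≤ α.normSq g x := by
  unfold normSq
  positivity

theorem continuous_normSq (α : HolomorphicQuadraticDifferential S) (g : HyperbolicMetric S) :
    Continuous (α.normSq g) := by
  rw [continuous_iff_continuousAt]
  intro x
  set e : atlas ℂ S := chartOf x
  have hx : x ∈ e.1.source := mem_chart_source ℂ x
  have hxt := e.1.open_target.mem_nhds (e.1.map_source hx)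
  have hev : (fun y => ‖α.coeff e (e.1 y)‖ ^ 2 / g.density e (e.1 y) ^ 2) =ᶠ[𝓝 x] α.normSq g := by
    filter_upwards [e.1.open_source.mem_nhds hx] with y hy using (α.normSq_eq g e hy).symm
  refine ContinuousAt.congr ?_ hev
  have h1 : ContinuousAt (fun z => ‖α.coeff e z‖ ^ 2 / g.density e z ^ 2) (e.1 x) :=
    (((α.coeff_holomorphic e).continuousOn.continuousAt hxt).norm.pow 2).div
      (((g.density_smooth e).continuousOn.continuousAt hxt).pow 2)
      (pow_ne_zero 2 (g.density_pos e _ (e.1.map_source hx)).ne')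
  exact h1.comp (f := e.1) (e.1.continuousAt hx)

/-- Near each point, a quadratic differential vanishes identically or only at that point. -/
theorem eventually_normSq_eq_zero_or (α : HolomorphicQuadraticDifferential S)
    (g : HyperbolicMetric S) (x : S) :
    (∀ᶠ y in 𝓝 x, α.normSq g y = 0) ∨ ∀ᶠ y in 𝓝 x, y ≠ x → α.normSq g y ≠ 0 := by
  set e : atlas ℂ S := chartOf x
  have hx : x ∈ e.1.source := mem_chart_source ℂ x
  have hxt := e.1.map_source hx
  have han : AnalyticAt ℂ (α.coeff e) (e.1 x) :=
    (α.coeff_holomorphic e).analyticAt (e.1.open_target.mem_nhds hxt)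
  have hcont := e.1.continuousAt hx
  rcases han.eventually_eq_zero_or_eventually_ne_zero with h | h
  · left
    filter_upwards [hcont.eventually h, e.1.open_source.mem_nhds hx] with y hy hys
    rw [α.normSq_eq g e hys, hy]
    simp
  · right
    rw [eventually_nhdsWithin_iff] at h
    filter_upwards [hcont.eventually h, e.1.open_source.mem_nhds hx] with y hy hys hne
    have h1 : α.coeff e (e.1 y) ≠ 0 := hy fun h => hne (e.1.injOn hys hx h)
    have h2 := g.density_pos e _ (e.1.map_source hys)
    rw [α.normSq_eq g e hys]
    have := norm_pos_iff.2 h1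
    positivity

variable [CompactSpace S]

theorem exists_normSq_le (α : HolomorphicQuadraticDifferential S) (g : HyperbolicMetric S) :
    ∃ W, ∀ x, |α.normSq g x| ≤ W := by
  obtain ⟨C, hC⟩ := (isCompact_range (α.continuous_normSq g).abs).bddAbove
  exact ⟨C, fun x => hC ⟨x, rfl⟩⟩

variable [MeasurableSpace S] [BorelSpace S]

theorem measurable_normSq (α : HolomorphicQuadraticDifferential S) (g : HyperbolicMetric S) :
    Measurable (α.normSq g) := (α.continuous_normSq g).measurable

theorem _root_.area_singleton (g : HyperbolicMetric S) (x : S) : g.area {x} = 0 := by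
  obtain ⟨B, hB⟩ := exists_chartDisc g x
  have h1 := B.setLIntegral_piece_le (D := {B.chart.1 x}) (measurableSet_singleton _)
    (singleton_subset_iff.2 (B.ball_subset_closedBall_two hB.2)) (f := fun _ => 1) measurable_const
  simp only [lintegral_const, MeasurableSet.univ, Measure.restrict_apply, univ_inter, one_mul,
    measure_singleton, mul_zero, nonpos_iff_eq_zero] at h1
  refine measure_mono_null ?_ h1
  rintro y rfl
  exact ⟨hB.1, rfl⟩

/-- On a connected surface, a quadratic differential which is not identically zero has finitely
many zeros: the set of points near which it vanishes identically is open and closed. -/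
theorem ae_normSq_pos [ConnectedSpace S] (α : HolomorphicQuadraticDifferential S)
    (g : HyperbolicMetric S) (h : ∃ x, α.normSq g x ≠ 0) : ∀ᵐ x ∂g.area, 0 < α.normSq g x := by
  set Z : Set S := {x | ∀ᶠ y in 𝓝 x, α.normSq g y = 0}
  have hopen : IsOpen Z := isOpen_setOfPred_eventually_nhds
  have hclosed : IsClosed Z := by
    refine isClosed_of_closure_subset fun x hx => ?_
    rcases α.eventually_normSq_eq_zero_or g x with h | h
    · exact h
    · obtain ⟨y, hy, hyZ⟩ := mem_closure_iff_nhds.1 hx _ h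
      by_cases hxy : y = x
      · exact hxy ▸ hyZ
      · exact absurd (show ∀ᶠ z in 𝓝 y, α.normSq g z = 0 from hyZ).self_of_nhds (hy hxy)
  have hZ : Z = ∅ := by
    refine (isClopen_iff.1 ⟨hclosed, hopen⟩).resolve_right fun hu => ?_
    obtain ⟨x, hx⟩ := h
    have : x ∈ Z := hu ▸ mem_univ x
    exact hx (show ∀ᶠ z in 𝓝 x, α.normSq g z = 0 from this).self_of_nhds
  have hiso : ∀ x, {y | y ≠ x → α.normSq g y ≠ 0} ∈ 𝓝 x := fun x =>
    (α.eventually_normSq_eq_zero_or g x).resolve_left fun h =>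
      (hZ ▸ (show x ∈ Z from h) : x ∈ (∅ : Set S))
  obtain ⟨t, -, ht⟩ := isCompact_univ.elim_nhds_subcover _ fun x _ => hiso x
  have hnull : g.area (t : Set S) = 0 := by
    rw [← biUnion_of_singleton (t : Set S), measure_biUnion_null_iff t.countable_toSet]
    exact fun x _ => area_singleton g x
  have hsub : ∀ x ∉ (t : Set S), 0 < α.normSq g x := by
    intro x hx
    obtain ⟨y, hy, hxy⟩ := mem_iUnion₂.1 (ht (mem_univ x))
    exact (α.normSq_nonneg g x).lt_of_ne' (hxy fun h => hx (h ▸ hy))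
  rw [ae_iff]
  exact measure_mono_null (fun x hx => by_contra fun h => hx (hsub x h)) hnull

end HolomorphicQuadraticDifferential

end QuadraticDifferential

/-! ### The functional and its derivative -/

section FunctionalDerivative

variable {S : Type*} [TopologicalSpace S] [ChartedSpace ℂ S] [IsManifold 𝓘(ℂ) ω S]
  [CompactSpace S] [MeasurableSpace S] [BorelSpace S] {g : HyperbolicMetric S}

namespace SobolevH1

/-- The functional `φ ↦ ∫ ⟨∇v, ∇φ⟩ dA`. -/
noncomputable def gradCLM (v : SobolevH1 g) : SobolevH1 g →L[ℝ] ℝ :=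
  innerSL ℝ v - (innerSL ℝ (toL2 v)).comp toL2

theorem gradCLM_apply (v φ : SobolevH1 g) : gradCLM v φ = v.gradPairing φ := rfl

theorem continuous_gradCLM : Continuous (gradCLM (g := g)) := by
  unfold gradCLM
  exact (innerSL ℝ).continuous.sub
    (((innerSL ℝ).continuous.comp toL2.continuous).clm_comp continuous_const)

theorem hasFDerivAt_gradPairing_self (v : SobolevH1 g) :
    HasFDerivAt (fun v : SobolevH1 g => 1 / 2 * v.gradPairing v) (gradCLM v) v := by
  have h1 := ((hasFDerivAt_id v).norm_sq).sub
    ((toL2 (g := g)).hasFDerivAt (x := v)).norm_sq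
  have h2 := h1.const_mul (1 / 2 : ℝ)
  have e : (fun v : SobolevH1 g => 1 / 2 * v.gradPairing v) =
      fun v => 1 / 2 * (‖v‖ ^ 2 - ‖toL2 v‖ ^ 2) := by
    funext v; rw [gradPairing_self]
  rw [e]
  refine h2.congr_fderiv ?_
  ext φ
  simp [gradCLM]
  ring

/-- The functional `φ ↦ ∫ φ dA`. -/
noncomputable def integralCLM (g : HyperbolicMetric S) : SobolevH1 g →L[ℝ] ℝ :=
  (innerSL ℝ (indicatorConstLp 2 MeasurableSet.univ (measure_ne_top g.area univ) (1 : ℝ))).comp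
    toL2

theorem integralCLM_apply (v : SobolevH1 g) : integralCLM g v = ∫ x, v.fn x ∂g.area := by
  have := setIntegral_fn_eq_inner MeasurableSet.univ v
  rw [setIntegral_univ] at this
  exact this.symm

theorem exp_neg_fn_ae (v : SobolevH1 g) :
    (fun x => Real.exp (-v.fn x)) =ᵐ[g.area] fun x => (1 : ℝ) * Real.exp ((-v).fn x) := by
  filter_upwards [fn_neg v] with x hx
  rw [hx, Pi.neg_apply, one_mul]

theorem integrable_exp_neg (v : SobolevH1 g) :
    Integrable (fun x => Real.exp (-v.fn x)) g.area :=
  (integrable_congr v.exp_neg_fn_ae).2 ((-v).integrable_exp measurable_const fun _ => le_rfl)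

theorem integrable_exp_neg_mul (v φ : SobolevH1 g) :
    Integrable (fun x => Real.exp (-v.fn x) * φ.fn x) g.area := by
  refine (integrable_congr ?_).2 ((-v).integrable_exp_mul φ (w := fun _ => (1 : ℝ))
    measurable_const fun _ => le_rfl)
  filter_upwards [v.exp_neg_fn_ae] with x hx
  rw [hx]

theorem integrable_exp_neg_mul_mul (v φ ψ : SobolevH1 g) :
    Integrable (fun x => Real.exp (-v.fn x) * (φ.fn x * ψ.fn x)) g.area := by
  refine (integrable_congr ?_).2 ((-v).integrable_exp_mul_mul φ ψ (w := fun _ => (1 : ℝ))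
    measurable_const fun _ => le_rfl)
  filter_upwards [v.exp_neg_fn_ae] with x hx
  rw [hx]

end SobolevH1

open SobolevH1

variable (α : HolomorphicQuadraticDifferential S)

theorem integrable_normSq_exp (v : SobolevH1 g) :
    Integrable (fun x => α.normSq g x * Real.exp (v.fn x)) g.area := by
  obtain ⟨W, hW⟩ := α.exists_normSq_le g
  exact v.integrable_exp (α.measurable_normSq g) hW

theorem integrable_normSq_exp_mul (v φ : SobolevH1 g) :
    Integrable (fun x => α.normSq g x * Real.exp (v.fn x) * φ.fn x) g.area := by
  obtain ⟨W, hW⟩ := α.exists_normSq_le g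
  exact v.integrable_exp_mul φ (α.measurable_normSq g) hW

theorem integrable_normSq_exp_mul_mul (v φ ψ : SobolevH1 g) :
    Integrable (fun x => α.normSq g x * Real.exp (v.fn x) * (φ.fn x * ψ.fn x)) g.area := by
  obtain ⟨W, hW⟩ := α.exists_normSq_le g
  exact v.integrable_exp_mul_mul φ ψ (α.measurable_normSq g) hW

theorem exists_deriv_expFunctional {w : S → ℝ} {W : ℝ} (hw : Measurable w)
    (hW : ∀ x, |w x| ≤ W) : ∃ D : SobolevH1 g → SobolevH1 g →L[ℝ] ℝ, Continuous D ∧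
      (∀ v, HasFDerivAt (fun v : SobolevH1 g => ∫ x, w x * Real.exp (v.fn x) ∂g.area) (D v) v) ∧
      ∀ v φ, D v φ = ∫ x, w x * Real.exp (v.fn x) * φ.fn x ∂g.area :=
  ⟨expFunctionalDeriv w W hw hW, continuous_expFunctionalDeriv hw hW,
    hasFDerivAt_expFunctional hw hW, expFunctionalDeriv_apply hw hW⟩

/-- The functional `I_t` is continuously differentiable, and its derivative is the weak form of
the equation `(1)_t`. -/
theorem exists_gaussFunctional_deriv (t : ℝ) :
    ∃ D : SobolevH1 g → SobolevH1 g →L[ℝ] ℝ, Continuous D ∧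
      (∀ v, HasFDerivAt (gaussFunctional α t) (D v) v) ∧
      ∀ v φ, D v φ = v.gradPairing φ -
        2 * t ^ 2 * ∫ x, α.normSq g x * Real.exp (v.fn x) * φ.fn x ∂g.area -
        2 * ∫ x, Real.exp (-v.fn x) * φ.fn x ∂g.area + 2 * ∫ x, φ.fn x ∂g.area := by
  obtain ⟨W, hW⟩ := α.exists_normSq_le g
  obtain ⟨JK, cK, dK, aK⟩ := exists_deriv_expFunctional (g := g) (α.measurable_normSq g) hW
  obtain ⟨J, c, d, a⟩ := exists_deriv_expFunctional (g := g) (w := fun _ => (1 : ℝ))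
    measurable_const fun _ => le_rfl
  have c1 : Continuous fun v : SobolevH1 g => (2 * t ^ 2) • JK v := cK.const_smul (2 * t ^ 2)
  have c2 : Continuous fun v : SobolevH1 g => (2 : ℝ) • J (-v) :=
    (c.comp continuous_neg).const_smul (2 : ℝ)
  refine ⟨fun v => gradCLM v - (2 * t ^ 2) • JK v - (2 : ℝ) • J (-v) + (2 : ℝ) • integralCLM g,
    ((continuous_gradCLM.sub c1).sub c2).add continuous_const, fun v => ?_, fun v φ => ?_⟩
  · have h1 := hasFDerivAt_gradPairing_self v
    have h2 := (dK v).const_mul (2 * t ^ 2)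
    have h3 := ((d (-v)).comp v (hasFDerivAt_id v).neg).const_mul (2 : ℝ)
    have h4 := ((integralCLM g).hasFDerivAt (x := v)).const_mul (2 : ℝ)
    have e : gaussFunctional (g := g) α t = fun v => 1 / 2 * v.gradPairing v -
        2 * t ^ 2 * (∫ x, α.normSq g x * Real.exp (v.fn x) ∂g.area) +
        2 * (∫ x, (1 : ℝ) * Real.exp ((-v).fn x) ∂g.area) + 2 * integralCLM g v := by
      funext v
      rw [gaussFunctional, integralCLM_apply, integral_congr_ae v.exp_neg_fn_ae]
    rw [e]
    refine (((h1.sub h2).add h3).add h4).congr_fderiv ?_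
    ext φ
    simp [sub_eq_add_neg]
  · simp only [add_apply, sub_apply, smul_apply, smul_eq_mul, gradCLM_apply, aK, a,
      integralCLM_apply]
    congr 3
    refine integral_congr_ae ?_
    filter_upwards [v.exp_neg_fn_ae] with x hx
    rw [hx]

theorem fderiv_gaussFunctional_apply (t : ℝ) (v φ : SobolevH1 g) :
    fderiv ℝ (gaussFunctional (g := g) α t) v φ = v.gradPairing φ -
        2 * t ^ 2 * ∫ x, α.normSq g x * Real.exp (v.fn x) * φ.fn x ∂g.area -
        2 * ∫ x, Real.exp (-v.fn x) * φ.fn x ∂g.area + 2 * ∫ x, φ.fn x ∂g.area := by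
  obtain ⟨D, -, hD, h⟩ := exists_gaussFunctional_deriv (g := g) α t
  rw [(hD v).fderiv, h]

theorem contDiff_gaussFunctional (t : ℝ) : ContDiff ℝ 1 (gaussFunctional (g := g) α t) := by
  obtain ⟨D, hc, hD, -⟩ := exists_gaussFunctional_deriv (g := g) α t
  rw [contDiff_one_iff_hasFDerivAt]
  exact ⟨D, hc, hD⟩

theorem hasFDerivAt_gaussFunctional (t : ℝ) (v : SobolevH1 g) :
    HasFDerivAt (gaussFunctional α t) (fderiv ℝ (gaussFunctional (g := g) α t) v) v :=
  ((contDiff_gaussFunctional α t).differentiable one_ne_zero v).hasFDerivAt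

/-- The right-hand side of the equation, tested with `φ`, in separate integrals. -/
theorem integral_nonlinearity_mul (t : ℝ) (v φ : SobolevH1 g) :
    ∫ x, (2 * t ^ 2 * α.normSq g x * Real.exp (v.fn x) - 2 * (1 - Real.exp (-v.fn x)))
      * φ.fn x ∂g.area = 2 * t ^ 2 * ∫ x, α.normSq g x * Real.exp (v.fn x) * φ.fn x ∂g.area +
        2 * ∫ x, Real.exp (-v.fn x) * φ.fn x ∂g.area - 2 * ∫ x, φ.fn x ∂g.area := by
  have i1 := (integrable_normSq_exp_mul α v φ).const_mul (2 * t ^ 2)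
  have i2 := (v.integrable_exp_neg_mul φ).const_mul 2
  have i3 := φ.integrable_fn.const_mul 2
  rw [← integral_const_mul, ← integral_const_mul, ← integral_const_mul, ← integral_add i1 i2,
    ← integral_sub (by exact i1.add i2) i3]
  congr 1
  funext x
  ring

theorem isGaussSolution_iff_fderiv (t : ℝ) (v : SobolevH1 g) :
    IsGaussSolution α t v ↔ fderiv ℝ (gaussFunctional (g := g) α t) v = 0 := by
  have h : ∀ φ, fderiv ℝ (gaussFunctional (g := g) α t) v φ = v.gradPairing φ -
      ∫ x, (2 * t ^ 2 * α.normSq g x * Real.exp (v.fn x) - 2 * (1 - Real.exp (-v.fn x)))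
        * φ.fn x ∂g.area := fun φ => by
    rw [fderiv_gaussFunctional_apply, integral_nonlinearity_mul]
    ring
  constructor
  · intro hs
    ext φ
    rw [h, hs φ, sub_self]
    rfl
  · intro hs φ
    have := h φ
    rw [hs] at this
    exact (sub_eq_zero.1 this.symm)

end FunctionalDerivative

/-! ### The Palais–Smale condition -/

section PalaisSmale

variable {S : Type*} [TopologicalSpace S] [ChartedSpace ℂ S] [IsManifold 𝓘(ℂ) ω S]
  [CompactSpace S] [MeasurableSpace S] [BorelSpace S] {g : HyperbolicMetric S}

namespace SobolevH1

/-- Only the `L²` norm of one of the factors enters: combined with the compactness of the inclusion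
into `L²(S)`, this makes the exponential terms weakly continuous. -/
theorem exists_integral_exp_mul_le_norm_toL2 {w : S → ℝ} {W : ℝ} (hw : Measurable w)
    (hW : ∀ x, |w x| ≤ W) (R : ℝ) : ∃ C : ℝ, 0 ≤ C ∧ ∀ v a φ : SobolevH1 g, ‖v‖ ≤ R →
      |∫ x, w x * Real.exp (v.fn x) * (a.fn x * φ.fn x) ∂g.area| ≤ C * ‖a‖ * ‖toL2 φ‖ := by
  obtain ⟨C, hC, h⟩ := exists_integral_exp_mul_mul_le g (show (0 : ℝ) ≤ 2 by norm_num) R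
  refine ⟨√(W ^ 2 * C), Real.sqrt_nonneg _, fun v a φ hv => ?_⟩
  obtain ⟨hi, hle⟩ := h v a a hv
  have hpt : ∀ x, (w x * Real.exp (v.fn x) * a.fn x) ^ 2 ≤
      W ^ 2 * (Real.exp (2 * |v.fn x|) * (|a.fn x| * |a.fn x|)) := fun x => by
    rw [mul_pow, mul_pow, mul_assoc, ← sq_abs (w x), ← sq_abs (a.fn x), ← Real.exp_nat_mul,
      ← sq |a.fn x|, Nat.cast_ofNat]
    have h1 := hW x
    gcongr
    exact le_abs_self _
  have hm : AEStronglyMeasurable (fun x => w x * Real.exp (v.fn x) * a.fn x) g.area :=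
    (hw.aestronglyMeasurable.mul (Real.continuous_exp.comp_aestronglyMeasurable
      v.aestronglyMeasurable_fn)).mul a.aestronglyMeasurable_fn
  have hint : Integrable (fun x => (w x * Real.exp (v.fn x) * a.fn x) ^ 2) g.area :=
    (hi.const_mul (W ^ 2)).mono' (hm.pow 2) (ae_of_all _ fun x => by
      rw [Real.norm_of_nonneg (sq_nonneg _)]
      exact hpt x)
  have hf : MemLp (fun x => w x * Real.exp (v.fn x) * a.fn x) 2 g.area :=
    (memLp_two_iff_integrable_sq hm).2 hint
  have key := abs_integral_mul_le hf φ.memLp_fn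
  rw [← norm_toL2_sq, Real.sqrt_sq (norm_nonneg _)] at key
  simp only [mul_assoc] at key ⊢
  refine key.trans ?_
  rw [← mul_assoc]
  refine mul_le_mul_of_nonneg_right ?_ (norm_nonneg _)
  rw [← Real.sqrt_sq (norm_nonneg a), ← Real.sqrt_mul (by positivity)]
  refine Real.sqrt_le_sqrt ?_
  simp only [← mul_assoc]
  refine (integral_mono hint (hi.const_mul (W ^ 2)) hpt).trans ?_
  rw [integral_const_mul, sq ‖a‖, mul_assoc]
  gcongr

theorem norm_const_sq (g : HyperbolicMetric S) (c : ℝ) :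
    ‖const g c‖ ^ 2 = c ^ 2 * g.area.real univ := by
  rw [norm_sq_eq, gradPairing_const_self, norm_toL2_sq, zero_add]
  have : (fun x => (const g c).fn x ^ 2) =ᵐ[g.area] fun _ => c ^ 2 := by
    filter_upwards [fn_const g c] with x hx
    rw [hx]
  rw [integral_congr_ae this, integral_const, smul_eq_mul, mul_comm]

theorem integral_const_fn (g : HyperbolicMetric S) (c : ℝ) :
    ∫ x, (const g c).fn x ∂g.area = c * g.area.real univ := by
  rw [integral_congr_ae (fn_const g c), integral_const, smul_eq_mul, mul_comm]

theorem integral_fn_sub (v w : SobolevH1 g) :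
    ∫ x, (v - w).fn x ∂g.area = ∫ x, v.fn x ∂g.area - ∫ x, w.fn x ∂g.area := by
  rw [← integral_sub v.integrable_fn w.integrable_fn]
  exact integral_congr_ae (fn_sub v w)

theorem area_real_univ_pos [Nonempty S] (g : HyperbolicMetric S) : 0 < g.area.real univ :=
  measureReal_univ_pos

/-- By the Poincaré inequality, the mean and the energy control the norm. -/
theorem exists_norm_le_of_integral_le [ConnectedSpace S] (g : HyperbolicMetric S) (m e : ℝ) :
    ∃ R, ∀ v : SobolevH1 g, |∫ x, v.fn x ∂g.area| ≤ m → v.gradPairing v ≤ e → ‖v‖ ≤ R := by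
  obtain ⟨C, hC, h⟩ := exists_poincare g
  have hA := area_real_univ_pos g
  set A := g.area.real univ
  refine ⟨√((C + 1) * e) + √((m / A) ^ 2 * A), fun v hm he => ?_⟩
  set c := (∫ x, v.fn x ∂g.area) / A with hc
  have h0 : ∫ x, (v - const g c).fn x ∂g.area = 0 := by
    rw [integral_fn_sub, integral_const_fn, hc, div_mul_cancel₀ _ hA.ne', sub_self]
  have hE : (v - const g c).gradPairing (v - const g c) = v.gradPairing v := by
    rw [gradPairing_sub_left, gradPairing_sub_right, gradPairing_const_left,
      gradPairing_const_right]
    ring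
  have h1 : ‖v - const g c‖ ≤ √((C + 1) * e) := by
    refine Real.le_sqrt_of_sq_le ?_
    rw [norm_sq_eq]
    have := h _ h0
    rw [hE] at this ⊢
    nlinarith
  have h2 : ‖const g c‖ ≤ √((m / A) ^ 2 * A) := by
    refine Real.le_sqrt_of_sq_le ?_
    rw [norm_const_sq]
    refine mul_le_mul_of_nonneg_right (sq_le_sq' ?_ ?_) hA.le
    · rw [← neg_div]
      exact div_le_div_of_nonneg_right (abs_le.1 hm).1 hA.le
    · exact div_le_div_of_nonneg_right (abs_le.1 hm).2 hA.le
  calc ‖v‖ = ‖(v - const g c) + const g c‖ := by rw [sub_add_cancel]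
    _ ≤ _ := (norm_add_le _ _).trans (add_le_add h1 h2)

end SobolevH1

open SobolevH1

variable (α : HolomorphicQuadraticDifferential S)

/-- Palais–Smale sequences are bounded: testing the derivative with the constant `1` bounds both
exponential integrals, hence the mean from below; the value of the functional then bounds the
energy, and the mean from above. -/
theorem exists_norm_le_of_fderiv_le [ConnectedSpace S] (t c : ℝ) :
    ∃ R, ∀ v : SobolevH1 g, gaussFunctional α t v ≤ c →
      ‖fderiv ℝ (gaussFunctional (g := g) α t) v‖ ≤ 1 → ‖v‖ ≤ R := by
  set A := g.area.real univ
  set N := ‖const g 1‖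
  set b := A + N / 2
  have hA : 0 ≤ A := measureReal_nonneg
  have hN : 0 ≤ N := norm_nonneg _
  obtain ⟨R, hR⟩ := exists_norm_le_of_integral_le g (b + |c| + 2 * b) (2 * (|c| + 4 * b))
  refine ⟨R, fun v hI hD => ?_⟩
  have h1 := (fderiv ℝ (gaussFunctional (g := g) α t) v).le_opNorm (const g 1)
  rw [fderiv_gaussFunctional_apply, gradPairing_const_right, integral_const_fn, one_mul,
    Real.norm_eq_abs] at h1
  have e1 : ∫ x, α.normSq g x * Real.exp (v.fn x) * (const g 1).fn x ∂g.area =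
      ∫ x, α.normSq g x * Real.exp (v.fn x) ∂g.area := by
    refine integral_congr_ae ?_
    filter_upwards [fn_const g 1] with x hx
    rw [hx, mul_one]
  have e2 : ∫ x, Real.exp (-v.fn x) * (const g 1).fn x ∂g.area =
      ∫ x, Real.exp (-v.fn x) ∂g.area := by
    refine integral_congr_ae ?_
    filter_upwards [fn_const g 1] with x hx
    rw [hx, mul_one]
  rw [e1, e2] at h1
  have hX : 0 ≤ t ^ 2 * ∫ x, α.normSq g x * Real.exp (v.fn x) ∂g.area :=
    mul_nonneg (sq_nonneg t) (integral_nonneg fun x =>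
      mul_nonneg (α.normSq_nonneg g x) (Real.exp_pos _).le)
  have hY : 0 ≤ ∫ x, Real.exp (-v.fn x) ∂g.area := integral_nonneg fun x => (Real.exp_pos _).le
  have hYM : -∫ x, Real.exp (-v.fn x) ∂g.area ≤ ∫ x, v.fn x ∂g.area := by
    rw [← integral_neg]
    refine integral_mono v.integrable_exp_neg.neg v.integrable_fn fun x => ?_
    have := Real.add_one_le_exp (-v.fn x)
    simp only
    linarith
  have hE := v.gradPairing_self_nonneg
  rw [gaussFunctional] at hI
  have h2 := (abs_le.1 (h1.trans (mul_le_of_le_one_left hN hD))).1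
  have h3 := le_abs_self c
  have hc0 := abs_nonneg c
  set X := ∫ x, α.normSq g x * Real.exp (v.fn x) ∂g.area
  set Y := ∫ x, Real.exp (-v.fn x) ∂g.area
  set M := ∫ x, v.fn x ∂g.area
  have h4 : t ^ 2 * X + Y ≤ b := by simp only [b]; linarith
  refine hR v (abs_le.2 ⟨?_, ?_⟩) ?_
  · linarith
  · linarith
  · linarith

/-- For a bounded sequence on which the derivative tends to zero, weak limits are strong limits. -/
theorem tendsto_of_isWeakLimit (t : ℝ) {v : ℕ → SobolevH1 g} {w : SobolevH1 g}
    (hw : IsWeakLimit v w) (hD : Tendsto (fun n => fderiv ℝ (gaussFunctional (g := g) α t) (v n))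
      (hyperfilter ℕ) (𝓝 0)) : Tendsto v (hyperfilter ℕ) (𝓝 w) := by
  obtain ⟨R, hR⟩ := hw.1
  obtain ⟨W, hW⟩ := α.exists_normSq_le g
  obtain ⟨C₁, hC₁, h₁⟩ := exists_integral_exp_mul_le_norm_toL2 (g := g) (α.measurable_normSq g) hW R
  obtain ⟨C₂, hC₂, h₂⟩ := exists_integral_exp_mul_le_norm_toL2 (g := g) (w := fun _ => (1 : ℝ))
    measurable_const (fun _ => le_rfl) R
  have hL : Tendsto (fun n => ‖toL2 (v n - w)‖) (hyperfilter ℕ) (𝓝 0) := by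
    have := (hw.tendsto_toL2.sub_const (toL2 w)).norm
    simpa only [map_sub, sub_self, norm_zero] using this
  have t1 : Tendsto (fun n => fderiv ℝ (gaussFunctional (g := g) α t) (v n) (v n - w))
      (hyperfilter ℕ) (𝓝 0) := by
    have h0 : Tendsto (fun n => ‖fderiv ℝ (gaussFunctional (g := g) α t) (v n)‖ * (R + ‖w‖))
        (hyperfilter ℕ) (𝓝 0) := by
      have := (tendsto_zero_iff_norm_tendsto_zero (E := SobolevH1 g →L[ℝ] ℝ)).1 hD
      simpa using this.mul_const (R + ‖w‖)
    refine squeeze_zero_norm (fun n => ?_) h0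
    refine (ContinuousLinearMap.le_opNorm _ _).trans ?_
    refine mul_le_mul_of_nonneg_left ?_ (norm_nonneg _)
    exact (norm_sub_le _ _).trans (by linarith [hR n])
  have t2 : Tendsto (fun n => ∫ x, α.normSq g x * Real.exp ((v n).fn x) * (v n - w).fn x ∂g.area)
      (hyperfilter ℕ) (𝓝 0) := by
    refine squeeze_zero_norm (a := fun n => C₁ * ‖const g 1‖ * ‖toL2 (v n - w)‖) (fun n => ?_)
      (by simpa using hL.const_mul (C₁ * ‖const g 1‖))
    refine (le_of_eq ?_).trans (h₁ (v n) (const g 1) (v n - w) (hR n))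
    rw [Real.norm_eq_abs]
    congr 1
    refine integral_congr_ae ?_
    filter_upwards [fn_const g 1] with x hx
    rw [hx, one_mul]
  have t3 : Tendsto (fun n => ∫ x, Real.exp (-(v n).fn x) * (v n - w).fn x ∂g.area)
      (hyperfilter ℕ) (𝓝 0) := by
    refine squeeze_zero_norm (a := fun n => C₂ * ‖const g 1‖ * ‖toL2 (v n - w)‖) (fun n => ?_)
      (by simpa using hL.const_mul (C₂ * ‖const g 1‖))
    refine (le_of_eq ?_).trans (h₂ (-v n) (const g 1) (v n - w) ((norm_neg _).trans_le (hR n)))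
    rw [Real.norm_eq_abs]
    congr 1
    refine integral_congr_ae ?_
    filter_upwards [fn_const g 1, (v n).exp_neg_fn_ae] with x hx h2
    rw [h2, hx]
    ring
  have t4 : Tendsto (fun n => ∫ x, (v n - w).fn x ∂g.area) (hyperfilter ℕ) (𝓝 0) := by
    have := ((innerSL ℝ (indicatorConstLp 2 MeasurableSet.univ (measure_ne_top g.area univ)
      (1 : ℝ))).continuous.tendsto (toL2 w)).comp hw.tendsto_toL2
    have e : ∀ n, ∫ x, (v n - w).fn x ∂g.area = integralCLM g (v n) - integralCLM g w := fun n => by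
      rw [← integralCLM_apply, map_sub]
    simp_rw [e]
    rw [← sub_self (integralCLM g w)]
    exact this.sub_const _
  have t5 : Tendsto (fun n => w.gradPairing (v n - w)) (hyperfilter ℕ) (𝓝 0) := by
    have := (hw.tendsto_gradPairing w).sub_const (w.gradPairing w)
    rw [sub_self] at this
    refine this.congr fun n => ?_
    rw [gradPairing_sub_right, gradPairing_comm w (v n)]
  have hsq : Tendsto (fun n => ‖v n - w‖ ^ 2) (hyperfilter ℕ) (𝓝 0) := by
    have := ((((t1.add (t2.const_mul (2 * t ^ 2))).add (t3.const_mul 2)).sub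
      (t4.const_mul 2)).sub t5).add (hL.pow 2)
    simp only [mul_zero, add_zero, sub_zero, ne_eq, OfNat.ofNat_ne_zero, not_false_eq_true,
      zero_pow] at this
    refine this.congr fun n => ?_
    rw [norm_sq_eq, fderiv_gaussFunctional_apply, gradPairing_sub_left (v n) w]
    ring
  rw [tendsto_iff_norm_sub_tendsto_zero]
  have := hsq.sqrt
  rw [Real.sqrt_zero] at this
  exact this.congr fun n => Real.sqrt_sq (norm_nonneg _)

theorem exists_subseq_tendsto_of_palaisSmale [ConnectedSpace S] (t c : ℝ) {v : ℕ → SobolevH1 g}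
    (hI : Tendsto (fun n => gaussFunctional α t (v n)) atTop (𝓝 c))
    (hD : Tendsto (fun n => fderiv ℝ (gaussFunctional (g := g) α t) (v n)) atTop (𝓝 0)) :
    ∃ (w : SobolevH1 g) (k : ℕ → ℕ), StrictMono k ∧ Tendsto (fun n => v (k n)) atTop (𝓝 w) := by
  obtain ⟨R, hR⟩ := exists_norm_le_of_fderiv_le (g := g) α t (c + 1)
  have hD0 := (tendsto_zero_iff_norm_tendsto_zero (E := SobolevH1 g →L[ℝ] ℝ)).1 hD
  obtain ⟨n₀, hn₀⟩ := eventually_atTop.1 ((hI.eventually_le_const (lt_add_one c)).and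
    (hD0.eventually_le_const one_pos))
  have hb : ∀ n, ‖v (n + n₀)‖ ≤ R := fun n =>
    hR _ (hn₀ _ (Nat.le_add_left _ _)).1 (hn₀ _ (Nat.le_add_left _ _)).2
  obtain ⟨w, hw⟩ := exists_isWeakLimit (fun n => v (n + n₀)) hb
  have h := tendsto_of_isWeakLimit α t hw
    ((hD.comp (tendsto_add_atTop_nat n₀)).mono_left Nat.hyperfilter_le_atTop)
  obtain ⟨k, hk, hkt⟩ := exists_subseq_of_hyperfilter h
  exact ⟨w, fun n => k n + n₀, fun a b hab => Nat.add_lt_add_right (hk hab) _, hkt⟩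

theorem exists_critical_of_palaisSmale [ConnectedSpace S] (t c : ℝ) {v : ℕ → SobolevH1 g}
    (hI : Tendsto (fun n => gaussFunctional α t (v n)) atTop (𝓝 c))
    (hD : Tendsto (fun n => fderiv ℝ (gaussFunctional (g := g) α t) (v n)) atTop (𝓝 0)) :
    ∃ w : SobolevH1 g, gaussFunctional α t w = c ∧
      HasFDerivAt (gaussFunctional (g := g) α t) (0 : SobolevH1 g →L[ℝ] ℝ) w := by
  obtain ⟨w, k, hk, hkt⟩ := exists_subseq_tendsto_of_palaisSmale α t c hI hD
  have hC := contDiff_gaussFunctional (g := g) α t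
  refine ⟨w, tendsto_nhds_unique ((hC.continuous.tendsto w).comp hkt) (hI.comp hk.tendsto_atTop),
    ?_⟩
  have h0 : fderiv ℝ (gaussFunctional (g := g) α t) w = 0 :=
    tendsto_nhds_unique (((hC.continuous_fderiv one_ne_zero).tendsto w).comp hkt)
      (hD.comp hk.tendsto_atTop)
  exact h0 ▸ hasFDerivAt_gaussFunctional α t w

end PalaisSmale

/-! ### Comparison with a stable solution, and strict stability -/

section Comparison

open SobolevH1

variable {S : Type*} [TopologicalSpace S] [ChartedSpace ℂ S] [IsManifold 𝓘(ℂ) ω S]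
  [CompactSpace S] [MeasurableSpace S] [BorelSpace S] {g : HyperbolicMetric S}

/-- The nonlinearity `v ↦ k e^v - 2 (1 - e^{-v})` is strictly convex. -/
theorem nonlinearity_lt_tangent {k a b : ℝ} (hk : 0 ≤ k) (hab : a ≠ b) :
    (k * Real.exp a - 2 * (1 - Real.exp (-a))) - (k * Real.exp b - 2 * (1 - Real.exp (-b))) <
      (k * Real.exp a - 2 * Real.exp (-a)) * (a - b) := by
  have h1 := mul_le_mul_of_nonneg_left (Real.add_one_le_exp (b - a)) (Real.exp_pos a).le
  have h2 := mul_lt_mul_of_pos_left (Real.add_one_lt_exp (sub_ne_zero.2 hab)) (Real.exp_pos (-a))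
  rw [← Real.exp_add, show a + (b - a) = b by ring] at h1
  rw [← Real.exp_add, show -a + (a - b) = -b by ring] at h2
  nlinarith

variable (α : HolomorphicQuadraticDifferential S)

theorem integrable_nonlinearity_mul (t : ℝ) (v φ : SobolevH1 g) :
    Integrable (fun x => (2 * t ^ 2 * α.normSq g x * Real.exp (v.fn x) -
      2 * (1 - Real.exp (-v.fn x))) * φ.fn x) g.area := by
  refine ((((integrable_normSq_exp_mul α v φ).const_mul (2 * t ^ 2)).add
    ((v.integrable_exp_neg_mul φ).const_mul 2)).sub (φ.integrable_fn.const_mul 2)).congr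
      (ae_of_all _ fun x => ?_)
  simp only [Pi.add_apply, Pi.sub_apply]
  ring

theorem integrable_linearization_mul (t : ℝ) (v φ ψ : SobolevH1 g) :
    Integrable (fun x => (2 * t ^ 2 * α.normSq g x * Real.exp (v.fn x) -
      2 * Real.exp (-v.fn x)) * (φ.fn x * ψ.fn x)) g.area := by
  refine (((integrable_normSq_exp_mul_mul α v φ ψ).const_mul (2 * t ^ 2)).sub
    ((v.integrable_exp_neg_mul_mul φ ψ).const_mul 2)).congr (ae_of_all _ fun x => ?_)
  simp only [Pi.sub_apply]
  ring

/-- The symmetric bilinear form of the linearized operator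
`φ ↦ -Δφ - (2 t² K e^v - 2 e^{-v}) φ`. -/
noncomputable def secondVariation (t : ℝ) (v φ ψ : SobolevH1 g) : ℝ :=
  φ.gradPairing ψ - ∫ x, (2 * t ^ 2 * α.normSq g x * Real.exp (v.fn x) -
    2 * Real.exp (-v.fn x)) * (φ.fn x * ψ.fn x) ∂g.area

theorem isStableGaussSolution_iff (t : ℝ) (v : SobolevH1 g) :
    IsStableGaussSolution α t v ↔
      IsGaussSolution α t v ∧ ∀ φ : SobolevH1 g, 0 ≤ secondVariation α t v φ φ := by
  simp only [IsStableGaussSolution, secondVariation, sq]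

variable {α}

/-- A stable solution lies below every solution for the same or a larger parameter: the positive
part of the difference is a test function for both equations and for the stability inequality, and
convexity leaves room only for the value zero. -/
theorem IsStableGaussSolution.fn_le {t t' : ℝ} {v w : SobolevH1 g}
    (hv : IsStableGaussSolution α t v) (hw : IsGaussSolution α t' w) (ht : 0 ≤ t) (htt : t ≤ t') :
    ∀ᵐ x ∂g.area, v.fn x ≤ w.fn x := by
  obtain ⟨φ, hφ, hE⟩ := (v - w).exists_posPart
  rw [isStableGaussSolution_iff] at hv
  have h1 := hv.2 φ
  rw [secondVariation] at h1
  rw [gradPairing_sub_left, hv.1 φ, hw φ] at hE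
  have i1 := integrable_nonlinearity_mul α t v φ
  have i2 := integrable_nonlinearity_mul α t' w φ
  have i3 := integrable_linearization_mul α t v φ φ
  set N : S → ℝ := fun x => (2 * t ^ 2 * α.normSq g x * Real.exp (v.fn x) -
      2 * (1 - Real.exp (-v.fn x))) * φ.fn x - (2 * t' ^ 2 * α.normSq g x * Real.exp (w.fn x) -
      2 * (1 - Real.exp (-w.fn x))) * φ.fn x - (2 * t ^ 2 * α.normSq g x * Real.exp (v.fn x) -
      2 * Real.exp (-v.fn x)) * (φ.fn x * φ.fn x) with hN
  have iN : Integrable N g.area := (i1.sub i2).sub i3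
  have hint : 0 ≤ ∫ x, N x ∂g.area := by
    rw [hN, integral_sub (by exact i1.sub i2) i3, integral_sub i1 i2]
    linarith
  have hneg : ∀ᵐ x ∂g.area, N x ≤ 0 ∧ (N x = 0 → v.fn x ≤ w.fn x) := by
    filter_upwards [hφ, fn_sub v w] with x hx h2
    rw [h2, Pi.sub_apply] at hx
    rcases le_or_gt (v.fn x) (w.fn x) with h | h
    · rw [max_eq_right (by linarith)] at hx
      simp [hN, hx, h]
    · rw [max_eq_left (by linarith)] at hx
      have hK := α.normSq_nonneg g x
      have h3 := nonlinearity_lt_tangent (k := 2 * t ^ 2 * α.normSq g x) (by positivity) h.ne'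
      have h4 : 2 * t ^ 2 * α.normSq g x * Real.exp (w.fn x) ≤
          2 * t' ^ 2 * α.normSq g x * Real.exp (w.fn x) := by gcongr
      have h5 : N x < 0 := by
        have : N x = ((2 * t ^ 2 * α.normSq g x * Real.exp (v.fn x) -
          2 * (1 - Real.exp (-v.fn x))) - (2 * t' ^ 2 * α.normSq g x * Real.exp (w.fn x) -
          2 * (1 - Real.exp (-w.fn x))) - (2 * t ^ 2 * α.normSq g x * Real.exp (v.fn x) -
          2 * Real.exp (-v.fn x)) * (v.fn x - w.fn x)) * (v.fn x - w.fn x) := by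
          simp only [hN, hx]
          ring
        rw [this]
        exact mul_neg_of_neg_of_pos (by linarith) (by linarith)
      exact ⟨h5.le, fun h0 => absurd h0 h5.ne⟩
  have h0 : -N =ᵐ[g.area] 0 := by
    refine (integral_eq_zero_iff_of_nonneg_ae ?_ iN.neg).1 ?_
    · filter_upwards [hneg] with x hx
      simpa using hx.1
    · refine le_antisymm ?_ (integral_nonneg_of_ae ?_)
      · simp only [Pi.neg_apply, integral_neg]
        linarith
      · filter_upwards [hneg] with x hx
        simpa using hx.1
  filter_upwards [hneg, h0] with x hx hx0
  exact hx.2 (by simpa using hx0)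

/-- A nonnegative element of the kernel of the linearized operator at a stable solution vanishes,
if the problem has a solution for a larger parameter. -/
theorem IsStableGaussSolution.fn_eq_zero_of_kernel [ConnectedSpace S] {t t' : ℝ}
    {v w ψ : SobolevH1 g} (hv : IsStableGaussSolution α t v) (hw : IsGaussSolution α t' w)
    (ht : 0 ≤ t) (htt : t < t') (hα : ∃ x, α.normSq g x ≠ 0) (hψ : ∀ᵐ x ∂g.area, 0 ≤ ψ.fn x)
    (hker : ∀ φ, secondVariation α t v ψ φ = 0) : ψ.fn =ᵐ[g.area] 0 := by
  have hle := hv.fn_le hw ht htt.le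
  have h1 := hker (w - v)
  rw [secondVariation, gradPairing_sub_right, gradPairing_comm, gradPairing_comm ψ, hw ψ,
    hv.1 ψ] at h1
  have i1 := integrable_nonlinearity_mul α t' w ψ
  have i2 := integrable_nonlinearity_mul α t v ψ
  have i3 := integrable_linearization_mul α t v ψ (w - v)
  rw [← integral_sub i1 i2, ← integral_sub (by exact i1.sub i2) i3] at h1
  have hpt : ∀ᵐ x ∂g.area, ∃ c : ℝ, 0 < c ∧
      (2 * t' ^ 2 * α.normSq g x * Real.exp (w.fn x) - 2 * (1 - Real.exp (-w.fn x))) * ψ.fn x -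
      (2 * t ^ 2 * α.normSq g x * Real.exp (v.fn x) - 2 * (1 - Real.exp (-v.fn x))) * ψ.fn x -
      (2 * t ^ 2 * α.normSq g x * Real.exp (v.fn x) - 2 * Real.exp (-v.fn x)) *
        (ψ.fn x * (w - v).fn x) = c * ψ.fn x := by
    filter_upwards [fn_sub w v, α.ae_normSq_pos g hα] with x hx hK
    refine ⟨(2 * t' ^ 2 * α.normSq g x * Real.exp (w.fn x) - 2 * (1 - Real.exp (-w.fn x))) -
      (2 * t ^ 2 * α.normSq g x * Real.exp (v.fn x) - 2 * (1 - Real.exp (-v.fn x))) -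
      (2 * t ^ 2 * α.normSq g x * Real.exp (v.fn x) - 2 * Real.exp (-v.fn x)) *
        (w.fn x - v.fn x), ?_, ?_⟩
    · have h4 : 2 * t ^ 2 * α.normSq g x * Real.exp (w.fn x) <
          2 * t' ^ 2 * α.normSq g x * Real.exp (w.fn x) := by gcongr
      rcases eq_or_ne (v.fn x) (w.fn x) with h | h
      · rw [h]
        linarith
      · have h3 := nonlinearity_lt_tangent (k := 2 * t ^ 2 * α.normSq g x) (by positivity) h
        linarith
    · rw [hx, Pi.sub_apply]
      ring
  rw [integral_eq_zero_iff_of_nonneg_ae ?_ (by exact (i1.sub i2).sub i3)] at h1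
  · filter_upwards [h1, hpt] with x hx hc
    obtain ⟨c, hc, h⟩ := hc
    rw [hx, Pi.zero_apply] at h
    exact (mul_eq_zero.1 h.symm).resolve_left hc.ne'
  · filter_upwards [hpt, hψ] with x hc hx
    obtain ⟨c, hc, h⟩ := hc
    rw [h]
    exact mul_nonneg hc.le hx

/-- If a semidefinite form vanishes at `ψ`, then `ψ` is in its kernel. -/
theorem IsStableGaussSolution.secondVariation_eq_zero {t : ℝ} {v ψ : SobolevH1 g}
    (hv : IsStableGaussSolution α t v) (hψ : secondVariation α t v ψ ψ ≤ 0) (φ : SobolevH1 g) :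
    secondVariation α t v ψ φ = 0 := by
  rw [isStableGaussSolution_iff] at hv
  have hexp : ∀ s : ℝ, secondVariation α t v (s • ψ + φ) (s • ψ + φ) =
      s ^ 2 * secondVariation α t v ψ ψ + 2 * s * secondVariation α t v ψ φ +
        secondVariation α t v φ φ := by
    intro s
    have i1 := (integrable_linearization_mul α t v ψ ψ).const_mul (s ^ 2)
    have i2 := (integrable_linearization_mul α t v ψ φ).const_mul (2 * s)
    have i3 := integrable_linearization_mul α t v φ φ
    have e : ∫ x, (2 * t ^ 2 * α.normSq g x * Real.exp (v.fn x) - 2 * Real.exp (-v.fn x)) *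
        ((s • ψ + φ).fn x * (s • ψ + φ).fn x) ∂g.area =
        s ^ 2 * (∫ x, (2 * t ^ 2 * α.normSq g x * Real.exp (v.fn x) - 2 * Real.exp (-v.fn x)) *
          (ψ.fn x * ψ.fn x) ∂g.area) +
        2 * s * (∫ x, (2 * t ^ 2 * α.normSq g x * Real.exp (v.fn x) - 2 * Real.exp (-v.fn x)) *
          (ψ.fn x * φ.fn x) ∂g.area) +
        ∫ x, (2 * t ^ 2 * α.normSq g x * Real.exp (v.fn x) - 2 * Real.exp (-v.fn x)) *
          (φ.fn x * φ.fn x) ∂g.area := by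
      rw [← integral_const_mul, ← integral_const_mul, ← integral_add i1 i2,
        ← integral_add (by exact i1.add i2) i3]
      refine integral_congr_ae ?_
      filter_upwards [fn_add (s • ψ) φ, fn_smul s ψ] with x h1 h2
      rw [h1, Pi.add_apply, h2, Pi.smul_apply, smul_eq_mul]
      ring
    rw [secondVariation, e]
    simp only [secondVariation, gradPairing_add_left, gradPairing_add_right,
      gradPairing_smul_left, gradPairing_smul_right, gradPairing_comm φ ψ]
    ring
  have h0 : secondVariation α t v ψ ψ = 0 := le_antisymm hψ (hv.2 ψ)
  by_contra hne
  have h := hv.2 ((-(secondVariation α t v φ φ + 1) / (2 * secondVariation α t v ψ φ)) • ψ + φ)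
  rw [hexp, h0, mul_div_assoc', mul_div_mul_left _ _ two_ne_zero, div_mul_cancel₀ _ hne] at h
  linarith

theorem tendsto_integral_linearization (t : ℝ) (v : SobolevH1 g) {u : ℕ → SobolevH1 g}
    {φ : SobolevH1 g} (h : IsWeakLimit u φ) :
    Tendsto (fun n => ∫ x, (2 * t ^ 2 * α.normSq g x * Real.exp (v.fn x) -
        2 * Real.exp (-v.fn x)) * ((u n).fn x * (u n).fn x) ∂g.area) (hyperfilter ℕ)
      (𝓝 (∫ x, (2 * t ^ 2 * α.normSq g x * Real.exp (v.fn x) -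
        2 * Real.exp (-v.fn x)) * (φ.fn x * φ.fn x) ∂g.area)) := by
  obtain ⟨R, hR⟩ := h.1
  obtain ⟨W, hW⟩ := α.exists_normSq_le g
  obtain ⟨C₁, hC₁, h₁⟩ := exists_integral_exp_mul_le_norm_toL2 (g := g) (α.measurable_normSq g) hW
    ‖v‖
  obtain ⟨C₂, hC₂, h₂⟩ := exists_integral_exp_mul_le_norm_toL2 (g := g) (w := fun _ => (1 : ℝ))
    measurable_const (fun _ => le_rfl) ‖v‖
  have hL : Tendsto (fun n => ‖toL2 (u n - φ)‖) (hyperfilter ℕ) (𝓝 0) := by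
    have := (h.tendsto_toL2.sub_const (toL2 φ)).norm
    simpa only [map_sub, sub_self, norm_zero] using this
  rw [tendsto_iff_norm_sub_tendsto_zero]
  refine squeeze_zero (fun n => norm_nonneg _)
    (g := fun n => (2 * t ^ 2 * C₁ + 2 * C₂) * (R + ‖φ‖) * ‖toL2 (u n - φ)‖) (fun n => ?_)
    (by simpa using hL.const_mul ((2 * t ^ 2 * C₁ + 2 * C₂) * (R + ‖φ‖)))
  have b1 := h₁ v (u n + φ) (u n - φ) le_rfl
  have b2 := h₂ (-v) (u n + φ) (u n - φ) (norm_neg v).le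
  have e : (∫ x, (2 * t ^ 2 * α.normSq g x * Real.exp (v.fn x) -
        2 * Real.exp (-v.fn x)) * ((u n).fn x * (u n).fn x) ∂g.area) -
      ∫ x, (2 * t ^ 2 * α.normSq g x * Real.exp (v.fn x) -
        2 * Real.exp (-v.fn x)) * (φ.fn x * φ.fn x) ∂g.area =
      2 * t ^ 2 * (∫ x, α.normSq g x * Real.exp (v.fn x) *
        ((u n + φ).fn x * (u n - φ).fn x) ∂g.area) -
      2 * ∫ x, 1 * Real.exp ((-v).fn x) * ((u n + φ).fn x * (u n - φ).fn x) ∂g.area := by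
    have i1 := (integrable_normSq_exp_mul_mul α v (u n + φ) (u n - φ)).const_mul (2 * t ^ 2)
    have i2 := ((-v).integrable_exp_mul_mul (u n + φ) (u n - φ) (w := fun _ => (1 : ℝ))
      measurable_const fun _ => le_rfl).const_mul 2
    rw [← integral_sub (integrable_linearization_mul α t v _ _)
      (integrable_linearization_mul α t v _ _), ← integral_const_mul, ← integral_const_mul,
      ← integral_sub i1 i2]
    refine integral_congr_ae ?_
    filter_upwards [fn_add (u n) φ, fn_sub (u n) φ, v.exp_neg_fn_ae] with x h1 h2 h3
    rw [h1, h2, h3, Pi.add_apply, Pi.sub_apply]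
    ring
  rw [e, Real.norm_eq_abs]
  have hn : ‖u n + φ‖ ≤ R + ‖φ‖ := (norm_add_le _ _).trans (by linarith [hR n])
  have hT := norm_nonneg (toL2 (u n - φ))
  have b3 : C₁ * ‖u n + φ‖ * ‖toL2 (u n - φ)‖ ≤ C₁ * (R + ‖φ‖) * ‖toL2 (u n - φ)‖ := by gcongr
  have b4 : C₂ * ‖u n + φ‖ * ‖toL2 (u n - φ)‖ ≤ C₂ * (R + ‖φ‖) * ‖toL2 (u n - φ)‖ := by gcongr
  refine (abs_sub _ _).trans ?_
  rw [abs_mul, abs_of_nonneg (by positivity : (0 : ℝ) ≤ 2 * t ^ 2), abs_mul,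
    abs_of_nonneg (by norm_num : (0 : ℝ) ≤ 2)]
  have b5 := mul_le_mul_of_nonneg_left (b1.trans b3) (by positivity : (0 : ℝ) ≤ 2 * t ^ 2)
  linarith [b2.trans b4]

/-- Below the maximal parameter, the second variation at a stable solution is coercive. -/
theorem IsStableGaussSolution.exists_coercive [ConnectedSpace S] {t t' : ℝ} {v w : SobolevH1 g}
    (hv : IsStableGaussSolution α t v) (hw : IsGaussSolution α t' w) (ht : 0 ≤ t) (htt : t < t')
    (hα : ∃ x, α.normSq g x ≠ 0) :
    ∃ δ : ℝ, 0 < δ ∧ ∀ φ : SobolevH1 g, δ * ‖φ‖ ^ 2 ≤ secondVariation α t v φ φ := by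
  by_contra! hcon
  have h : ∀ n : ℕ, ∃ φ : SobolevH1 g, ‖φ‖ = 1 ∧
      secondVariation α t v φ φ ≤ 1 / ((n : ℝ) + 1) := by
    intro n
    obtain ⟨φ, hφ⟩ := hcon (1 / ((n : ℝ) + 1)) (by positivity)
    have hne : ‖φ‖ ≠ 0 := by
      intro h0
      have := ((isStableGaussSolution_iff α t v).1 hv).2 φ
      rw [h0] at hφ
      simp only [ne_eq, OfNat.ofNat_ne_zero, not_false_eq_true, zero_pow, mul_zero] at hφ
      linarith
    have hs : secondVariation α t v (‖φ‖⁻¹ • φ) (‖φ‖⁻¹ • φ) =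
        (‖φ‖ ^ 2)⁻¹ * secondVariation α t v φ φ := by
      rw [secondVariation, secondVariation, gradPairing_smul_left, gradPairing_smul_right, mul_sub,
        ← integral_const_mul]
      congr 1
      · rw [sq, mul_inv]; ring
      · refine integral_congr_ae ?_
        filter_upwards [fn_smul ‖φ‖⁻¹ φ] with x hx
        rw [hx, Pi.smul_apply, smul_eq_mul, ← inv_pow]
        ring
    refine ⟨‖φ‖⁻¹ • φ, ?_, ?_⟩
    · rw [norm_smul, norm_inv, norm_norm, inv_mul_cancel₀ hne]
    · rw [hs, inv_mul_le_iff₀ (by positivity), mul_comm]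
      exact hφ.le
  choose u hu1 hu2 using h
  obtain ⟨φ, hφ⟩ := exists_isWeakLimit u fun n => (hu1 n).le
  have hlin := tendsto_integral_linearization (α := α) t v hφ
  have hinv : Tendsto (fun n : ℕ => 1 / ((n : ℝ) + 1)) (hyperfilter ℕ) (𝓝 0) :=
    tendsto_one_div_add_atTop_nhds_zero_nat.mono_left Nat.hyperfilter_le_atTop
  have hc := hinv.add hlin
  rw [zero_add] at hc
  have hEn : ∀ n, (u n).gradPairing (u n) ≤ 1 / ((n : ℝ) + 1) +
      ∫ x, (2 * t ^ 2 * α.normSq g x * Real.exp (v.fn x) -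
        2 * Real.exp (-v.fn x)) * ((u n).fn x * (u n).fn x) ∂g.area := fun n => by
    have := hu2 n
    rw [secondVariation] at this
    linarith
  have hE := hφ.gradPairing_le hc hEn
  obtain ⟨ψ, hψ, hψE⟩ := φ.exists_abs
  have hψQ : secondVariation α t v ψ ψ ≤ 0 := by
    have e : ∫ x, (2 * t ^ 2 * α.normSq g x * Real.exp (v.fn x) -
        2 * Real.exp (-v.fn x)) * (ψ.fn x * ψ.fn x) ∂g.area =
        ∫ x, (2 * t ^ 2 * α.normSq g x * Real.exp (v.fn x) -
        2 * Real.exp (-v.fn x)) * (φ.fn x * φ.fn x) ∂g.area := by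
      refine integral_congr_ae ?_
      filter_upwards [hψ] with x hx
      rw [hx, abs_mul_abs_self]
    rw [secondVariation, e]
    linarith
  have h0 := hv.fn_eq_zero_of_kernel hw ht htt hα
    (by filter_upwards [hψ] with x hx; rw [hx]; exact abs_nonneg _)
    (hv.secondVariation_eq_zero hψQ)
  have hφ0 : φ.fn =ᵐ[g.area] 0 := by
    filter_upwards [hψ, h0] with x h1 h2
    exact abs_eq_zero.1 (h1.symm.trans h2)
  have e0 : ∫ x, (2 * t ^ 2 * α.normSq g x * Real.exp (v.fn x) -
      2 * Real.exp (-v.fn x)) * (φ.fn x * φ.fn x) ∂g.area = 0 := by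
    refine integral_eq_zero_of_ae ?_
    filter_upwards [hφ0] with x hx
    rw [hx]
    simp
  have hL0 : toL2 φ = 0 := (Lp.eq_zero_iff_ae_eq_zero).2 hφ0
  have hT := hφ.tendsto_toL2.norm.pow 2
  rw [hL0, norm_zero] at hT
  rw [e0] at hc
  have hlim := hc.add hT
  have := ge_of_tendsto' (b := (1 : ℝ)) hlim fun n => by
    have h1 := (u n).norm_sq_eq
    rw [hu1 n, one_pow] at h1
    have h2 := hEn n
    linarith
  norm_num at this

end Comparison

/-! ### The mountain-pass geometry -/

section MountainPass

open SobolevH1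

variable {S : Type*} [TopologicalSpace S] [ChartedSpace ℂ S] [IsManifold 𝓘(ℂ) ω S]
  [CompactSpace S] [MeasurableSpace S] [BorelSpace S] {g : HyperbolicMetric S}

theorem abs_exp_sub_taylor_two_le (y : ℝ) :
    |Real.exp y - 1 - y - y ^ 2 / 2| ≤ Real.exp |y| * (|y| * |y| * |y|) := by
  have h := Complex.norm_exp_sub_sum_le_norm_mul_exp (y : ℂ) 3
  have e : Complex.exp y - ∑ m ∈ Finset.range 3, (y : ℂ) ^ m / (m.factorial : ℂ) =
      ((Real.exp y - 1 - y - y ^ 2 / 2 : ℝ) : ℂ) := by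
    simp [Finset.sum_range_succ]
    ring
  rw [e, Complex.norm_real, Complex.norm_real, Real.norm_eq_abs, Real.norm_eq_abs] at h
  refine h.trans (le_of_eq (by ring))

theorem exists_expFunctional_taylor_le {w : S → ℝ} {W : ℝ} (hw : Measurable w)
    (hW : ∀ x, |w x| ≤ W) (v : SobolevH1 g) : ∃ C : ℝ, 0 ≤ C ∧ ∀ φ : SobolevH1 g, ‖φ‖ ≤ 1 →
      |∫ x, w x * Real.exp ((v + φ).fn x) ∂g.area - ∫ x, w x * Real.exp (v.fn x) ∂g.area -
        ∫ x, w x * Real.exp (v.fn x) * φ.fn x ∂g.area -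
        1 / 2 * ∫ x, w x * Real.exp (v.fn x) * (φ.fn x * φ.fn x) ∂g.area| ≤ C * ‖φ‖ ^ 3 := by
  obtain ⟨C, hC, h⟩ := exists_integral_exp_mul_le g (show (0 : ℝ) ≤ 2 by norm_num) (max ‖v‖ 1)
  refine ⟨|W| * (2 * C), by positivity, fun φ hφ => ?_⟩
  obtain ⟨i₁, b₁⟩ := h v φ φ φ (le_max_left _ _)
  obtain ⟨i₂, b₂⟩ := h φ φ φ φ (hφ.trans (le_max_right _ _))
  have j₁ := (v + φ).integrable_exp hw hW
  have j₂ := v.integrable_exp hw hW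
  have j₃ := v.integrable_exp_mul φ hw hW
  have j₄ := (v.integrable_exp_mul_mul φ φ hw hW).const_mul (1 / 2)
  rw [← integral_const_mul, ← integral_sub j₁ j₂, ← integral_sub (by exact j₁.sub j₂) j₃,
    ← integral_sub (by exact (j₁.sub j₂).sub j₃) j₄]
  have heq : ∀ᵐ x ∂g.area, w x * Real.exp ((v + φ).fn x) - w x * Real.exp (v.fn x) -
      w x * Real.exp (v.fn x) * φ.fn x - 1 / 2 * (w x * Real.exp (v.fn x) * (φ.fn x * φ.fn x)) =
        w x * (Real.exp (v.fn x) * (Real.exp (φ.fn x) - 1 - φ.fn x - φ.fn x ^ 2 / 2)) := by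
    filter_upwards [fn_add v φ] with x hx
    rw [hx, Pi.add_apply, Real.exp_add]
    ring
  rw [integral_congr_ae heq]
  refine (norm_integral_weight_le hW (i₁.add i₂) (ae_of_all _ fun x => ?_)).trans ?_
  · rw [Pi.add_apply, ← add_mul, abs_mul, Real.abs_exp]
    refine (mul_le_mul (Real.exp_le_exp.2 (le_abs_self _)) (abs_exp_sub_taylor_two_le _)
      (abs_nonneg _) (Real.exp_pos _).le).trans ?_
    rw [← mul_assoc]
    exact mul_le_mul_of_nonneg_right (exp_abs_add_abs_le _ _) (by positivity)
  · simp only [Pi.add_apply]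
    rw [integral_add i₁ i₂, mul_assoc]
    refine mul_le_mul_of_nonneg_left ?_ (abs_nonneg _)
    calc _ ≤ C * (‖φ‖ * ‖φ‖ * ‖φ‖) + C * (‖φ‖ * ‖φ‖ * ‖φ‖) := add_le_add b₁ b₂
      _ = _ := by ring

variable {α : HolomorphicQuadraticDifferential S}

/-- The second-order expansion of the functional at a critical point. -/
theorem IsGaussSolution.exists_taylor_le {t : ℝ} {v : SobolevH1 g} (hv : IsGaussSolution α t v) :
    ∃ C : ℝ, 0 ≤ C ∧ ∀ φ : SobolevH1 g, ‖φ‖ ≤ 1 →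
      1 / 2 * secondVariation α t v φ φ - C * ‖φ‖ ^ 3 ≤
        gaussFunctional α t (v + φ) - gaussFunctional α t v := by
  obtain ⟨W, hW⟩ := α.exists_normSq_le g
  obtain ⟨C₁, hC₁, h₁⟩ := exists_expFunctional_taylor_le (g := g) (α.measurable_normSq g) hW v
  obtain ⟨C₂, hC₂, h₂⟩ := exists_expFunctional_taylor_le (g := g) (w := fun _ => (1 : ℝ))
    measurable_const (fun _ => le_rfl) (-v)
  refine ⟨2 * t ^ 2 * C₁ + 2 * C₂, by positivity, fun φ hφ => ?_⟩
  have b₁ := (abs_le.1 (h₁ φ hφ)).2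
  have b₂ := (abs_le.1 (h₂ (-φ) ((norm_neg φ).trans_le hφ))).1
  rw [norm_neg] at b₂
  have hsol := hv φ
  rw [integral_nonlinearity_mul] at hsol
  have e1 : ∫ x, 1 * Real.exp ((-v + -φ).fn x) ∂g.area = ∫ x, Real.exp (-(v + φ).fn x) ∂g.area := by
    rw [← neg_add]
    exact (integral_congr_ae (v + φ).exp_neg_fn_ae).symm
  have e2 : ∫ x, 1 * Real.exp ((-v).fn x) ∂g.area = ∫ x, Real.exp (-v.fn x) ∂g.area :=
    (integral_congr_ae v.exp_neg_fn_ae).symm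
  have e3 : ∫ x, 1 * Real.exp ((-v).fn x) * (-φ).fn x ∂g.area =
      -∫ x, Real.exp (-v.fn x) * φ.fn x ∂g.area := by
    rw [← integral_neg]
    refine integral_congr_ae ?_
    filter_upwards [v.exp_neg_fn_ae, fn_neg φ] with x h1 h2
    rw [← h1, h2, Pi.neg_apply]
    ring
  have e4 : ∫ x, 1 * Real.exp ((-v).fn x) * ((-φ).fn x * (-φ).fn x) ∂g.area =
      ∫ x, Real.exp (-v.fn x) * (φ.fn x * φ.fn x) ∂g.area := by
    refine integral_congr_ae ?_
    filter_upwards [v.exp_neg_fn_ae, fn_neg φ] with x h1 h2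
    rw [← h1, h2, Pi.neg_apply]
    ring
  rw [e1, e2, e3, e4] at b₂
  have e5 : secondVariation α t v φ φ = φ.gradPairing φ -
      (2 * t ^ 2 * (∫ x, α.normSq g x * Real.exp (v.fn x) * (φ.fn x * φ.fn x) ∂g.area) -
        2 * ∫ x, Real.exp (-v.fn x) * (φ.fn x * φ.fn x) ∂g.area) := by
    rw [secondVariation, ← integral_const_mul, ← integral_const_mul, ← integral_sub
      ((integrable_normSq_exp_mul_mul α v φ φ).const_mul _)
      ((v.integrable_exp_neg_mul_mul φ φ).const_mul _)]
    congr 2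
    funext x
    ring
  have e6 : ∫ x, (v + φ).fn x ∂g.area = ∫ x, v.fn x ∂g.area + ∫ x, φ.fn x ∂g.area := by
    simp only [← integralCLM_apply, map_add]
  rw [e5, gaussFunctional, gaussFunctional, e6, gradPairing_add_left, gradPairing_add_right,
    gradPairing_add_right, gradPairing_comm φ v, hsol]
  have b₃ := mul_le_mul_of_nonneg_left b₁ (by positivity : (0 : ℝ) ≤ 2 * t ^ 2)
  linarith

/-- A coercive critical point is a strict local minimum, surrounded by a sphere on which the
functional is larger by a definite amount. -/
theorem IsGaussSolution.exists_barrier {t : ℝ} {v : SobolevH1 g}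
    (hv : IsGaussSolution α t v) {δ : ℝ} (hδ : 0 < δ)
    (hQ : ∀ φ : SobolevH1 g, δ * ‖φ‖ ^ 2 ≤ secondVariation α t v φ φ) :
    ∃ r : ℝ, 0 < r ∧ ∃ η : ℝ, 0 < η ∧
      (∀ p : SobolevH1 g, ‖p - v‖ ≤ r → gaussFunctional α t v ≤ gaussFunctional α t p) ∧
      ∀ p : SobolevH1 g, ‖p - v‖ = r → gaussFunctional α t v + η ≤ gaussFunctional α t p := by
  obtain ⟨C, hC, h⟩ := hv.exists_taylor_le
  set r := min 1 (δ / (4 * (C + 1)))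
  have hr : 0 < r := lt_min one_pos (by positivity)
  have hCr : C * r ≤ δ / 4 := by
    have h1 : r * (4 * (C + 1)) ≤ δ := (le_div_iff₀ (by positivity)).1 (min_le_right _ _)
    nlinarith
  have key : ∀ p : SobolevH1 g, ‖p - v‖ ≤ r →
      δ / 4 * ‖p - v‖ ^ 2 ≤ gaussFunctional α t p - gaussFunctional α t v := by
    intro p hp
    have h1 := h (p - v) (hp.trans (min_le_left _ _))
    rw [add_sub_cancel] at h1
    have h2 := hQ (p - v)
    have h3 : C * ‖p - v‖ ≤ δ / 4 := (mul_le_mul_of_nonneg_left hp hC).trans hCr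
    have h4 := mul_le_mul_of_nonneg_right h3 (sq_nonneg ‖p - v‖)
    nlinarith
  refine ⟨r, hr, δ / 4 * r ^ 2, by positivity, fun p hp => ?_, fun p hp => ?_⟩
  · have h1 := key p hp
    have h2 : 0 ≤ δ / 4 * ‖p - v‖ ^ 2 := by positivity
    linarith
  · have h1 := key p hp.le
    rw [hp] at h1
    linarith

theorem integral_normSq_exp_pos [ConnectedSpace S] (hα : ∃ x, α.normSq g x ≠ 0)
    (v : SobolevH1 g) : 0 < ∫ x, α.normSq g x * Real.exp (v.fn x) ∂g.area := by
  have hnn : 0 ≤ fun x => α.normSq g x * Real.exp (v.fn x) := fun x =>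
    mul_nonneg (α.normSq_nonneg g x) (Real.exp_pos _).le
  refine (integral_nonneg hnn).lt_of_ne' fun h0 => ?_
  rw [integral_eq_zero_iff_of_nonneg hnn (integrable_normSq_exp α v)] at h0
  obtain ⟨x, hx, hx'⟩ := (h0.and (α.ae_normSq_pos g hα)).exists
  exact (mul_pos hx' (Real.exp_pos (v.fn x))).ne' hx

/-- The functional tends to `-∞` along the constants. -/
theorem exists_gaussFunctional_add_const_le [ConnectedSpace S] (hα : ∃ x, α.normSq g x ≠ 0)
    {t : ℝ} (ht : 0 < t) (v : SobolevH1 g) (m : ℝ) :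
    ∃ s : ℝ, gaussFunctional α t (v + const g s) ≤ gaussFunctional α t v - m := by
  have hX := integral_normSq_exp_pos hα v
  have hY : 0 ≤ ∫ x, Real.exp (-v.fn x) ∂g.area := integral_nonneg fun x => (Real.exp_pos _).le
  set X := ∫ x, α.normSq g x * Real.exp (v.fn x) ∂g.area with hXdef
  set Y := ∫ x, Real.exp (-v.fn x) ∂g.area with hYdef
  have hA : 0 ≤ g.area.real univ := measureReal_nonneg
  set A := g.area.real univ
  have ha : 0 < 2 * t ^ 2 * X := by positivity
  set a := 2 * t ^ 2 * X with hadef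
  set s := (4 * A + 2 * |m|) / a + 1
  have hs : 1 ≤ s := le_add_of_nonneg_left (by positivity)
  have has : a * s = 4 * A + 2 * |m| + a := by
    simp only [s]
    rw [mul_add, mul_div_cancel₀ _ ha.ne', mul_one]
  refine ⟨s, ?_⟩
  have e1 : ∫ x, α.normSq g x * Real.exp ((v + const g s).fn x) ∂g.area = Real.exp s * X := by
    rw [hXdef, ← integral_const_mul]
    refine integral_congr_ae ?_
    filter_upwards [fn_add v (const g s), fn_const g s] with x h1 h2
    rw [h1, Pi.add_apply, h2, Real.exp_add]
    ring
  have e2 : ∫ x, Real.exp (-(v + const g s).fn x) ∂g.area = Real.exp (-s) * Y := by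
    rw [hYdef, ← integral_const_mul]
    refine integral_congr_ae ?_
    filter_upwards [fn_add v (const g s), fn_const g s] with x h1 h2
    rw [h1, Pi.add_apply, h2, neg_add, Real.exp_add]
    ring
  have e3 : ∫ x, (v + const g s).fn x ∂g.area = ∫ x, v.fn x ∂g.area + s * A := by
    rw [← integral_const_fn, ← integralCLM_apply, map_add, integralCLM_apply, integralCLM_apply]
  rw [gaussFunctional, gaussFunctional, e1, e2, e3, gradPairing_add_left, gradPairing_add_right,
    gradPairing_const_left, gradPairing_const_right]
  have h1 := mul_le_mul_of_nonneg_left (Real.quadratic_le_exp_of_nonneg (by linarith : 0 ≤ s)) ha.le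
  have h2 : Real.exp (-s) * Y ≤ Y := mul_le_of_le_one_left hY (Real.exp_le_one_iff.2 (by linarith))
  have h3 : s * (2 * |m| + a) ≥ 2 * |m| := by nlinarith [abs_nonneg m]
  have h4 := le_abs_self m
  have h5 : a * s ^ 2 = s * (4 * A) + s * (2 * |m| + a) := by
    rw [sq, ← mul_assoc, has]
    ring
  have h6 : a * s ≥ 0 := by positivity
  nlinarith

/-- The mountain-pass level is a critical value, larger than the value at the stable solution. -/
theorem IsStableGaussSolution.exists_minimax_critical [ConnectedSpace S] {t t' : ℝ}
    {v w : SobolevH1 g} (hv : IsStableGaussSolution α t v) (hw : IsGaussSolution α t' w)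
    (ht : 0 < t) (htt : t < t') (hα : ∃ x, α.normSq g x ≠ 0) :
    ∃ v₂ : SobolevH1 g,
      HasFDerivAt (gaussFunctional (g := g) α t) (0 : SobolevH1 g →L[ℝ] ℝ) v₂ ∧
      IsGLB {m : ℝ | ∃ Γ ∈ mountainPassPaths α t v,
        IsGreatest (range fun s => gaussFunctional α t (Γ s)) m} (gaussFunctional α t v₂) ∧
      gaussFunctional α t v < gaussFunctional α t v₂ := by
  have hI := contDiff_gaussFunctional (g := g) α t
  obtain ⟨δ, hδ, hQ⟩ := hv.exists_coercive hw ht.le htt hα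
  obtain ⟨r, hr, η, hη, hin, hsph⟩ := hv.1.exists_barrier hδ hQ
  set M := {m : ℝ | ∃ Γ ∈ mountainPassPaths α t v,
    IsGreatest (range fun s => gaussFunctional α t (Γ s)) m}
  have hmax : ∀ Γ : C(unitInterval, SobolevH1 g), ∃ m,
      IsGreatest (range fun s => gaussFunctional α t (Γ s)) m := fun Γ =>
    (isCompact_range (hI.continuous.comp Γ.continuous)).exists_isGreatest (range_nonempty _)
  obtain ⟨s, hs⟩ := exists_gaussFunctional_add_const_le hα ht v 10
  have hne : M.Nonempty := by
    let Γ : C(unitInterval, SobolevH1 g) := ⟨fun τ => v + (τ : ℝ) • const g s, by fun_prop⟩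
    obtain ⟨m, hm⟩ := hmax Γ
    refine ⟨m, Γ, ⟨?_, ?_⟩, hm⟩
    · simp [Γ]
    · simpa [Γ] using hs
  have hlow : ∀ m ∈ M, gaussFunctional α t v + η ≤ m := by
    rintro m ⟨Γ, ⟨h0, h1⟩, hm⟩
    -- the path leaves the ball of radius `r`, hence crosses its boundary
    have hout : r < ‖Γ 1 - v‖ := by
      by_contra! hle
      linarith [hin _ hle]
    have hcont : Continuous fun τ : unitInterval => ‖Γ τ - v‖ := by fun_prop
    obtain ⟨τ, hτ⟩ := mem_range_of_exists_le_of_exists_ge hcont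
      ⟨0, by rw [h0, sub_self, norm_zero]; exact hr.le⟩ ⟨1, hout.le⟩
    exact (hsph _ hτ).trans (hm.2 ⟨τ, rfl⟩)
  have hGLB : IsGLB M (sInf M) := isGLB_csInf hne ⟨_, hlow⟩
  set c := sInf M
  have hc : gaussFunctional α t v < c := (lt_add_of_pos_right _ hη).trans_le (hGLB.2 hlow)
  have hps : ∀ n : ℕ, ∃ p : SobolevH1 g, c ≤ gaussFunctional α t p ∧
      gaussFunctional α t p ≤ c + 1 / ((n : ℝ) + 1) ∧
      ‖fderiv ℝ (gaussFunctional (g := g) α t) p‖ < 2 * (1 / ((n : ℝ) + 1)) := by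
    intro n
    have hε : 0 < 1 / ((n : ℝ) + 1) := by positivity
    obtain ⟨m, ⟨Γ₀, ⟨h0, h1⟩, hm⟩, hmc⟩ := exists_lt_of_csInf_lt hne (lt_add_of_pos_right c hε)
    refine exists_almost_critical_of_minimax hI (sub_le_self _ (by norm_num : (0 : ℝ) ≤ 10)) hc hε
      (fun Γ h0 h1 => ?_) Γ₀ h0 h1 fun s => (hm.2 ⟨s, rfl⟩).trans hmc.le
    obtain ⟨m, hm⟩ := hmax Γ
    obtain ⟨s, hs⟩ := hm.1
    exact ⟨s, (hGLB.1 ⟨Γ, ⟨h0, h1⟩, hm⟩).trans hs.ge⟩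
  choose p hp1 hp2 hp3 using hps
  have hinv := tendsto_one_div_add_atTop_nhds_zero_nat (𝕜 := ℝ)
  have hpI : Tendsto (fun n => gaussFunctional α t (p n)) atTop (𝓝 c) :=
    tendsto_of_tendsto_of_tendsto_of_le_of_le tendsto_const_nhds
      (by simpa using hinv.const_add c) hp1 hp2
  have hpD : Tendsto (fun n => fderiv ℝ (gaussFunctional (g := g) α t) (p n)) atTop (𝓝 0) :=
    squeeze_zero_norm (E := SobolevH1 g →L[ℝ] ℝ) (fun n => (hp3 n).le)
      (by simpa using hinv.const_mul 2)
  obtain ⟨v₂, h2, h2'⟩ := exists_critical_of_palaisSmale α t c hpI hpD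
  exact ⟨v₂, h2', by rwa [h2], by rwa [h2]⟩

end MountainPass

/-! ### The strong maximum principle, and the mountain-pass solution -/

section StrongMaximum

open SobolevH1

variable {S : Type*} [TopologicalSpace S] [ChartedSpace ℂ S] [IsManifold 𝓘(ℂ) ω S]
  [CompactSpace S] [MeasurableSpace S] [BorelSpace S] {g : HyperbolicMetric S}
  {α : HolomorphicQuadraticDifferential S}

/-- Two solutions which agree almost everywhere have the same energy, as this is determined by the
equation. -/
theorem IsGaussSolution.gaussFunctional_eq {t : ℝ} {v w : SobolevH1 g}
    (hv : IsGaussSolution α t v) (hw : IsGaussSolution α t w) (h : v.fn =ᵐ[g.area] w.fn) :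
    gaussFunctional α t v = gaussFunctional α t w := by
  have hE : ∀ φ, v.gradPairing φ = w.gradPairing φ := fun φ => by
    rw [hv φ, hw φ]
    refine integral_congr_ae ?_
    filter_upwards [h] with x hx
    rw [hx]
  have e1 : ∫ x, α.normSq g x * Real.exp (v.fn x) ∂g.area =
      ∫ x, α.normSq g x * Real.exp (w.fn x) ∂g.area := by
    refine integral_congr_ae ?_
    filter_upwards [h] with x hx
    rw [hx]
  have e2 : ∫ x, Real.exp (-v.fn x) ∂g.area = ∫ x, Real.exp (-w.fn x) ∂g.area := by
    refine integral_congr_ae ?_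
    filter_upwards [h] with x hx
    rw [hx]
  rw [gaussFunctional, gaussFunctional, hE, gradPairing_comm w v, hE, e1, e2, integral_congr_ae h]

theorem hasDerivAt_sub_sqrt {a : ℝ} (ha : 0 < a) (x : ℝ) :
    HasDerivAt (fun x : ℝ => x - √(x ^ 2 + a)) (1 - x / √(x ^ 2 + a)) x :=
  (hasDerivAt_id x).sub (hasDerivAt_sqrt_sq_add ha x)

theorem hasDerivAt_arsinh_div {a : ℝ} (ha : 0 < a) (x : ℝ) :
    HasDerivAt (fun x : ℝ => √(a / 2) * Real.arsinh (x / √a)) (√(a / 2) / √(x ^ 2 + a)) x := by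
  have h0 := Real.sqrt_pos.2 ha
  have h := ((Real.hasDerivAt_arsinh (x / √a)).comp x
    ((hasDerivAt_id x).div_const (√a))).const_mul (√(a / 2))
  refine h.congr_deriv ?_
  have e : √(x ^ 2 + a) = √(1 + (x / √a) ^ 2) * √a := by
    rw [← Real.sqrt_mul (by positivity), div_pow, Real.sq_sqrt ha.le, add_mul,
      div_mul_cancel₀ _ ha.ne', one_mul, add_comm]
  rw [e]
  have h1 : 0 < √(1 + (x / √a) ^ 2) := Real.sqrt_pos.2 (by positivity)
  field_simp

theorem abs_le_sqrt_sq_add {a : ℝ} (ha : 0 < a) (x : ℝ) : |x| ≤ √(x ^ 2 + a) :=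
  Real.abs_le_sqrt (by linarith)

/-- The test function `√(u² + a) - u` in a linear differential inequality bounds the energy of
`arsinh (u / √a)`, uniformly in `a`. -/
theorem exists_arsinh_energy_le {u : SobolevH1 g} {V : S → ℝ} (hV : Integrable V g.area)
    (hVnn : ∀ x, 0 ≤ V x) (hunn : ∀ᵐ x ∂g.area, 0 ≤ u.fn x)
    (hu : ∀ φ : SobolevH1 g, (∀ᵐ x ∂g.area, φ.fn x ≤ 0) → ∃ f : S → ℝ,
      (∀ᵐ x ∂g.area, f x ≤ V x * u.fn x * (-φ.fn x)) ∧ Integrable f g.area ∧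
        u.gradPairing φ = ∫ x, f x ∂g.area) {a : ℝ} (ha : 0 < a) :
    ∃ ζ : SobolevH1 g, ζ.fn =ᵐ[g.area] (fun x => Real.arsinh (u.fn x / √a)) ∧
      ζ.gradPairing ζ ≤ 2 * ∫ x, V x ∂g.area := by
  have hs : ∀ x : ℝ, 0 < √(x ^ 2 + a) := fun x => Real.sqrt_pos.2 (by positivity)
  have hsq : ∀ x : ℝ, √(x ^ 2 + a) ^ 2 = x ^ 2 + a := fun x => Real.sq_sqrt (by positivity)
  have hxs := abs_le_sqrt_sq_add ha
  have hF : ContDiff ℝ ∞ fun x : ℝ => x - √(x ^ 2 + a) := contDiff_id.sub (contDiff_sqrt_sq_add ha)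
  have hG : ContDiff ℝ ∞ fun x : ℝ => √(a / 2) * Real.arsinh (x / √a) :=
    contDiff_const.mul (Real.contDiff_arsinh.comp (contDiff_id.div_const _))
  have hFL : ∀ x, |deriv (fun x : ℝ => x - √(x ^ 2 + a)) x| ≤ 2 := by
    intro x
    rw [(hasDerivAt_sub_sqrt ha x).deriv]
    have h1 : |x / √(x ^ 2 + a)| ≤ 1 := by
      rw [abs_div, abs_of_pos (hs x)]
      exact (div_le_one (hs x)).2 (hxs x)
    rw [abs_le] at h1 ⊢
    constructor <;> linarith
  have hGL : ∀ x, |deriv (fun x : ℝ => √(a / 2) * Real.arsinh (x / √a)) x| ≤ 2 := by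
    intro x
    rw [(hasDerivAt_arsinh_div ha x).deriv, abs_of_nonneg (by positivity), div_le_iff₀ (hs x)]
    have : √(a / 2) ≤ √(x ^ 2 + a) := Real.sqrt_le_sqrt (by nlinarith)
    linarith [hs x]
  have hFG : ∀ x, deriv (fun x : ℝ => √(a / 2) * Real.arsinh (x / √a)) x ^ 2 ≤
      deriv (fun x : ℝ => x - √(x ^ 2 + a)) x := by
    intro x
    rw [(hasDerivAt_sub_sqrt ha x).deriv, (hasDerivAt_arsinh_div ha x).deriv, div_pow,
      Real.sq_sqrt (by positivity), div_le_iff₀ (by have := hs x; positivity), sub_mul,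
      div_mul_eq_mul_div, sq, ← mul_assoc, ← mul_assoc, mul_div_cancel_right₀ _ (hs x).ne', one_mul]
    -- that is, `a / 2 ≤ s (s - x)` for `s² = x² + a`
    nlinarith [hsq x, sq_nonneg (√(x ^ 2 + a) - x)]
  obtain ⟨φ, γ, hφ, hγ, hE⟩ := u.exists_comp hF hG hFL hGL hFG
  have hφle : ∀ᵐ x ∂g.area, φ.fn x ≤ 0 := by
    filter_upwards [hφ] with x hx
    rw [hx]
    linarith [(abs_le.1 (hxs (u.fn x))).2]
  obtain ⟨f, hf, hfi, hfu⟩ := hu φ hφle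
  have hfle : ∫ x, f x ∂g.area ≤ ∫ x, a * V x ∂g.area := by
    refine integral_mono_ae hfi (hV.const_mul a) ?_
    filter_upwards [hf, hφ, hunn] with x h1 h2 h3
    refine h1.trans ?_
    rw [h2, mul_assoc, mul_comm a]
    refine mul_le_mul_of_nonneg_left ?_ (hVnn x)
    have h4 := hsq (u.fn x)
    have h5 := (abs_le.1 (hxs (u.fn x))).2
    nlinarith
  have ha2 : 0 < √(a / 2) := Real.sqrt_pos.2 (by positivity)
  refine ⟨(√(a / 2))⁻¹ • γ, ?_, ?_⟩
  · filter_upwards [hγ, fn_smul (√(a / 2))⁻¹ γ] with x h1 h2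
    rw [h2, Pi.smul_apply, h1, smul_eq_mul, inv_mul_cancel_left₀ ha2.ne']
  · rw [gradPairing_smul_left, gradPairing_smul_right, ← mul_assoc, ← mul_inv,
      Real.mul_self_sqrt (by positivity), inv_div, div_mul_eq_mul_div, div_le_iff₀ ha]
    rw [integral_const_mul] at hfle
    linarith

/-- The strong maximum principle for `-Δu + V u ≥ 0`, `u ≥ 0`, with `V` only integrable: if `u`
vanished on a set of positive measure, then by the Poincaré inequality the functions
`arsinh (u / √a)` would be bounded in `L¹(S)` as `a → 0`. -/
theorem ae_pos_or_ae_eq_zero [ConnectedSpace S] {u : SobolevH1 g} {V : S → ℝ}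
    (hV : Integrable V g.area) (hVnn : ∀ x, 0 ≤ V x) (hunn : ∀ᵐ x ∂g.area, 0 ≤ u.fn x)
    (hu : ∀ φ : SobolevH1 g, (∀ᵐ x ∂g.area, φ.fn x ≤ 0) → ∃ f : S → ℝ,
      (∀ᵐ x ∂g.area, f x ≤ V x * u.fn x * (-φ.fn x)) ∧ Integrable f g.area ∧
        u.gradPairing φ = ∫ x, f x ∂g.area) :
    (∀ᵐ x ∂g.area, 0 < u.fn x) ∨ u.fn =ᵐ[g.area] 0 := by
  obtain ⟨C, hC, hP⟩ := exists_poincare g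
  have hA := area_real_univ_pos g
  set A := g.area.real univ
  rcases eq_or_ne (g.area {x | u.fn x = 0}) 0 with hZ | hZ
  · left
    have hZ' : ∀ᵐ x ∂g.area, ¬ u.fn x = 0 := by
      rw [ae_iff]
      simpa only [not_not] using hZ
    filter_upwards [hZ', hunn] with x h1 h2 using h2.lt_of_ne' h1
  right
  set z := g.area.real {x | u.fn x = 0}
  have hz : 0 < z := ENNReal.toReal_pos hZ (measure_ne_top _ _)
  set B := C * (2 * ∫ x, V x ∂g.area)
  -- a bound of the integrals of `arsinh (u / √a)` which does not depend on `a`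
  have hbound : ∀ a : ℝ, 0 < a → ∃ ζ : SobolevH1 g,
      ζ.fn =ᵐ[g.area] (fun x => Real.arsinh (u.fn x / √a)) ∧
        ∫ x, ζ.fn x ∂g.area ≤ √(B / z) * A := by
    intro a ha
    obtain ⟨ζ, hζ, hE⟩ := exists_arsinh_energy_le hV hVnn hunn hu ha
    refine ⟨ζ, hζ, ?_⟩
    set c := (∫ x, ζ.fn x ∂g.area) / A with hc
    have hcA : c * A = ∫ x, ζ.fn x ∂g.area := div_mul_cancel₀ _ hA.ne'
    have h0 : ∫ x, (ζ - const g c).fn x ∂g.area = 0 := by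
      rw [integral_fn_sub, integral_const_fn, hcA, sub_self]
    have h1 := hP _ h0
    rw [gradPairing_sub_left, gradPairing_sub_right, gradPairing_const_left,
      gradPairing_const_right, sub_zero, sub_zero, norm_toL2_sq] at h1
    have h2 := mul_meas_ge_le_integral_of_nonneg
      (ae_of_all g.area fun x => sq_nonneg ((ζ - const g c).fn x))
      (ζ - const g c).memLp_fn.integrable_sq (c ^ 2)
    have h3 : z ≤ g.area.real {x | c ^ 2 ≤ (ζ - const g c).fn x ^ 2} := by
      refine ENNReal.toReal_mono (measure_ne_top _ _) (measure_mono_ae ?_)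
      filter_upwards [hζ, fn_sub ζ (const g c), fn_const g c] with x e1 e2 e3 hx
      change c ^ 2 ≤ (ζ - const g c).fn x ^ 2
      rw [e2, Pi.sub_apply, e1, e3, show u.fn x = 0 from hx]
      simp
    have h4 : c ^ 2 * z ≤ B :=
      (mul_le_mul_of_nonneg_left h3 (sq_nonneg c)).trans
        (h2.trans (h1.trans (mul_le_mul_of_nonneg_left hE hC)))
    rw [← hcA]
    exact mul_le_mul_of_nonneg_right (Real.le_sqrt_of_sq_le ((le_div_iff₀ hz).2 h4)) hA.le
  have hnull : ∀ η : ℝ, 0 < η → g.area {x | η ≤ u.fn x} = 0 := by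
    intro η hη
    by_contra hne
    set y := g.area.real {x | η ≤ u.fn x}
    have hy : 0 < y := ENNReal.toReal_pos hne (measure_ne_top _ _)
    set T := √(B / z) * A / y + 1
    have hT : 0 < T := by positivity
    have hsT : 0 < Real.sinh T := Real.sinh_pos_iff.2 hT
    -- choose `a` so that `arsinh (η / √a) = T`
    obtain ⟨ζ, hζ, hle⟩ := hbound ((η / Real.sinh T) ^ 2) (by positivity)
    rw [Real.sqrt_sq (by positivity)] at hζ
    have h1 := mul_meas_ge_le_integral_of_nonneg (μ := g.area) (f := ζ.fn) (by
      filter_upwards [hζ, hunn] with x h1 h2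
      rw [h1, Pi.zero_apply, Real.arsinh_nonneg_iff]
      positivity) ζ.integrable_fn T
    have h2 : y ≤ g.area.real {x | T ≤ ζ.fn x} := by
      refine ENNReal.toReal_mono (measure_ne_top _ _) (measure_mono_ae ?_)
      filter_upwards [hζ] with x e1 hx
      change T ≤ ζ.fn x
      rw [e1, ← Real.arsinh_sinh T, Real.arsinh_le_arsinh, div_div_eq_mul_div, le_div_iff₀ hη,
        mul_comm, Real.arsinh_sinh]
      exact mul_le_mul_of_nonneg_right (show η ≤ u.fn x from hx) hsT.le
    have h3 := (mul_le_mul_of_nonneg_left h2 hT.le).trans (h1.trans hle)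
    simp only [T, add_mul, one_mul, div_mul_cancel₀ _ hy.ne'] at h3
    linarith
  have hall : ∀ᵐ x ∂g.area, ∀ n : ℕ, ¬ 1 / ((n : ℝ) + 1) ≤ u.fn x := by
    rw [ae_all_iff]
    intro n
    rw [ae_iff]
    simpa only [not_not] using hnull _ (by positivity : (0 : ℝ) < 1 / ((n : ℝ) + 1))
  filter_upwards [hall, hunn] with x h1 h2
  refine le_antisymm (not_lt.1 fun h => ?_) h2
  obtain ⟨n, hn⟩ := exists_nat_one_div_lt h
  exact h1 n hn.le

/-- Two ordered solutions are equal, or one is strictly larger than the other. -/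
theorem IsGaussSolution.ae_lt_or_ae_eq [ConnectedSpace S] {t : ℝ} {v w : SobolevH1 g}
    (hv : IsGaussSolution α t v) (hw : IsGaussSolution α t w)
    (hle : ∀ᵐ x ∂g.area, v.fn x ≤ w.fn x) :
    (∀ᵐ x ∂g.area, v.fn x < w.fn x) ∨ v.fn =ᵐ[g.area] w.fn := by
  have h := ae_pos_or_ae_eq_zero (u := w - v) (V := fun x => 2 * Real.exp (-v.fn x))
    (v.integrable_exp_neg.const_mul 2) (fun x => by positivity)
    (by filter_upwards [fn_sub w v, hle] with x h1 h2; rw [h1, Pi.sub_apply]; linarith)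
    fun φ hφ => ?_
  · refine h.imp (fun h => ?_) fun h => ?_
    · filter_upwards [h, fn_sub w v] with x h1 h2
      rw [h2, Pi.sub_apply] at h1
      linarith
    · filter_upwards [h, fn_sub w v] with x h1 h2
      rw [h2, Pi.sub_apply, Pi.zero_apply] at h1
      linarith
  · refine ⟨_, ?_, (integrable_nonlinearity_mul α t w φ).sub (integrable_nonlinearity_mul α t v φ),
      ?_⟩
    · filter_upwards [fn_sub w v, hle, hφ] with x h1 h2 h3
      rw [h1, Pi.sub_apply, Pi.sub_apply, ← sub_mul, mul_neg, ← neg_mul]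
      refine mul_le_mul_of_nonpos_right ?_ h3
      have h4 := mul_le_mul_of_nonneg_left (Real.add_one_le_exp (v.fn x - w.fn x))
        (Real.exp_pos (-v.fn x)).le
      rw [← Real.exp_add, show -v.fn x + (v.fn x - w.fn x) = -w.fn x by ring] at h4
      have h5 : 2 * t ^ 2 * α.normSq g x * Real.exp (v.fn x) ≤
          2 * t ^ 2 * α.normSq g x * Real.exp (w.fn x) :=
        mul_le_mul_of_nonneg_left (Real.exp_le_exp.2 h2)
          (mul_nonneg (by positivity) (α.normSq_nonneg g x))
      linarith
    · rw [gradPairing_sub_left, hw φ, hv φ]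
      exact (integral_sub (integrable_nonlinearity_mul α t w φ)
        (integrable_nonlinearity_mul α t v φ)).symm

theorem IsStableGaussSolution.exists_isMountainPassSolution [ConnectedSpace S] {t t' : ℝ}
    {v w : SobolevH1 g} (hv : IsStableGaussSolution α t v) (hw : IsGaussSolution α t' w)
    (ht : 0 < t) (htt : t < t') (hα : ∃ x, α.normSq g x ≠ 0) :
    ∃ v₂ : SobolevH1 g, IsMountainPassSolution α t v v₂ := by
  obtain ⟨v₂, hcrit, hGLB, hlt⟩ := hv.exists_minimax_critical hw ht htt hα
  have hsol : IsGaussSolution α t v₂ := (isGaussSolution_iff_fderiv α t v₂).2 hcrit.fderiv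
  have hle := hv.fn_le hsol ht.le le_rfl
  have hne : ¬ v.fn =ᵐ[g.area] v₂.fn := fun h => hlt.ne (hv.1.gaussFunctional_eq hsol h)
  refine ⟨v₂, hcrit, hsol, fun hst => hne ?_, (hv.1.ae_lt_or_ae_eq hsol hle).resolve_right hne,
    hGLB, hlt⟩
  filter_upwards [hle, hst.fn_le hv.1 ht.le le_rfl] with x h1 h2 using le_antisymm h1 h2

end StrongMaximum

theorem mainTheorem8 {S : Type*} [TopologicalSpace S] [T2Space S] [CompactSpace S]
    [ConnectedSpace S] [ChartedSpace ℂ S] [IsManifold 𝓘(ℂ) ω S]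
    [MeasurableSpace S] [BorelSpace S]
    (g : HyperbolicMetric S) (α : HolomorphicQuadraticDifferential S) :
    -- the functional is well defined (all its integrals converge) and of class `C¹` on `H¹(S)`
    (∀ v : SobolevH1 g, Integrable v.fn g.area ∧
      Integrable (fun x => Real.exp (-v.fn x)) g.area ∧
      Integrable (fun x => α.normSq g x * Real.exp (v.fn x)) g.area) ∧
    (∀ t : ℝ, ContDiff ℝ 1 (gaussFunctional (g := g) α t)) ∧
    -- the Palais-Smale condition; every Palais-Smale level is a critical value
    (∀ (t c : ℝ) (v : ℕ → SobolevH1 g),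
      Tendsto (fun n => gaussFunctional α t (v n)) atTop (𝓝 c) →
      Tendsto (fun n => fderiv ℝ (gaussFunctional (g := g) α t) (v n)) atTop (𝓝 0) →
      (∃ (w : SobolevH1 g) (k : ℕ → ℕ), StrictMono k ∧
        Tendsto (fun n => v (k n)) atTop (𝓝 w)) ∧
      ∃ w : SobolevH1 g, gaussFunctional α t w = c ∧
        HasFDerivAt (gaussFunctional (g := g) α t) (0 : SobolevH1 g →L[ℝ] ℝ) w) ∧
    -- the mountain-pass solution
    ((∃ x, α.normSq g x ≠ 0) → ∀ t : ℝ, 0 < t → t < maximalParameter g α →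
      ∀ v₁ : SobolevH1 g, IsStableGaussSolution α t v₁ →
        ∃ v₂ : SobolevH1 g, IsMountainPassSolution α t v₁ v₂) := by
  refine ⟨fun v => ⟨v.integrable_fn, v.integrable_exp_neg, integrable_normSq_exp α v⟩,
    contDiff_gaussFunctional α, fun t c v hI hD =>
      ⟨exists_subseq_tendsto_of_palaisSmale α t c hI hD,
        exists_critical_of_palaisSmale α t c hI hD⟩,
    fun hα t ht htmax v₁ hv₁ => ?_⟩
  have hne : {t : ℝ | 0 ≤ t ∧ ∃ v : SobolevH1 g, IsGaussSolution α t v}.Nonempty :=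
    ⟨t, ht.le, v₁, hv₁.1⟩
  obtain ⟨t', ⟨-, w, hw⟩, htt⟩ := exists_lt_of_lt_csSup hne htmax
  exact hv₁.exists_isMountainPassSolution hw ht htt hα
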